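/- Let $k$ be an algebraically closed field of characteristic $0$, let $X$ be a smooth connected projective curve over $k$, and let $\mathrm{Aff}$ be the category of affine $k$-schemes of finite type, with its Zariski topology. All products and morphisms are over $k$. **Generic maps.** For a $k$-scheme $S$, an $S$-family of domains in $X$ is an open $U\subseteq S\times X$ such that for every $T\to S$ the preimage of $U$ in $T\times X$ is dense. For a $k$-scheme $Y$, let $\mathrm{GMap}(X,Y):\mathrm{Aff}^{op}\to\mathrm{Set}$ be the presheaf with $\mathrm{GMap}(X,Y)(S)=\mathrm{colim}_U\,\mathrm{Hom}_k(U,Y)$, where $U$ runs over the $S$-families of domains; two maps are identified if they agree on a smaller $S$-family of domains. **Quasi-maps.** Let $\mathrm{QMap}(X,\mathbb P^n)(S)$ be the set of isomorphism classes of pairs $(\mathcal L,\ \mathcal L\hookrightarrow\mathcal O_{S\times X}^{n+1})$ with $\mathcal L$ a line bundle on $S\times X$ and the map an injection of sheaves with $S$-flat cokernel. For a closed subscheme $Z\subseteq\mathbb P^n$ with graded ideal $I_Z\subseteq k[x_0,\dots,x_n]$, let $\mathrm{QMap}(X,Z)\subseteq\mathrm{QMap}(X,\mathbb P^n)$ consist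 of those pairs for which the composite $\mathcal O_{S\times X}\otimes I_Z\to\mathrm{Sym}\,\mathcal O_{S\times X}^{n+1}\to\mathrm{Sym}\,\mathcal L^\vee$ vanishes. For a locally closed subscheme $Y\hookrightarrow\mathbb P^n$ with scheme-theoretic closure $\overline Y$, let $\mathrm{QMap}(X,Y)\subseteq\mathrm{QMap}(X,\overline Y)$ be the complement of the quasi-maps to $\overline Y\setminus Y$: an $S$-point of $\mathrm{QMap}(X,\overline Y)$ belongs to it iff its pullback to every nonempty $T\to S$ in $\mathrm{Aff}$ is not a $T$-point of $\mathrm{QMap}(X,\overline Y\setminus Y)$. The regularity domain of a quasi-map is the open set where $\mathcal L\to\mathcal O^{n+1}$ is a sub-bundle embedding, i.e. injective on fibres. Let $\mathcal E_Y(S)\subseteq \mathrm{QMap}(X,Y)(S)^2$ be the set of pairs of quasi-maps whose subsheaves of $\mathcal O_{S\times X}^{n+1}$ agree over the intersection of their regularity domains, and let $\mathrm{QMap}(X,Y)/\mathcal E_Y$ be the presheaf $S\mapsto \mathrm{QMap}(X,Y)(S)/\mathcal E_Y(S)$. **Proposition.** Let $Y\hookrightarrow\mathbb P^n$ be a locally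 closed subscheme over $k$. 1. $\mathcal E_Y(S)$ is an equivalence relation for every $S$. 2. There is a unique map of presheaves $\eta:\mathrm{QMap}(X,Y)\to\mathrm{GMap}(X,Y)$ that sends each quasi-map $\mathcal L\hookrightarrow\mathcal O_{S\times X}^{n+1}$ to the class of a map $\varphi:U\to Y$, where $U$ is an $S$-family of domains contained in the regularity domain and $\mathcal L|_U$ is the pullback of the tautological sub-bundle $\mathcal O(-1)\subseteq\mathcal O^{n+1}$ along $U\xrightarrow{\varphi}Y\hookrightarrow\mathbb P^n$. 3. $\eta$ induces a map of presheaves $\Phi:\mathrm{QMap}(X,Y)/\mathcal E_Y\to\mathrm{GMap}(X,Y)$, which becomes an isomorphism after Zariski sheafification. 4. Consequently, up to isomorphism compatible with the maps to the sheafification of $\mathrm{GMap}(X,Y)$, the Zariski sheafification of $\mathrm{QMap}(X,Y)/\mathcal E_Y$ does not depend on the embedding of $Y$ as a locally closed subscheme of a projective space. -/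

import Mathlib

open CategoryTheory CategoryTheory.Limits AlgebraicGeometry Opposite TopologicalSpace
universe u
noncomputable section
namespace GenericMaps

variable (k : Type u) [Field k]

/-- Schemes over the field `k`. -/
abbrev Sch := Over (Spec (CommRingCat.of k))

/-- Affine schemes of finite type over `k` (an affine `S` is quasi-compact over `k`, so
"locally of finite type" is "of finite type"). -/
abbrev IsAffFT : ObjectProperty (Sch k) :=
  fun S => IsAffine S.left ∧ LocallyOfFiniteType S.hom

/-- The category of affine schemes of finite type over `k`. -/
abbrev Aff := (IsAffFT k).FullSubcategory

/-- The Zariski topology on `Aff k`: a sieve on `S` is covering if the open immersions belonging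
to it jointly cover `S`. -/
def zariski : GrothendieckTopology (Aff k) where
  sieves S := {R | ∀ s : S.obj.left, ∃ (T : Aff k) (g : T ⟶ S), R g ∧
    IsOpenImmersion g.hom.left ∧ s ∈ Set.range g.hom.left}
  top_mem' S s := ⟨S, 𝟙 S, trivial, by
    change IsOpenImmersion (𝟙 S.obj.left); infer_instance, s, rfl⟩
  pullback_stable' := by
    intro S S' R h hR s
    obtain ⟨T, g, hg, hgo, t, ht⟩ := hR (h.hom.left s)
    have := S.property.1
    have := S'.property.1
    have := T.property.1
    let P : Sch k := Over.mk (pullback.fst h.hom.left g.hom.left ≫ S'.obj.hom)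
    have hP : IsAffFT k P := by
      refine ⟨inferInstanceAs (IsAffine (pullback h.hom.left g.hom.left)), ?_⟩
      have := S'.property.2
      exact inferInstanceAs (LocallyOfFiniteType
        (pullback.fst h.hom.left g.hom.left ≫ S'.obj.hom))
    let a : P ⟶ S'.obj := Over.homMk (pullback.fst h.hom.left g.hom.left) rfl
    let b : P ⟶ T.obj := Over.homMk (pullback.snd h.hom.left g.hom.left) (by
      have h1 := Over.w g.hom
      have h2 := Over.w h.hom
      rw [← h1, ← pullback.condition_assoc, h2]; rfl)
    refine ⟨⟨P, hP⟩, ⟨a⟩, ?_, ?_, ?_⟩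
    · have : (⟨a⟩ : (⟨P, hP⟩ : Aff k) ⟶ S') ≫ h = (⟨b⟩ : (⟨P, hP⟩ : Aff k) ⟶ T) ≫ g := by
        ext : 2
        exact pullback.condition
      change R (_ ≫ h)
      rw [this]
      exact R.downward_closed hg _
    · exact inferInstanceAs (IsOpenImmersion (pullback.fst h.hom.left g.hom.left))
    · change s ∈ Set.range (pullback.fst h.hom.left g.hom.left)
      rw [Scheme.Pullback.range_fst]
      exact ⟨t, ht⟩
  transitive' := by
    intro S R hR R' hR' s
    obtain ⟨T, g, hg, hgo, t, rfl⟩ := hR s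
    obtain ⟨T', g', hg', hgo', t', rfl⟩ := hR' hg t
    refine ⟨T', g' ≫ g, hg', ?_, t', rfl⟩
    exact inferInstanceAs (IsOpenImmersion (g'.hom.left ≫ g.hom.left))

variable {k}

/-- The product `S × X` over `k`. -/
abbrev prodOver (S X : Sch k) : Scheme.{u} := pullback S.hom X.hom

/-- The structure map `S × X ⟶ Spec k`. -/
abbrev prodStr (S X : Sch k) : prodOver S X ⟶ Spec (CommRingCat.of k) :=
  pullback.fst S.hom X.hom ≫ S.hom

/-- The map `g × id : T × X ⟶ S × X`. -/
def prodMap {T S : Sch k} (g : T ⟶ S) (X : Sch k) : prodOver T X ⟶ prodOver S X :=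
  pullback.lift (pullback.fst _ _ ≫ g.left) (pullback.snd _ _) (by
    rw [Category.assoc, Over.w g, pullback.condition])

lemma prodMap_fst {T S : Sch k} (g : T ⟶ S) (X : Sch k) :
    prodMap g X ≫ pullback.fst S.hom X.hom = pullback.fst T.hom X.hom ≫ g.left :=
  pullback.lift_fst _ _ _

lemma prodMap_snd {T S : Sch k} (g : T ⟶ S) (X : Sch k) :
    prodMap g X ≫ pullback.snd S.hom X.hom = pullback.snd T.hom X.hom :=
  pullback.lift_snd _ _ _

lemma prodMap_id (S X : Sch k) : prodMap (𝟙 S) X = 𝟙 _ := by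
  apply pullback.hom_ext
  · rw [prodMap_fst]; simp
  · rw [prodMap_snd]; simp

lemma prodMap_comp {R T S : Sch k} (h : R ⟶ T) (g : T ⟶ S) (X : Sch k) :
    prodMap (h ≫ g) X = prodMap h X ≫ prodMap g X := by
  apply pullback.hom_ext
  · rw [prodMap_fst, Category.assoc, prodMap_fst, ← Category.assoc, prodMap_fst, Category.assoc,
      Over.comp_left]
  · rw [prodMap_snd, Category.assoc, prodMap_snd, prodMap_snd]

lemma prodMap_str {T S : Sch k} (g : T ⟶ S) (X : Sch k) :
    prodMap g X ≫ prodStr S X = prodStr T X := by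
  rw [prodStr, ← Category.assoc, prodMap_fst, Category.assoc, Over.w g]

lemma prodMap_isPullback {T S : Sch k} (g : T ⟶ S) (X : Sch k) :
    IsPullback (prodMap g X) (pullback.fst T.hom X.hom) (pullback.fst S.hom X.hom) g.left := by
  have h1 : IsPullback (pullback.snd T.hom X.hom) (pullback.fst T.hom X.hom) X.hom T.hom :=
    (IsPullback.of_hasPullback _ _).flip
  have h2 : IsPullback (pullback.snd S.hom X.hom) (pullback.fst S.hom X.hom) X.hom S.hom :=
    (IsPullback.of_hasPullback _ _).flip
  refine IsPullback.of_right (h₁₂ := pullback.snd S.hom X.hom) (h₂₂ := S.hom) (v₁₃ := X.hom)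
    ?_ (prodMap_fst g X) h2
  rw [Over.w g, prodMap_snd]
  exact h1

/-- An open `U ⊆ S × X` is an `S`-family of domains in `X` if it is universally dense over `S`: for
every `T ⟶ S`, its preimage in `T × X` is dense. -/
def IsDomainFamily {S X : Sch k} (U : (prodOver S X).Opens) : Prop :=
  ∀ (T : Sch k) (g : T ⟶ S), Dense ((prodMap g X ⁻¹ᵁ U : (prodOver T X).Opens) : Set (prodOver T X))

lemma IsDomainFamily.inf {S X : Sch k} {U V : (prodOver S X).Opens} (hU : IsDomainFamily U)
    (hV : IsDomainFamily V) : IsDomainFamily (U ⊓ V) := fun T g =>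
  (hU T g).inter_of_isOpen_left (hV T g) (prodMap g X ⁻¹ᵁ U).isOpen

lemma IsDomainFamily.preimage {S T X : Sch k} {U : (prodOver S X).Opens} (hU : IsDomainFamily U)
    (g : T ⟶ S) : IsDomainFamily (prodMap g X ⁻¹ᵁ U) := fun R h => by
  have := hU R (h ≫ g)
  rwa [prodMap_comp] at this

/-- A `k`-morphism to `Y` defined on an `S`-family of domains in `X`. -/
structure GenMap (X Y S : Sch k) where
  dom : (prodOver S X).Opens
  isDomainFamily : IsDomainFamily dom
  hom : (dom : Scheme.{u}) ⟶ Y.left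
  w : hom ≫ Y.hom = dom.ι ≫ prodStr S X

/-- Two such morphisms are identified if they agree on a smaller `S`-family of domains. -/
instance GenMap.setoid (X Y S : Sch k) : Setoid (GenMap X Y S) where
  r φ ψ := ∃ (W : (prodOver S X).Opens) (hφ : W ≤ φ.dom) (hψ : W ≤ ψ.dom), IsDomainFamily W ∧
    (prodOver S X).homOfLE hφ ≫ φ.hom = (prodOver S X).homOfLE hψ ≫ ψ.hom
  iseqv :=
    { refl := fun φ => ⟨φ.dom, le_rfl, le_rfl, φ.isDomainFamily, rfl⟩
      symm := fun ⟨W, h, h', hW, e⟩ => ⟨W, h', h, hW, e.symm⟩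
      trans := by
        rintro φ ψ χ ⟨W, h, h', hW, e⟩ ⟨W', j, j', hW', e'⟩
        refine ⟨W ⊓ W', inf_le_left.trans h, inf_le_right.trans j', hW.inf hW', ?_⟩
        have e1 := congrArg (fun t => (prodOver S X).homOfLE (inf_le_left : W ⊓ W' ≤ W) ≫ t) e
        have e2 := congrArg (fun t => (prodOver S X).homOfLE (inf_le_right : W ⊓ W' ≤ W') ≫ t) e'
        simp only [Scheme.homOfLE_homOfLE_assoc] at e1 e2
        exact e1.trans e2 }

/-- Base change of a generically defined map along `g : T ⟶ S`. -/
def GenMap.pullback {X Y S T : Sch k} (g : T ⟶ S) (φ : GenMap X Y S) : GenMap X Y T where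
  dom := prodMap g X ⁻¹ᵁ φ.dom
  isDomainFamily := φ.isDomainFamily.preimage g
  hom := prodMap g X ∣_ φ.dom ≫ φ.hom
  w := by
    rw [Category.assoc, φ.w, morphismRestrict_ι_assoc, prodMap_str]

lemma GenMap.pullback_equiv {X Y S T : Sch k} (g : T ⟶ S) {φ ψ : GenMap X Y S} (h : φ ≈ ψ) :
    φ.pullback g ≈ ψ.pullback g := by
  obtain ⟨W, h, h', hW, e⟩ := h
  have key : ∀ {U : (prodOver S X).Opens} (hU : W ≤ U),
      (prodOver T X).homOfLE (show prodMap g X ⁻¹ᵁ W ≤ prodMap g X ⁻¹ᵁ U from fun _ hx => hU hx) ≫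
        prodMap g X ∣_ U = prodMap g X ∣_ W ≫ (prodOver S X).homOfLE hU := by
    intro U hU
    rw [← cancel_mono U.ι]
    simp
  refine ⟨prodMap g X ⁻¹ᵁ W, fun _ hx => h hx, fun _ hx => h' hx, hW.preimage g, ?_⟩
  dsimp only [GenMap.pullback]
  rw [reassoc_of% (key h), reassoc_of% (key h'), e]

lemma GenMap.pullback_id {X Y S : Sch k} (φ : GenMap X Y S) : φ.pullback (𝟙 S) ≈ φ := by
  have h : prodMap (𝟙 S) X ⁻¹ᵁ φ.dom ≤ φ.dom := by rw [prodMap_id]; exact le_rfl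
  refine ⟨prodMap (𝟙 S) X ⁻¹ᵁ φ.dom, le_rfl, h, φ.isDomainFamily.preimage _, ?_⟩
  have key : prodMap (𝟙 S) X ∣_ φ.dom = (prodOver S X).homOfLE h := by
    rw [← cancel_mono φ.dom.ι, morphismRestrict_ι, Scheme.homOfLE_ι, prodMap_id, Category.comp_id]
  dsimp only [GenMap.pullback]
  rw [key]
  simp

lemma GenMap.pullback_comp {X Y R S T : Sch k} (h : R ⟶ T) (g : T ⟶ S) (φ : GenMap X Y S) :
    φ.pullback (h ≫ g) ≈ (φ.pullback g).pullback h := by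
  have hle : prodMap (h ≫ g) X ⁻¹ᵁ φ.dom ≤ prodMap h X ⁻¹ᵁ (prodMap g X ⁻¹ᵁ φ.dom) := by
    rw [prodMap_comp]; exact le_rfl
  refine ⟨prodMap (h ≫ g) X ⁻¹ᵁ φ.dom, le_rfl, hle, φ.isDomainFamily.preimage _, ?_⟩
  have key : prodMap (h ≫ g) X ∣_ φ.dom = (prodOver R X).homOfLE hle ≫
      prodMap h X ∣_ (prodMap g X ⁻¹ᵁ φ.dom) ≫ prodMap g X ∣_ φ.dom := by
    rw [← cancel_mono φ.dom.ι]
    simp [prodMap_comp]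
  dsimp only [GenMap.pullback]
  rw [key]
  simp

/-- The presheaf of generically defined maps from `X` to `Y`. Its value at `S` is the filtered
colimit, over the poset of `S`-families of domains `U ⊆ S × X` ordered by reverse inclusion, of
`Hom_k(U, Y)`; this is the pointwise formula for the left Kan extension of `(S, U) ↦ Hom_k(U, Y)`
along `(S, U) ↦ S`. -/
def GMap (X Y : Sch k) : (Aff k)ᵒᵖ ⥤ Type u where
  obj S := Quotient (GenMap.setoid X Y S.unop.obj)
  map g := ↾(Quotient.map (GenMap.pullback g.unop.hom) fun _ _ h => GenMap.pullback_equiv _ h)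
  map_id S := by
    ext x
    induction x using Quotient.inductionOn with | _ φ
    exact Quotient.sound φ.pullback_id
  map_comp g h := by
    ext x
    induction x using Quotient.inductionOn with | _ φ
    exact Quotient.sound (φ.pullback_comp h.unop.hom g.unop.hom)

/-- A family of submodules `L_z ⊆ 𝒪_{Z,z}^m`, one for each point `z`. Subsheaves of `𝒪_Z^m` are
recorded by their stalks; that the stalks fit together to a subsheaf is part of
`IsFlatInvertible` below, which asks for local generators. -/
def StalkFamily (Z : Scheme.{u}) (m : ℕ) : Type u :=
  ∀ z : Z, Submodule (Z.presheaf.stalk z) (Fin m → Z.presheaf.stalk z)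

/-- The map `𝒪_{Z,g(w)}^m → 𝒪_{W,w}^m` induced by `g : W ⟶ Z`. -/
def stalkVec {W Z : Scheme.{u}} (m : ℕ) (g : W ⟶ Z) (w : W) :
    (Fin m → Z.presheaf.stalk (g w)) →ₛₗ[(g.stalkMap w).hom] (Fin m → W.presheaf.stalk w) where
  toFun v j := (g.stalkMap w).hom (v j)
  map_add' _ _ := by ext; simp
  map_smul' _ _ := by ext; simp

lemma stalkVec_comp {W V Z : Scheme.{u}} (m : ℕ) (h : W ⟶ V) (g : V ⟶ Z) (w : W)
    (v : Fin m → Z.presheaf.stalk (g (h w))) :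
    stalkVec m (h ≫ g) w v = stalkVec m h w (stalkVec m g (h w) v) := by
  ext j
  change ((h ≫ g).stalkMap w).hom (v j) = (h.stalkMap w).hom ((g.stalkMap (h w)).hom (v j))
  rw [Scheme.Hom.stalkMap_comp]
  rfl

/-- The image of `g^* L` in `𝒪_W^m`: at `w` it is generated by the image of `L_{g(w)}`. (When
`𝒪_Z^m / L` is flat over a base and `g` is a base change, `g^* L ⟶ 𝒪_W^m` is injective, and this
image is `g^* L`.) -/
def StalkFamily.pullback {W Z : Scheme.{u}} {m : ℕ} (g : W ⟶ Z) (L : StalkFamily Z m) :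
    StalkFamily W m := fun w =>
  Submodule.span (W.presheaf.stalk w) (stalkVec m g w '' (L (g w) : Set (Fin m → Z.presheaf.stalk (g w))))

lemma StalkFamily.pullback_id {Z : Scheme.{u}} {m : ℕ} (L : StalkFamily Z m) :
    L.pullback (𝟙 Z) = L := by
  funext z
  have : ∀ v : Fin m → Z.presheaf.stalk z, stalkVec m (𝟙 Z) z v = v := by
    intro v
    ext j
    change ((𝟙 Z : Z ⟶ Z).stalkMap z).hom (v j) = v j
    rw [Scheme.Hom.stalkMap_id]
    rfl
  have h2 : stalkVec m (𝟙 Z) z '' (L z : Set (Fin m → Z.presheaf.stalk z)) = L z := by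
    ext x
    constructor
    · rintro ⟨v, hv, rfl⟩
      exact Set.mem_of_eq_of_mem (this v) hv
    · intro hx
      exact ⟨x, hx, this x⟩
  change Submodule.span _ (stalkVec m (𝟙 Z) z '' (L z : Set (Fin m → Z.presheaf.stalk z))) = L z
  rw [h2, Submodule.span_eq]

lemma StalkFamily.pullback_comp {W V Z : Scheme.{u}} {m : ℕ} (h : W ⟶ V) (g : V ⟶ Z)
    (L : StalkFamily Z m) : L.pullback (h ≫ g) = (L.pullback g).pullback h := by
  funext w
  dsimp only [StalkFamily.pullback]
  apply le_antisymm
  · refine Submodule.span_le.mpr ?_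
    rintro _ ⟨v, hv, rfl⟩
    refine Submodule.subset_span ⟨stalkVec m g (h w) v, Submodule.subset_span ⟨v, hv, rfl⟩, ?_⟩
    exact (stalkVec_comp m h g w v).symm
  · refine Submodule.span_le.mpr ?_
    rintro _ ⟨v, hv, rfl⟩
    simp only [SetLike.mem_coe] at hv ⊢
    induction hv using Submodule.span_induction with
    | mem x hx =>
      obtain ⟨y, hy, rfl⟩ := hx
      exact Submodule.subset_span ⟨y, hy, stalkVec_comp m h g w y⟩
    | zero => rw [map_zero]; exact Submodule.zero_mem _
    | add x y hx hy h1 h2 => rw [map_add]; exact Submodule.add_mem _ h1 h2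
    | smul a x hx h1 => rw [map_smulₛₗ]; exact Submodule.smul_mem _ _ h1

lemma StalkFamily.pullback_span {W Z : Scheme.{u}} {m : ℕ} (g : W ⟶ Z) (L : StalkFamily Z m)
    (w : W) (v : Fin m → Z.presheaf.stalk (g w)) (hv : L (g w) = Submodule.span _ {v}) :
    L.pullback g w = Submodule.span _ {stalkVec m g w v} := by
  dsimp only [StalkFamily.pullback]
  apply le_antisymm
  · refine Submodule.span_le.mpr ?_
    rintro _ ⟨x, hx, rfl⟩
    rw [SetLike.mem_coe, hv, Submodule.mem_span_singleton] at hx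
    obtain ⟨a, rfl⟩ := hx
    rw [map_smulₛₗ]
    exact Submodule.smul_mem _ _ (Submodule.mem_span_singleton_self _)
  · rw [Submodule.span_singleton_le_iff_mem]
    refine Submodule.subset_span ⟨v, ?_, rfl⟩
    rw [hv]
    exact Submodule.mem_span_singleton_self _

/-- The germs at `z` of a vector of sections over `V`. -/
def germVec {Z : Scheme.{u}} {m : ℕ} {V : Z.Opens} (f : Fin m → Γ(Z, V)) (z : Z) (hz : z ∈ V) :
    Fin m → Z.presheaf.stalk z := fun j => Z.presheaf.germ V z hz (f j)

lemma stalkVec_germVec {W Z : Scheme.{u}} {m : ℕ} (g : W ⟶ Z) {V : Z.Opens}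
    (f : Fin m → Γ(Z, V)) (w : W) (hw : g w ∈ V) :
    stalkVec m g w (germVec f (g w) hw) =
      germVec (V := g ⁻¹ᵁ V) (fun j => (g.app V).hom (f j)) w hw := by
  ext j
  exact Scheme.Hom.germ_stalkMap_apply g V w hw (f j)

/-- For `p : Z ⟶ S` with `S` affine: `L` is an invertible subsheaf of `𝒪_Z^m` whose cokernel is
`S`-flat. Around every point there is an affine open `V` and a vector `f` of sections over `V` which
generates `L` on `V`, and freely so (`a f = 0` implies `a = 0`), such that `Γ(V, 𝒪)^m / (f)`, the
module of sections of `𝒪^m / L` over `V`, is flat over `Γ(S, 𝒪)`. Isomorphism classes of pairs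
`(L, L ↪ 𝒪^m)` with `L` a line bundle are the same as invertible subsheaves. -/
def IsFlatInvertible {Z S : Scheme.{u}} (p : Z ⟶ S) {m : ℕ} (L : StalkFamily Z m) : Prop :=
  ∀ z : Z, ∃ (V : Z.Opens) (f : Fin m → Γ(Z, V)), IsAffineOpen V ∧ z ∈ V ∧
    (∀ (w : Z) (hw : w ∈ V), L w = Submodule.span (Z.presheaf.stalk w) {germVec f w hw}) ∧
    (∀ a : Γ(Z, V), (∀ j, a * f j = 0) → a = 0) ∧
    letI : Algebra Γ(S, ⊤) Γ(Z, V) := (p.appLE ⊤ V le_top).hom.toAlgebra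
    Module.Flat Γ(S, ⊤) ((Fin m → Γ(Z, V)) ⧸ Submodule.span Γ(Z, V) {f})

open TensorProduct in
lemma flat_aux₁ {R R' A A' N : Type*} [CommRing R] [CommRing R'] [CommRing A] [CommRing A']
    [Algebra R A] [Algebra R R'] [Algebra R A'] [Algebra A A'] [Algebra R' A']
    [IsScalarTower R A A'] [IsScalarTower R R' A'] [Algebra.IsPushout R R' A A']
    [AddCommGroup N] [Module R N] [Module.Flat R N]
    {m : ℕ} (f : Fin m → A) (hf : ∀ a : A, (∀ j, a * f j = 0) → a = 0)
    (p : (Fin m → A) →ₗ[R] N) (hp : Function.Surjective p)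
    (hpf : ∀ x, p x = 0 ↔ x ∈ Submodule.span A {f}) :
    (∀ a : A', (∀ j, a * algebraMap A A' (f j) = 0) → a = 0) ∧
      Module.Flat R' ((Fin m → A') ⧸ Submodule.span A' {fun j => algebraMap A A' (f j)}) := by
  let h : A →ₗ[R] (Fin m → A) := (LinearMap.toSpanSingleton A (Fin m → A) f).restrictScalars R
  have hex : Function.Exact h p := by
    intro x
    simp [h, hpf, Submodule.mem_span_singleton]
  have hinj : Function.Injective h := by
    rw [injective_iff_map_eq_zero]
    intro a ha
    exact hf a fun j => by simpa [h] using congrFun ha j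
  have hTinj : Function.Injective (h.lTensor R') :=
    LinearMap.lTensor_injective_of_exact_of_flat p hp h hinj hex R'
  have hTex : Function.Exact (h.lTensor R') (p.lTensor R') := lTensor_exact R' hex hp
  let e : R' ⊗[R] A ≃ₗ[R'] A' := (Algebra.IsPushout.equiv R R' A A').toLinearEquiv
  let em : R' ⊗[R] (Fin m → A) ≃ₗ[R'] (Fin m → A') :=
    (TensorProduct.piRight R R' R' (fun _ : Fin m => A)).trans (LinearEquiv.piCongrRight fun _ => e)
  have hsq : ∀ t : R' ⊗[R] A, em (h.lTensor R' t) = e t • fun j => algebraMap A A' (f j) := by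
    intro t
    induction t with
    | zero => simp
    | add x y hx hy => simp only [map_add, hx, hy, add_smul]
    | tmul r a =>
      ext j
      simp [em, e, h, Algebra.IsPushout.equiv_tmul, Algebra.smul_def, mul_assoc]
  constructor
  · intro a ha
    obtain ⟨t, rfl⟩ := e.surjective a
    have : em (h.lTensor R' t) = 0 := by
      rw [hsq]; ext j; simpa using ha j
    have : t = 0 := by
      apply hTinj; rw [map_zero]; simpa using this
    simp [this]
  · let ψ : (Fin m → A') →ₗ[R'] R' ⊗[R] N :=
      (p.baseChange R') ∘ₗ em.symm.toLinearMap
    have hψ : Function.Surjective ψ := by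
      have : Function.Surjective (p.lTensor R') := LinearMap.lTensor_surjective _ hp
      exact this.comp em.symm.surjective
    have hk : LinearMap.ker ψ =
        (Submodule.span A' {fun j => algebraMap A A' (f j)}).restrictScalars R' := by
      ext x
      rw [LinearMap.mem_ker, Submodule.restrictScalars_mem, Submodule.mem_span_singleton]
      change p.lTensor R' (em.symm x) = 0 ↔ _
      rw [hTex]
      constructor
      · rintro ⟨t, ht⟩
        exact ⟨e t, by rw [← hsq, ht]; simp⟩
      · rintro ⟨a, rfl⟩
        obtain ⟨t, rfl⟩ := e.surjective a
        exact ⟨t, by rw [← hsq]; simp⟩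
    let N' : Submodule A' (Fin m → A') := Submodule.span A' {fun j => algebraMap A A' (f j)}
    let e₁ : ((Fin m → A') ⧸ N'.restrictScalars R') ≃ₗ[R'] ((Fin m → A') ⧸ N') :=
      Submodule.Quotient.restrictScalarsEquiv R' N'
    let e₂ : ((Fin m → A') ⧸ LinearMap.ker ψ) ≃ₗ[R'] ((Fin m → A') ⧸ N'.restrictScalars R') :=
      Submodule.quotEquivOfEq _ _ hk
    let e₃ : ((Fin m → A') ⧸ LinearMap.ker ψ) ≃ₗ[R']
        R' ⊗[R] N := ψ.quotKerEquivOfSurjective hψ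
    have h₃ : Module.Flat R' ((Fin m → A') ⧸ LinearMap.ker ψ) := Module.Flat.of_linearEquiv e₃
    have h₂ : Module.Flat R' ((Fin m → A') ⧸ N'.restrictScalars R') :=
      Module.Flat.of_linearEquiv e₂.symm
    exact Module.Flat.of_linearEquiv e₁.symm


lemma flat_aux {R R' A A' : Type*} [CommRing R] [CommRing R'] [CommRing A] [CommRing A']
    [Algebra R A] [Algebra R R'] [Algebra R A'] [Algebra A A'] [Algebra R' A']
    [IsScalarTower R A A'] [IsScalarTower R R' A'] [Algebra.IsPushout R R' A A']
    {m : ℕ} (f : Fin m → A) (hf : ∀ a : A, (∀ j, a * f j = 0) → a = 0)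
    (hflat : Module.Flat R ((Fin m → A) ⧸ Submodule.span A {f})) :
    (∀ a : A', (∀ j, a * algebraMap A A' (f j) = 0) → a = 0) ∧
      Module.Flat R' ((Fin m → A') ⧸ Submodule.span A' {fun j => algebraMap A A' (f j)}) := by
  let p : (Fin m → A) →ₗ[R] ((Fin m → A) ⧸ Submodule.span A {f}) :=
    { toFun := Submodule.Quotient.mk
      map_add' := fun _ _ => rfl
      map_smul' := fun _ _ => rfl }
  exact flat_aux₁ (R := R) f hf p (Submodule.Quotient.mk_surjective _)
    fun x => Submodule.Quotient.mk_eq_zero _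

/-- Invertible subsheaves with `S`-flat cokernel are stable under base change. -/
lemma IsFlatInvertible.pullback {Z Z' S S' : Scheme.{u}} [IsAffine S] [IsAffine S']
    {G : Z' ⟶ Z} {p' : Z' ⟶ S'} {p : Z ⟶ S} {g : S' ⟶ S} (H : IsPullback G p' p g)
    {m : ℕ} {L : StalkFamily Z m} (hL : IsFlatInvertible p L) :
    IsFlatInvertible p' (L.pullback G) := by
  intro z
  obtain ⟨V, f, hV, hz, hspan, hinj, hflat⟩ := hL (G z)
  have : IsAffineHom g := inferInstance
  have : IsAffineHom G := MorphismProperty.of_isPullback H.flip this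
  refine ⟨G ⁻¹ᵁ V, fun j => (G.app V).hom (f j), hV.preimage G, hz, ?_, ?_⟩
  · intro w hw
    rw [StalkFamily.pullback_span G L w _ (hspan (G w) hw)]
    exact congrArg (fun t => Submodule.span _ {t}) (stalkVec_germVec G f w hw)
  · have hpo := (isIso_pushoutSection_iff H (US := ⊤) (UT := ⊤) (UX := V) (UY := G ⁻¹ᵁ V)
      le_top le_top (by simp)).mp
      (isIso_pushoutSection_of_isAffineOpen _ _ _ _ (isAffineOpen_top S) (isAffineOpen_top S') hV)
    let : Algebra Γ(S, ⊤) Γ(Z, V) := (p.appLE ⊤ V le_top).hom.toAlgebra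
    let : Algebra Γ(S, ⊤) Γ(S', ⊤) := (g.appLE ⊤ ⊤ le_top).hom.toAlgebra
    let : Algebra Γ(Z, V) Γ(Z', G ⁻¹ᵁ V) := (G.appLE V (G ⁻¹ᵁ V) le_rfl).hom.toAlgebra
    let : Algebra Γ(S', ⊤) Γ(Z', G ⁻¹ᵁ V) := (p'.appLE ⊤ (G ⁻¹ᵁ V) le_top).hom.toAlgebra
    let : Algebra Γ(S, ⊤) Γ(Z', G ⁻¹ᵁ V) :=
      (p.appLE ⊤ V le_top ≫ G.appLE V (G ⁻¹ᵁ V) le_rfl).hom.toAlgebra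
    have : IsScalarTower Γ(S, ⊤) Γ(Z, V) Γ(Z', G ⁻¹ᵁ V) := .of_algebraMap_eq' rfl
    have : IsScalarTower Γ(S, ⊤) Γ(S', ⊤) Γ(Z', G ⁻¹ᵁ V) :=
      .of_algebraMap_eq' (congrArg CommRingCat.Hom.hom hpo.w)
    have : Algebra.IsPushout Γ(S, ⊤) Γ(S', ⊤) Γ(Z, V) Γ(Z', G ⁻¹ᵁ V) :=
      CommRingCat.isPushout_iff_isPushout.mp hpo.flip
    have := flat_aux (R := Γ(S, ⊤)) (R' := Γ(S', ⊤)) (A := Γ(Z, V)) (A' := Γ(Z', G ⁻¹ᵁ V))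
      f hinj hflat
    have e : (fun j => algebraMap Γ(Z, V) Γ(Z', G ⁻¹ᵁ V) (f j)) =
        fun j => (G.app V).hom (f j) := by
      funext j
      change (G.appLE V (G ⁻¹ᵁ V) le_rfl).hom (f j) = _
      rw [← Scheme.Hom.app_eq_appLE]
    rw [e] at this
    refine ⟨fun a ha => this.1 a fun j => ?_, this.2⟩
    exact (congrArg (a * ·) (congrFun e j)).trans (ha j)

/-- The inclusion `L ⊆ 𝒪_Z^m` is a sub-bundle embedding at `z`: it is injective on the fibre at
`z`, that is, some local section of `L` has a coordinate which does not vanish at `z`. -/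
def IsRegularAt {Z : Scheme.{u}} {m : ℕ} (L : StalkFamily Z m) (z : Z) : Prop :=
  ∃ v ∈ L z, ∃ j, IsUnit (v j)

lemma IsRegularAt.of_pullback {Z' Z S : Scheme.{u}} {m : ℕ} {p : Z ⟶ S} {L : StalkFamily Z m}
    (hL : IsFlatInvertible p L) (G : Z' ⟶ Z) {z : Z'} (h : IsRegularAt (L.pullback G) z) :
    IsRegularAt L (G z) := by
  obtain ⟨V, f, hV, hz, hspan, -⟩ := hL (G z)
  obtain ⟨x, hx, j, hj⟩ := h
  rw [StalkFamily.pullback_span G L z _ (hspan (G z) hz), Submodule.mem_span_singleton] at hx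
  obtain ⟨a, rfl⟩ := hx
  refine ⟨germVec f (G z) hz, ?_, j, ?_⟩
  · rw [hspan (G z) hz]; exact Submodule.mem_span_singleton_self _
  · have : IsUnit ((G.stalkMap z).hom (germVec f (G z) hz j)) := isUnit_of_mul_isUnit_right hj
    exact isUnit_of_map_unit (G.stalkMap z).hom _ this

section Proj
attribute [local instance] MvPolynomial.gradedAlgebra
open MvPolynomial

variable (k) in
/-- Projective space `ℙⁿ` over `k`, the `Proj` of `k[x_0, …, x_n]`. -/
def projSpace (n : ℕ) : Sch k :=
  Over.mk (Proj.toSpecZero (homogeneousSubmodule (Fin (n + 1)) k) ≫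
    Spec.map (CommRingCat.ofHom (algebraMap k (homogeneousSubmodule (Fin (n + 1)) k 0))))

variable (k) in
/-- The standard affine chart `D₊(x_j)` of `ℙⁿ`. -/
def chart (n : ℕ) (j : Fin (n + 1)) : (projSpace k n).left.affineOpens :=
  ⟨Proj.basicOpen (homogeneousSubmodule (Fin (n + 1)) k) (X j),
    Proj.isAffineOpen_basicOpen _ _ (isHomogeneous_X k j) one_pos⟩

/-- The function `F / x_j ^ d` on `D₊(x_j)`, for `F` homogeneous of degree `d`. -/
def ratio {n : ℕ} (j : Fin (n + 1)) {d : ℕ} (F : MvPolynomial (Fin (n + 1)) k)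
    (hF : F.IsHomogeneous d) : Γ((projSpace k n).left, chart k n j) :=
  (Proj.awayToSection (homogeneousSubmodule (Fin (n + 1)) k) (X j)).hom
    (HomogeneousLocalization.Away.mk _ (isHomogeneous_X k j) d F (by simpa using hF))

variable (k) in
/-- The tautological sub-bundle `𝒪(-1) ⊆ 𝒪^{n+1}` of `ℙⁿ`; on `D₊(x_j)` it is generated by
`(x_0 / x_j, …, x_n / x_j)`. -/
def taut (n : ℕ) : StalkFamily (projSpace k n).left (n + 1) := fun p =>
  ⨆ (j : Fin (n + 1)) (hp : p ∈ (chart k n j).1),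
    Submodule.span _ {germVec (fun i => ratio j (X i) (isHomogeneous_X k i)) p hp}

/-- The structure map `k → 𝒪_{Z,z}` of a `k`-scheme. -/
def scalar {Z : Scheme.{u}} (s : Z ⟶ Spec (CommRingCat.of k)) (z : Z) :
    k →+* Z.presheaf.stalk z :=
  ((Scheme.ΓSpecIso (CommRingCat.of k)).inv ≫ s.appTop ≫ Z.presheaf.germ ⊤ z trivial).hom

lemma stalkMap_scalar {W Z : Scheme.{u}} (G : W ⟶ Z) (s : Z ⟶ Spec (CommRingCat.of k)) (w : W) :
    ((G.stalkMap w).hom).comp (scalar s (G w)) = scalar (G ≫ s) w := by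
  rw [scalar, scalar, ← CommRingCat.hom_comp]
  congr 1
  simp only [Category.assoc, Scheme.Hom.comp_appTop]
  congr 2
  exact Scheme.Hom.germ_stalkMap G ⊤ w trivial

lemma eval₂_smul_of_isHomogeneous {σ R S : Type*} [CommRing R] [CommRing S]
    {F : MvPolynomial σ R} {d : ℕ} (hF : F.IsHomogeneous d) (φ : R →+* S) (a : S) (v : σ → S) :
    F.eval₂ φ (a • v) = a ^ d * F.eval₂ φ v := by
  rw [eval₂_eq, eval₂_eq, Finset.mul_sum]
  refine Finset.sum_congr rfl fun e he => ?_
  have hd : ∑ i ∈ e.support, e i = d := by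
    have h := hF (mem_support_iff.mp he)
    simpa [Finsupp.weight_apply, Finsupp.sum] using h
  simp only [Pi.smul_apply, smul_eq_mul, mul_pow, Finset.prod_mul_distrib,
    Finset.prod_pow_eq_pow_sum, hd]
  ring

/-- For the closed subscheme of `ℙⁿ` with ideal sheaf `I`, a homogeneous `F` of degree `d` belongs
to its graded ideal iff all `F / x_j ^ d` belong to `I`. The condition says that for all such `F` the
induced section of `Sym^d L^∨`, i.e. the function `v ↦ F(v)` of degree `d` on `L`, vanishes. -/
def LandsInClosed {n : ℕ} (I : (projSpace k n).left.IdealSheafData) {Z : Scheme.{u}}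
    (s : Z ⟶ Spec (CommRingCat.of k)) (L : StalkFamily Z (n + 1)) : Prop :=
  ∀ (d : ℕ) (F : MvPolynomial (Fin (n + 1)) k) (hF : F.IsHomogeneous d),
    (∀ j, ratio j F hF ∈ I.ideal (chart k n j)) →
      ∀ (z : Z), ∀ v ∈ L z, F.eval₂ (scalar s z) v = 0

lemma LandsInClosed.pullback {n : ℕ} {I : (projSpace k n).left.IdealSheafData} {Z Z' S : Scheme.{u}}
    {s : Z ⟶ Spec (CommRingCat.of k)} {p : Z ⟶ S} {L : StalkFamily Z (n + 1)}
    (hL : IsFlatInvertible p L) (h : LandsInClosed I s L) (G : Z' ⟶ Z) :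
    LandsInClosed I (G ≫ s) (L.pullback G) := by
  intro d F hF hI z x hx
  obtain ⟨V, f, hV, hz, hspan, -⟩ := hL (G z)
  rw [StalkFamily.pullback_span G L z _ (hspan (G z) hz), Submodule.mem_span_singleton] at hx
  obtain ⟨a, rfl⟩ := hx
  have h0 : F.eval₂ (scalar s (G z)) (germVec f (G z) hz) = 0 :=
    h d F hF hI (G z) _ (by rw [hspan (G z) hz]; exact Submodule.mem_span_singleton_self _)
  have h1 : F.eval₂ (scalar (G ≫ s) z) (stalkVec (n + 1) G z (germVec f (G z) hz)) = 0 := by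
    rw [← stalkMap_scalar]
    have := congrArg (G.stalkMap z).hom h0
    rw [map_zero, MvPolynomial.hom_eval₂] at this
    exact this
  rw [eval₂_smul_of_isHomogeneous hF, h1, mul_zero]

end Proj

/-- The closed subset `closure(Y) ∖ Y` of `ℙⁿ` (Mathlib's `coborder` is its complement). -/
def boundary {n : ℕ} {Y : Sch k} (i : Y ⟶ projSpace k n) [IsImmersion i.left] :
    Closeds (projSpace k n).left :=
  i.left.coborderRange.compl

/-- An `S`-family of quasi-maps from `X` to the locally closed subscheme `i : Y ⟶ ℙⁿ`: an invertible
subsheaf of `𝒪_{S × X}^{n+1}` with `S`-flat cokernel, which is a family of quasi-maps to the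
scheme-theoretic closure of `Y` (with ideal sheaf `i.left.ker`), and lies in the open complement of
the quasi-maps to `closure(Y) ∖ Y`, i.e. no base change of it to a nonempty `T` is a family of
quasi-maps to `closure(Y) ∖ Y`. -/
structure IsQuasiMap (X : Sch k) {n : ℕ} {Y : Sch k} (i : Y ⟶ projSpace k n) [IsImmersion i.left]
    (S : Aff k) (L : StalkFamily (prodOver S.obj X) (n + 1)) : Prop where
  flatInvertible : IsFlatInvertible (pullback.fst S.obj.hom X.hom) L
  landsInClosure : LandsInClosed i.left.ker (prodStr S.obj X) L
  avoidsBoundary : ∀ (T : Aff k) (g : T ⟶ S), Nonempty T.obj.left →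
    ¬ LandsInClosed (Scheme.IdealSheafData.vanishingIdeal (boundary i)) (prodStr T.obj X)
      (L.pullback (prodMap g.hom X))

lemma IsQuasiMap.pullback {X : Sch k} {n : ℕ} {Y : Sch k} {i : Y ⟶ projSpace k n}
    [IsImmersion i.left] {S T : Aff k} {L : StalkFamily (prodOver S.obj X) (n + 1)}
    (hL : IsQuasiMap X i S L) (g : T ⟶ S) : IsQuasiMap X i T (L.pullback (prodMap g.hom X)) where
  flatInvertible := by
    have := S.property.1
    have := T.property.1
    exact hL.flatInvertible.pullback (prodMap_isPullback g.hom X)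
  landsInClosure := by
    have := hL.landsInClosure.pullback hL.flatInvertible (prodMap g.hom X)
    rwa [prodMap_str] at this
  avoidsBoundary R h hR := by
    rw [← StalkFamily.pullback_comp, ← prodMap_comp]
    exact hL.avoidsBoundary R (h ≫ g) hR

/-- The presheaf of quasi-maps from `X` to `Y`, relative to the embedding `i : Y ⟶ ℙⁿ`. -/
def QMap (X : Sch k) {n : ℕ} {Y : Sch k} (i : Y ⟶ projSpace k n) [IsImmersion i.left] :
    (Aff k)ᵒᵖ ⥤ Type u where
  obj S := {L : StalkFamily (prodOver S.unop.obj X) (n + 1) // IsQuasiMap X i S.unop L}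
  map g := ↾(fun L => ⟨L.1.pullback (prodMap g.unop.hom X), L.2.pullback g.unop⟩)
  map_id S := by
    ext L
    change L.1.pullback (prodMap (𝟙 S.unop.obj) X) = L.1
    rw [prodMap_id, StalkFamily.pullback_id]
  map_comp g h := by
    ext L
    change L.1.pullback (prodMap (h.unop.hom ≫ g.unop.hom) X) =
      (L.1.pullback (prodMap g.unop.hom X)).pullback (prodMap h.unop.hom X)
    rw [prodMap_comp, StalkFamily.pullback_comp]

/-- The two subsheaves agree over the intersection of their regularity domains. -/
def GenericallyAgree {Z : Scheme.{u}} {m : ℕ} (L L' : StalkFamily Z m) : Prop :=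
  ∀ z, IsRegularAt L z → IsRegularAt L' z → L z = L' z

lemma GenericallyAgree.pullback {Z Z' S : Scheme.{u}} {m : ℕ} {p : Z ⟶ S} {L L' : StalkFamily Z m}
    (hL : IsFlatInvertible p L) (hL' : IsFlatInvertible p L') (h : GenericallyAgree L L')
    (G : Z' ⟶ Z) : GenericallyAgree (L.pullback G) (L'.pullback G) := by
  intro z hz hz'
  dsimp only [StalkFamily.pullback]
  rw [h (G z) (hz.of_pullback hL G) (hz'.of_pullback hL' G)]

/-- The relation `ℰ_Y` on `QMap(X, Y)(S)`. -/
def relE (X : Sch k) {n : ℕ} {Y : Sch k} (i : Y ⟶ projSpace k n) [IsImmersion i.left]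
    (S : (Aff k)ᵒᵖ) (q q' : (QMap X i).obj S) : Prop :=
  GenericallyAgree q.1 q'.1

lemma relE_map {X : Sch k} {n : ℕ} {Y : Sch k} (i : Y ⟶ projSpace k n) [IsImmersion i.left]
    {S T : (Aff k)ᵒᵖ} (g : S ⟶ T) (q q' : (QMap X i).obj S) (h : relE X i S q q') :
    relE X i T ((QMap X i).map g q) ((QMap X i).map g q') :=
  GenericallyAgree.pullback q.2.flatInvertible q'.2.flatInvertible h (prodMap g.unop.hom X)

/-- The presheaf quotient `S ↦ QMap(X, Y)(S) / ℰ_Y(S)`. -/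
def QMapModE (X : Sch k) {n : ℕ} {Y : Sch k} (i : Y ⟶ projSpace k n) [IsImmersion i.left] :
    (Aff k)ᵒᵖ ⥤ Type u where
  obj S := Quot (relE X i S)
  map {S T} g := ↾(Quot.map (ra := relE X i S) (rb := relE X i T) (fun q => (QMap X i).map g q)
    (relE_map i g))
  map_id S := by
    ext q
    induction q using Quot.inductionOn with | _ q
    change Quot.mk _ ((QMap X i).map (𝟙 S) q) = Quot.mk _ q
    rw [(QMap X i).map_id]
    rfl
  map_comp g h := by
    ext q
    induction q using Quot.inductionOn with | _ q
    change Quot.mk _ ((QMap X i).map (g ≫ h) q) = Quot.mk _ ((QMap X i).map h ((QMap X i).map g q))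
    rw [(QMap X i).map_comp]
    rfl

/-- The projection `QMap(X, Y) ⟶ QMap(X, Y) / ℰ_Y`. -/
def toQuotient (X : Sch k) {n : ℕ} {Y : Sch k} (i : Y ⟶ projSpace k n) [IsImmersion i.left] :
    QMap X i ⟶ QMapModE X i where
  app S := ↾(Quot.mk (relE X i S))

/-- The quasi-map `L` presents the generically defined map `φ : U ⟶ Y`: over `U`, the subsheaf `L`
is a sub-bundle, and it is the pullback of the tautological sub-bundle along `U ⟶ Y ⟶ ℙⁿ`. That is,
`φ` is the regular map defined by the sub-bundle `L` over `U`. -/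
def Presents {X : Sch k} {n : ℕ} {Y : Sch k} (i : Y ⟶ projSpace k n) {S : Sch k}
    (L : StalkFamily (prodOver S X) (n + 1)) (φ : GenMap X Y S) : Prop :=
  (∀ z ∈ φ.dom, IsRegularAt L z) ∧
    (taut k n).pullback (φ.hom ≫ i.left) = L.pullback φ.dom.ι

/-- `η` sends every quasi-map to the class of a generically defined map that it presents. -/
def IsAssociatedMap {X : Sch k} {n : ℕ} {Y : Sch k} (i : Y ⟶ projSpace k n) [IsImmersion i.left]
    (η : QMap X i ⟶ GMap X Y) : Prop :=
  ∀ (S : (Aff k)ᵒᵖ) (q : (QMap X i).obj S), ∃ φ : GenMap X Y S.unop.obj,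
    Presents i q.1 φ ∧ η.app S q = Quotient.mk _ φ

variable (k) in
/-- Zariski sheafification of presheaves of sets on `Aff k`. The values are lifted to the next
universe, where Mathlib provides sheafification on the (large) category `Aff k`. -/
def zariskiSheafification : ((Aff k)ᵒᵖ ⥤ Type u) ⥤ Sheaf (zariski k) (Type (u + 1)) :=
  (Functor.whiskeringRight _ _ _).obj uliftFunctor.{u + 1, u} ⋙
    presheafToSheaf (zariski k) (Type (u + 1))

/-- Projective schemes over `k`. -/
def IsProjective (X : Sch k) : Prop :=
  ∃ (N : ℕ) (j : X ⟶ projSpace k N), IsClosedImmersion j.left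

end GenericMaps
end
open GenericMaps

/-!
Write `p : S × X ⟶ S`. A smooth connected `X` is geometrically integral, so an open subset of
`S × X` is a family of domains if and only if it meets every fibre of `p`. Since `p` is flat and `S`
is noetherian, a section over an open subset of `S × X` that vanishes on such a family is zero: by
noetherian induction on modules over the base this reduces to integral `S`, where `S × X` is
integral. The same induction shows that a vector of sections one of whose entries is invertible on a
family of domains generates an invertible subsheaf with flat cokernel.

A quasi-map defines a morphism to `ℙⁿ` on its regularity domain. This morphism lands in the closure
of `Y`, and the preimage of `Y` is a family of domains, because after base change to an integral
scheme dominating the closure of a point of `S` the quasi-map would otherwise be one to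
`closure Y \ Y`. By density, two quasi-maps define the same germ of a map if and only if they agree
on their common regularity domain, which gives the equivalence relation, `η`, and the injectivity
of `Φ`.

For local surjectivity, shrink `S` until the domain of a map `φ` contains a family of domains that
is a basic open subset of an affine chart of `S × X`, pulled back from a projective embedding of
`X`, and that `φ` sends into one chart of `ℙⁿ`. There `φ` is a vector of functions with an entry
`1`. Multiplied by a high power of the sections defining the basic open subset, it extends to a
vector of sections of a twist `𝒪(M)` on all of `S × X`, and this vector generates the required
invertible subsheaf.
-/

noncomputable section

namespace GenericMaps

/-! ### Smooth connected schemes over an algebraically closed field are geometrically integral -/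

section GeometricIntegrality

open TensorProduct

lemma eq_zero_of_forall_algHom_eq_zero {k B : Type*} [Field k] [IsAlgClosed k] [CommRing B]
    [IsReduced B] [Algebra k B] [Algebra.FiniteType k B] {b : B} (hb : ∀ χ : B →ₐ[k] k, χ b = 0) :
    b = 0 := by
  have : IsJacobsonRing B := isJacobsonRing_of_finiteType (A := k)
  rw [← Ideal.mem_bot, ← isJacobsonRing_iff.mp this ⊥ Ideal.isRadical_bot,
    Ideal.jacobson, Ideal.mem_sInf]
  rintro m ⟨-, hm⟩
  let : Field (B ⧸ m) := Ideal.Quotient.field m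
  have : Module.Finite k (B ⧸ m) := finite_of_finite_type_of_isJacobsonRing k (B ⧸ m)
  let e : k ≃ₐ[k] B ⧸ m := AlgEquiv.ofBijective (Algebra.ofId k (B ⧸ m))
    IsAlgClosed.algebraMap_bijective_of_isIntegral
  rw [← Ideal.Quotient.eq_zero_iff_mem]
  exact (map_eq_zero_iff e.symm e.symm.injective).mp
    (hb (e.symm.toAlgHom.comp (Ideal.Quotient.mkₐ k m)))

/-- Specialization `B ⊗ K → K` along a `k`-point `χ` of `B`; it is used to test for zero the
coordinates of elements of `B ⊗ K` with respect to a `k`-basis of `K`. -/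
def specialize {k B : Type*} (K : Type*) [CommRing k] [CommRing B] [CommRing K] [Algebra k B]
    [Algebra k K] (χ : B →ₐ[k] k) : B ⊗[k] K →ₐ[k] K :=
  Algebra.TensorProduct.lift ((Algebra.ofId k K).comp χ) (AlgHom.id k K) fun _ _ => Commute.all _ _

lemma repr_specialize {k K B ι : Type*} [CommRing k] [CommRing K] [CommRing B] [Algebra k K]
    [Algebra k B] (b : Module.Basis ι k K) (χ : B →ₐ[k] k) (z : B ⊗[k] K) (l : ι) :
    b.repr (specialize K χ z) l = χ ((b.baseChange B).repr z l) := by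
  induction z with
  | zero => simp
  | add z w hz hw => simp only [map_add, Finsupp.add_apply, hz, hw]
  | tmul s t =>
    have : specialize K χ (s ⊗ₜ t) = χ s • t := by
      simp [specialize, Algebra.smul_def, Algebra.ofId_apply]
    rw [this, Module.Basis.baseChange_repr_tmul, map_smul, map_smul]
    simp [mul_comm]

lemma isDomain_tensorProduct_of_isAlgClosed {k K B : Type*} [Field k] [IsAlgClosed k] [CommRing K]
    [IsDomain K] [Algebra k K] [CommRing B] [IsDomain B] [Algebra k B] [Algebra.FiniteType k B] :
    IsDomain (B ⊗[k] K) := by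
  have : Nontrivial (B ⊗[k] K) :=
    Algebra.TensorProduct.nontrivial_of_algebraMap_injective_of_flat_left k B K
      (FaithfulSMul.algebraMap_injective k K)
  let b := Module.Free.chooseBasis k K
  have : NoZeroDivisors (B ⊗[k] K) := by
    refine ⟨fun {x y} hxy => ?_⟩
    have hcoord (i j) : (b.baseChange B).repr x i * (b.baseChange B).repr y j = 0 := by
      refine eq_zero_of_forall_algHom_eq_zero (k := k) fun χ => ?_
      have h0 : specialize K χ x * specialize K χ y = 0 := by rw [← map_mul, hxy, map_zero]
      rw [map_mul, ← repr_specialize, ← repr_specialize]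
      rcases mul_eq_zero.mp h0 with h | h <;> simp [h]
    by_contra! hne
    obtain ⟨i, hi⟩ := Finsupp.ne_iff.mp ((LinearEquiv.map_ne_zero_iff (b.baseChange B).repr).mpr
      hne.1)
    obtain ⟨j, hj⟩ := Finsupp.ne_iff.mp ((LinearEquiv.map_ne_zero_iff (b.baseChange B).repr).mpr
      hne.2)
    exact mul_ne_zero hi hj (hcoord i j)
  exact NoZeroDivisors.to_isDomain _

lemma isIntegrallyClosedIn_tensorProduct_of_smooth {P S B : Type*} [CommRing P] [CommRing S]
    [CommRing B] [Algebra P S] [Algebra P B] [Algebra.Smooth P S] [IsIntegrallyClosedIn P B] :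
    IsIntegrallyClosedIn S (S ⊗[P] B) := by
  have hinj : Function.Injective (algebraMap P B) := IsIntegralClosure.algebraMap_injective P P B
  refine ⟨Algebra.TensorProduct.includeLeft_injective (S := P) hinj, fun {t} => ⟨fun ht => ?_, ?_⟩⟩
  · obtain ⟨x, hx⟩ := (TensorProduct.toIntegralClosure_bijective_of_smooth (R := P) (S := S)
      (B := B)).2 ⟨t, ht⟩
    obtain rfl : (TensorProduct.toIntegralClosure P S B x : S ⊗[P] B) = t := by rw [hx]
    clear ht hx
    induction x with
    | zero => exact ⟨0, by simp⟩
    | add x y hx hy =>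
      obtain ⟨a, ha⟩ := hx
      obtain ⟨b, hb⟩ := hy
      exact ⟨a + b, by rw [map_add, ha, hb, map_add]; rfl⟩
    | tmul s c =>
      obtain ⟨c, hc⟩ := c
      obtain ⟨r, rfl⟩ := IsIntegrallyClosedIn.isIntegral_iff.mp hc
      refine ⟨r • s, ?_⟩
      change (r • s) ⊗ₜ[P] (1 : B) = s ⊗ₜ[P] algebraMap P B r
      rw [smul_tmul, Algebra.smul_def, mul_one]
  · rintro ⟨s, rfl⟩
    exact isIntegral_algebraMap

lemma exists_isDomain_away_of_injective_pi {S I : Type*} [CommRing S] [Finite I] [DecidableEq I]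
    {A : I → Type*} [∀ i, CommRing (A i)] [∀ i, IsDomain (A i)] {φ : S →+* Π i, A i}
    (hφ : Function.Injective φ) (hsingle : ∀ i, Pi.single i 1 ∈ φ.range) {q : Ideal S}
    (hq : q ≠ ⊤) : ∃ e ∉ q, IsDomain (Localization.Away e) := by
  have := Fintype.ofFinite I
  choose e he using hsingle
  have hsum : ∑ i, e i = 1 := by
    apply hφ
    simp only [map_sum, map_one, he]
    exact Finset.univ_sum_single (1 : Π i, A i)
  obtain ⟨i, hi⟩ : ∃ i, e i ∉ q := by
    by_contra! h
    exact hq ((Ideal.eq_top_iff_one _).mpr (hsum ▸ Ideal.sum_mem _ fun i _ => h i))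
  let ev : S →+* A i := (Pi.evalRingHom A i).comp φ
  have hev : ev (e i) = 1 := by simp [ev, he]
  have hker : ∀ a, ev a = 0 → e i * a = 0 := fun a ha => hφ <| by
    rw [map_mul, he, map_zero, ← Pi.single_mul_left, one_mul]
    exact (congrArg (Pi.single i) ha).trans (Pi.single_zero i)
  have hlift : Function.Injective (IsLocalization.Away.lift (S := Localization.Away (e i)) (e i)
      (g := ev) (hev ▸ isUnit_one)) := by
    rw [injective_iff_map_eq_zero]
    intro z hz
    obtain ⟨a, s, rfl⟩ := IsLocalization.exists_mk'_eq (Submonoid.powers (e i)) z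
    rw [IsLocalization.Away.lift, IsLocalization.lift_mk'_spec, mul_zero] at hz
    exact (IsLocalization.mk'_eq_zero_iff _ _).mpr ⟨⟨e i, 1, pow_one _⟩, hker a hz⟩
  exact ⟨e i, hi, hlift.isDomain _⟩

/-- The idempotents of the finite product of fields `K ⊗ S`, where `K` is the fraction field of
`P`, are integral over `S`, so they already belong to `S`. -/
lemma exists_isDomain_away_of_etale (P : Type u) {S : Type u} [CommRing P] [IsDomain P]
    [IsIntegrallyClosed P] [CommRing S] [Algebra P S] [Algebra.Etale P S] {q : Ideal S}
    (hq : q ≠ ⊤) : ∃ e ∉ q, IsDomain (Localization.Away e) := by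
  classical
  let K := FractionRing P
  obtain ⟨I, _, A, _, _, E₀, -⟩ := (Algebra.Etale.iff_exists_algEquiv_prod K (K ⊗[P] S)).mp
    inferInstance
  let E : S ⊗[P] K ≃+* Π i, A i :=
    (Algebra.TensorProduct.comm P S K).toRingEquiv.trans E₀.toRingEquiv
  have hclosed : IsIntegrallyClosedIn S (S ⊗[P] K) := isIntegrallyClosedIn_tensorProduct_of_smooth
  have hinj : Function.Injective (E.toRingHom.comp (algebraMap S (S ⊗[P] K))) :=
    E.injective.comp (IsIntegralClosure.algebraMap_injective S S _)
  refine exists_isDomain_away_of_injective_pi hinj (fun i => ?_) hq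
  have hidem : E.symm (Pi.single i 1) * E.symm (Pi.single i 1) = E.symm (Pi.single i 1) := by
    rw [← map_mul, ← Pi.single_mul, one_mul]
  have hint : IsIntegral S (E.symm (Pi.single i 1)) :=
    ⟨Polynomial.X ^ 2 - Polynomial.X, by monicity!, by simp [pow_two, hidem]⟩
  obtain ⟨s, hs⟩ := IsIntegrallyClosedIn.isIntegral_iff.mp hint
  exact ⟨s, by simp [hs]⟩

lemma irreducibleSpace_of_locally_isIrreducible {T : Type*} [TopologicalSpace T] [ConnectedSpace T]
    (h : ∀ x : T, ∃ W : Set T, IsOpen W ∧ x ∈ W ∧ IsIrreducible W) : IrreducibleSpace T := by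
  obtain ⟨x⟩ : Nonempty T := inferInstance
  obtain ⟨W, hW, hx, hirr⟩ := h x
  have hopen : IsOpen (closure W) := by
    rw [isOpen_iff_mem_nhds]
    intro z hz
    obtain ⟨N, hN, hzN, hNirr⟩ := h z
    refine Filter.mem_of_superset (hN.mem_nhds hzN) ?_
    have hne : (N ∩ W).Nonempty := mem_closure_iff.mp hz N hN hzN
    exact (subset_closure_inter_of_isPreirreducible_of_isOpen hNirr.2 hW hne).trans
      (closure_mono Set.inter_subset_right)
  have huniv : closure W = Set.univ :=
    IsClopen.eq_univ ⟨isClosed_closure, hopen⟩ ⟨x, subset_closure hx⟩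
  rw [irreducibleSpace_def, Set.top_eq_univ, ← huniv]
  exact hirr.closure

lemma isIntegral_of_connectedSpace {Z : Scheme.{u}} [ConnectedSpace Z]
    (h : ∀ z : Z, ∃ V : Z.Opens, z ∈ V ∧ IsIntegral V) : IsIntegral Z := by
  have : IrreducibleSpace Z := irreducibleSpace_of_locally_isIrreducible fun z => by
    obtain ⟨V, hz, hV⟩ := h z
    refine ⟨V, V.isOpen, hz, ?_⟩
    rw [← V.range_ι, ← Set.image_univ]
    exact (IrreducibleSpace.isIrreducible_univ V).image _ V.ι.continuous.continuousOn
  have (z : Z) : _root_.IsReduced (Z.presheaf.stalk z) := by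
    obtain ⟨V, hz, hV⟩ := h z
    have : _root_.IsReduced (V.toScheme.presheaf.stalk ⟨z, hz⟩) :=
      isReduced_stalk_of_isReduced V.toScheme ⟨z, hz⟩
    exact isReduced_of_injective (V.stalkIso ⟨z, hz⟩).inv.hom
      (V.stalkIso ⟨z, hz⟩).symm.commRingCatIsoToRingEquiv.injective
  have : IsReduced Z := isReduced_of_isReduced_stalk Z
  exact isIntegral_of_irreducibleSpace_of_isReduced Z

lemma isIntegral_of_isDomain_sections {Z : Scheme.{u}} {V : Z.Opens} (hV : IsAffineOpen V)
    [IsDomain Γ(Z, V)] : IsIntegral V := by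
  have : IsAffine V := hV
  have : IsDomain Γ(V, ⊤) := V.topIso.commRingCatIsoToRingEquiv.toMulEquiv.isDomain
  have : Nonempty V := ((Opens.ne_bot_iff_nonempty V).mp fun h =>
    not_subsingleton Γ(Z, V) (h ▸ inferInstance)).to_subtype
  exact isIntegral_of_isAffine_of_isDomain V

lemma isIntegral_of_smooth_of_connectedSpace {k : Type u} [Field k] {X : Scheme.{u}}
    (f : X ⟶ Spec (.of k)) [Smooth f] [ConnectedSpace X] : IsIntegral X := by
  refine isIntegral_of_connectedSpace fun x => ?_
  obtain ⟨U, hU, V, hV, hxV, hle, hstd⟩ := Smooth.exists_isStandardSmooth f x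
  obtain rfl : U = ⊤ := eq_top_iff.mpr fun y _ => Subsingleton.elim (f x) y ▸ hle hxV
  let : Field Γ(Spec (.of k), ⊤) :=
    ((Scheme.ΓSpecIso (.of k)).commRingCatIsoToRingEquiv.toMulEquiv.isField
      (Field.toIsField k)).toField
  obtain ⟨n, g, -, hg⟩ := hstd.exists_etale_mvPolynomial
  algebraize [g]
  obtain ⟨e, he, hdom⟩ := exists_isDomain_away_of_etale
    (MvPolynomial (Fin n) Γ(Spec (.of k), ⊤)) (hV.primeIdealOf ⟨x, hxV⟩).2.ne_top
  have hloc := hV.isLocalization_basicOpen e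
  have : IsDomain Γ(X, X.basicOpen e) := (IsLocalization.algEquiv (Submonoid.powers e)
    Γ(X, X.basicOpen e) (Localization.Away e)).toMulEquiv.isDomain
  refine ⟨X.basicOpen e, ?_, isIntegral_of_isDomain_sections (hV.basicOpen e)⟩
  have hmem : x ∈ hV.fromSpec ''ᵁ PrimeSpectrum.basicOpen e :=
    ⟨_, he, hV.fromSpec_primeIdealOf ⟨x, hxV⟩⟩
  rwa [hV.fromSpec_image_basicOpen e] at hmem

lemma exists_tensorProduct_equiv_preimage {Z Z' S S' : Scheme.{u}} [IsAffine S] [IsAffine S']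
    {G : Z' ⟶ Z} {p' : Z' ⟶ S'} {p : Z ⟶ S} {g : S' ⟶ S} (H : IsPullback G p' p g)
    {V : Z.Opens} (hV : IsAffineOpen V) :
    letI : Algebra Γ(S, ⊤) Γ(Z, V) := (p.appLE ⊤ V le_top).hom.toAlgebra
    letI : Algebra Γ(S, ⊤) Γ(S', ⊤) := (g.appLE ⊤ ⊤ le_top).hom.toAlgebra
    ∃ e : Γ(Z, V) ⊗[Γ(S, ⊤)] Γ(S', ⊤) ≃+* Γ(Z', G ⁻¹ᵁ V), ∀ a, e (a ⊗ₜ 1) = G.app V a := by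
  have hpo := (isIso_pushoutSection_iff H (US := ⊤) (UT := ⊤) (UX := V) (UY := G ⁻¹ᵁ V)
    le_top le_top (by simp)).mp
    (isIso_pushoutSection_of_isAffineOpen _ _ _ _ (isAffineOpen_top S) (isAffineOpen_top S') hV)
  let : Algebra Γ(S, ⊤) Γ(Z, V) := (p.appLE ⊤ V le_top).hom.toAlgebra
  let : Algebra Γ(S, ⊤) Γ(S', ⊤) := (g.appLE ⊤ ⊤ le_top).hom.toAlgebra
  let : Algebra Γ(Z, V) Γ(Z', G ⁻¹ᵁ V) := (G.appLE V (G ⁻¹ᵁ V) le_rfl).hom.toAlgebra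
  let : Algebra Γ(S', ⊤) Γ(Z', G ⁻¹ᵁ V) := (p'.appLE ⊤ (G ⁻¹ᵁ V) le_top).hom.toAlgebra
  let : Algebra Γ(S, ⊤) Γ(Z', G ⁻¹ᵁ V) :=
    (p.appLE ⊤ V le_top ≫ G.appLE V (G ⁻¹ᵁ V) le_rfl).hom.toAlgebra
  have : IsScalarTower Γ(S, ⊤) Γ(Z, V) Γ(Z', G ⁻¹ᵁ V) := .of_algebraMap_eq' rfl
  have : IsScalarTower Γ(S, ⊤) Γ(S', ⊤) Γ(Z', G ⁻¹ᵁ V) :=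
    .of_algebraMap_eq' (congrArg CommRingCat.Hom.hom hpo.w)
  have : Algebra.IsPushout Γ(S, ⊤) Γ(Z, V) Γ(S', ⊤) Γ(Z', G ⁻¹ᵁ V) :=
    CommRingCat.isPushout_iff_isPushout.mp hpo
  let e := Algebra.IsPushout.equiv Γ(S, ⊤) Γ(Z, V) Γ(S', ⊤) Γ(Z', G ⁻¹ᵁ V)
  refine ⟨e.toRingEquiv, fun a => (e.commutes a).trans ?_⟩
  change (G.appLE V (G ⁻¹ᵁ V) le_rfl).hom a = _
  rw [← Scheme.Hom.app_eq_appLE]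

lemma isDomain_sections_preimage {k : Type u} [Field k] [IsAlgClosed k] {X Z S : Scheme.{u}}
    [IsIntegral X] [IsAffine S] [IsIntegral S] {f : X ⟶ Spec (.of k)} [LocallyOfFiniteType f]
    {π : Z ⟶ X} {p : Z ⟶ S} {q : S ⟶ Spec (.of k)} (H : IsPullback π p f q) {V : X.Opens}
    (hV : IsAffineOpen V) [Nonempty V] : IsDomain Γ(Z, π ⁻¹ᵁ V) := by
  let ek := (Scheme.ΓSpecIso (.of k)).commRingCatIsoToRingEquiv
  let : Field Γ(Spec (.of k), ⊤) := (ek.toMulEquiv.isField (Field.toIsField k)).toField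
  have : IsAlgClosed Γ(Spec (.of k), ⊤) := IsAlgClosed.of_ringEquiv k _ ek.symm
  let : Algebra Γ(Spec (.of k), ⊤) Γ(X, V) := (f.appLE ⊤ V le_top).hom.toAlgebra
  let : Algebra Γ(Spec (.of k), ⊤) Γ(S, ⊤) := (q.appLE ⊤ ⊤ le_top).hom.toAlgebra
  have : Algebra.FiniteType Γ(Spec (.of k), ⊤) Γ(X, V) :=
    f.finiteType_appLE (isAffineOpen_top _) hV le_top
  obtain ⟨e, -⟩ := exists_tensorProduct_equiv_preimage H hV
  have := isDomain_tensorProduct_of_isAlgClosed (k := Γ(Spec (.of k), ⊤)) (B := Γ(X, V))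
    (K := Γ(S, ⊤))
  exact e.symm.toMulEquiv.isDomain

lemma connectedSpace_of_surjective_of_isPreconnected_preimage {Z X : Scheme.{u}} (π : Z ⟶ X)
    [Surjective π] [IrreducibleSpace X]
    (h : ∀ V : X.Opens, IsAffineOpen V → Nonempty V →
      _root_.IsPreconnected (π ⁻¹' (V : Set X))) :
    ConnectedSpace Z := by
  have hcov (z : Z) : ∃ V : X.Opens, IsAffineOpen V ∧ π z ∈ V := by
    obtain ⟨V, hV, hz, -⟩ := exists_isAffineOpen_mem_and_subset (U := (⊤ : X.Opens)) (x := π z)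
      trivial
    exact ⟨V, hV, hz⟩
  have : Nonempty Z := (inferInstance : Nonempty X).map fun x => (π.surjective x).choose
  refine { toNonempty := this
           isPreconnected_univ := isPreconnected_of_forall_pair fun z _ w _ => ?_ }
  obtain ⟨V, hV, hz⟩ := hcov z
  obtain ⟨W, hW, hw⟩ := hcov w
  obtain ⟨x, hxV, hxW⟩ := nonempty_preirreducible_inter V.2 W.2 ⟨_, hz⟩ ⟨_, hw⟩
  obtain ⟨y, rfl⟩ := π.surjective x
  exact ⟨π ⁻¹' V ∪ π ⁻¹' W, Set.subset_univ _, Or.inl hz, Or.inr hw,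
    (h V hV ⟨_, hz⟩).union y hxV hxW (h W hW ⟨_, hw⟩)⟩

lemma geometricallyIntegral_of_isAlgClosed {k : Type u} [Field k] [IsAlgClosed k] {X : Scheme.{u}}
    (f : X ⟶ Spec (.of k)) [LocallyOfFiniteType f] [IsIntegral X] : GeometricallyIntegral f := by
  constructor
  rw [geometrically_iff_of_commRing]
  intro K _ _ Z π p H
  let q : Spec (.of K) ⟶ Spec (.of k) := Spec.map (CommRingCat.ofHom (algebraMap k K))
  have : Surjective q := ⟨fun y => ⟨Nonempty.some inferInstance, Subsingleton.elim _ _⟩⟩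
  have : Surjective π := MorphismProperty.of_isPullback H.flip this
  have : IsAffineHom π := MorphismProperty.of_isPullback H.flip (inferInstanceAs (IsAffineHom q))
  have hint (V : X.Opens) (hV : IsAffineOpen V) (_ : Nonempty V) : IsIntegral (π ⁻¹ᵁ V) :=
    have := isDomain_sections_preimage H hV
    isIntegral_of_isDomain_sections (hV.preimage π)
  have : ConnectedSpace Z := connectedSpace_of_surjective_of_isPreconnected_preimage π
    fun V hV hne => by
      have := hint V hV hne
      rw [← Scheme.Hom.coe_preimage, ← (π ⁻¹ᵁ V).range_ι, ← Set.image_univ]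
      exact isPreconnected_univ.image _ (π ⁻¹ᵁ V).ι.continuous.continuousOn
  refine isIntegral_of_connectedSpace fun z => ?_
  obtain ⟨V, hV, hz, -⟩ := exists_isAffineOpen_mem_and_subset (U := (⊤ : X.Opens)) (x := π z)
    trivial
  exact ⟨π ⁻¹ᵁ V, hz, hint V hV ⟨_, hz⟩⟩

end GeometricIntegrality

/-! ### Flatness of cokernels and density of families of domains -/

section Flatness

open TensorProduct

/-- Dévissage along a filtration of `M` with quotients of the form `R ⧸ p`. -/
lemma eq_zero_of_smul_eq_zero_of_prime {R A : Type*} [CommRing R] [IsNoetherianRing R] [CommRing A]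
    [Algebra R A] [Module.Flat R A] (J : Set A)
    (H : ∀ p : Ideal R, p.IsPrime → ∀ x : A ⊗[R] (R ⧸ p), (∀ h ∈ J, h • x = 0) → x = 0)
    {M : Type*} [AddCommGroup M] [Module R M] [hM : Module.Finite R M] {x : A ⊗[R] M}
    (hx : ∀ h ∈ J, h • x = 0) : x = 0 := by
  revert x
  induction hM using IsNoetherianRing.induction_on_isQuotientEquivQuotientPrime R with
  | subsingleton N => exact fun {x} _ => Subsingleton.elim _ _
  | quotient N p e =>
    intro x hx
    let E : A ⊗[R] N ≃ₗ[A] A ⊗[R] (R ⧸ p.1) := e.baseChange R A N _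
    rw [← E.map_eq_zero_iff]
    exact H p.1 p.2 _ fun h hh => by rw [← map_smul, hx h hh, map_zero]
  | exact N₁ N₂ N₃ f g hf hg hfg h₁ h₃ =>
    intro x hx
    have hgx : g.baseChange A x = 0 := h₃ fun h hh => by rw [← map_smul, hx h hh, map_zero]
    have hex : Function.Exact (f.baseChange A) (g.baseChange A) := lTensor_exact A hfg hg
    obtain ⟨y, rfl⟩ := (hex x).mp hgx
    have hinj : Function.Injective (f.baseChange A) :=
      Module.Flat.lTensor_preserves_injective_linearMap (M := A) f hf
    rw [h₁ (x := y) fun h hh => hinj (by rw [map_smul, hx h hh, map_zero]), map_zero]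

lemma exact_rTensor_subtype_mkQ {R : Type*} [CommRing R] (I : Ideal R) (P : Type*) [AddCommGroup P]
    [Module R P] : Function.Exact (I.subtype.rTensor P) ((Submodule.mkQ I).rTensor P) :=
  rTensor_exact P (LinearMap.exact_subtype_mkQ I) (Submodule.mkQ_surjective I)

/-- Diagram chase in the tensor product of `0 → I → R → R ⧸ I → 0` with `N → F → Q → 0`. -/
lemma flat_of_lTensor_quotient_injective {R : Type*} {N F Q : Type u} [CommRing R] [AddCommGroup N]
    [AddCommGroup F] [AddCommGroup Q] [Module R N] [Module R F] [Module R Q] [Module.Flat R F]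
    {f : N →ₗ[R] F} {g : F →ₗ[R] Q} (hfg : Function.Exact f g) (hg : Function.Surjective g)
    (H : ∀ I : Ideal R, Function.Injective (f.lTensor (R ⧸ I))) : Module.Flat R Q := by
  rw [Module.Flat.iff_rTensor_injective']
  intro I
  rw [injective_iff_map_eq_zero]
  intro x hx
  obtain ⟨y, rfl⟩ := LinearMap.lTensor_surjective I hg x
  have hy : g.lTensor R (I.subtype.rTensor F y) = 0 := by
    rw [← hx, ← LinearMap.comp_apply, ← LinearMap.comp_apply, LinearMap.lTensor_comp_rTensor,
      LinearMap.rTensor_comp_lTensor]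
  obtain ⟨b, hb⟩ := (lTensor_exact R hfg hg _).mp hy
  have hbI : (Submodule.mkQ I).rTensor N b = 0 := by
    apply H I
    rw [map_zero, ← LinearMap.comp_apply, LinearMap.lTensor_comp_rTensor,
      ← LinearMap.rTensor_comp_lTensor, LinearMap.comp_apply, hb]
    exact (exact_rTensor_subtype_mkQ I F).apply_apply_eq_zero y
  obtain ⟨c, rfl⟩ := (exact_rTensor_subtype_mkQ I N b).mp hbI
  have hcy : f.lTensor I c = y := by
    apply Module.Flat.rTensor_preserves_injective_linearMap (M := F) I.subtype
      (Submodule.subtype_injective I)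
    rw [← hb, ← LinearMap.comp_apply, ← LinearMap.comp_apply, LinearMap.lTensor_comp_rTensor,
      LinearMap.rTensor_comp_lTensor]
  rw [← hcy, ← LinearMap.comp_apply, ← LinearMap.lTensor_comp, hfg.linearMap_comp_eq_zero,
    LinearMap.lTensor_zero, LinearMap.zero_apply]

lemma comm_lTensor_lmul {R A M : Type*} [CommRing R] [CommRing A] [Algebra R A] [AddCommGroup M]
    [Module R M] (b : A) (y : M ⊗[R] A) :
    TensorProduct.comm R M A ((Algebra.lmul R A b).lTensor M y) =
      b • TensorProduct.comm R M A y := by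
  induction y with
  | zero => simp
  | add y z hy hz => simp only [map_add, hy, hz, smul_add]
  | tmul m a => simp [smul_tmul']

lemma flat_quotient_span_singleton {R A : Type u} [CommRing R] [CommRing A] [Algebra R A]
    [Module.Flat R A] {ι : Type} [Finite ι] (f : ι → A) (j : ι)
    (H : ∀ (I : Ideal R) (x : A ⊗[R] (R ⧸ I)), f j • x = 0 → x = 0) :
    Module.Flat R ((ι → A) ⧸ Submodule.span A {f}) := by
  let F : A →ₗ[R] (ι → A) := (LinearMap.toSpanSingleton A (ι → A) f).restrictScalars R
  have hF : (LinearMap.proj j : (ι → A) →ₗ[R] A) ∘ₗ F = Algebra.lmul R A (f j) :=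
    LinearMap.ext fun a => mul_comm a (f j)
  let G : (ι → A) →ₗ[R] (ι → A) ⧸ Submodule.span A {f} :=
    { toFun := Submodule.Quotient.mk
      map_add' := fun _ _ => rfl
      map_smul' := fun _ _ => rfl }
  have hexact : Function.Exact F G := fun v => by
    change Submodule.Quotient.mk v = 0 ↔ _
    rw [Submodule.Quotient.mk_eq_zero, Submodule.mem_span_singleton]
    rfl
  have : Module.Flat R (ι → A) := by
    classical
    have := Fintype.ofFinite ι
    exact Module.Flat.of_linearEquiv ((Finsupp.linearEquivFunOnFinite R A ι).symm.trans
      (finsuppLEquivDirectSum R A ι))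
  refine flat_of_lTensor_quotient_injective hexact (Submodule.Quotient.mk_surjective _) fun I => ?_
  rw [injective_iff_map_eq_zero]
  intro x hx
  refine (LinearEquiv.map_eq_zero_iff (TensorProduct.comm R _ _)).mp (H I _ ?_)
  rw [← comm_lTensor_lmul, ← hF, LinearMap.lTensor_comp, LinearMap.comp_apply, hx, map_zero,
    map_zero]

end Flatness

section Density

open TensorProduct

lemma section_ext_germ {Z : Scheme.{u}} {V : Z.Opens} {a b : Γ(Z, V)}
    (h : ∀ (z : Z) (hz : z ∈ V), Z.presheaf.germ V z hz a = Z.presheaf.germ V z hz b) : a = b :=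
  TopCat.Presheaf.section_ext Z.sheaf V a b h

lemma exists_mem_inter_of_irreducible_fibre {Z S : Scheme.{u}} (p : Z ⟶ S)
    [GeometricallyIntegral p] [UniversallyOpen p] {U V : Z.Opens} {u v : Z} (hu : u ∈ U)
    (hv : v ∈ V) (h : p u = p v) : ∃ z ∈ U, z ∈ V ∧ p z = p u := by
  have hirr := p.isIrreducible_preimage p.isOpenMap (isIrreducible_singleton (x := p u))
  obtain ⟨z, hz, hzU, hzV⟩ := hirr.2 U V U.2 V.2 ⟨u, rfl, hu⟩ ⟨v, h.symm, hv⟩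
  exact ⟨z, hzU, hzV, hz⟩

lemma appTop_specMap_comp_isoSpec_inv {S : Scheme.{u}} [IsAffine S] {R : CommRingCat.{u}}
    (φ : Γ(S, ⊤) ⟶ R) :
    (Spec.map φ ≫ S.isoSpec.inv).appTop = φ ≫ (Scheme.ΓSpecIso R).inv := by
  have hinv : S.isoSpec.inv.appTop = (Scheme.ΓSpecIso Γ(S, ⊤)).inv := by
    rw [← cancel_mono (Scheme.ΓSpecIso Γ(S, ⊤)).hom, Iso.inv_hom_id, ← S.toSpecΓ_appTop]
    exact (Scheme.Hom.comp_appTop _ _).symm.trans (by simp)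
  rw [Scheme.ΓSpecIso_inv_naturality, ← hinv, ← Scheme.Hom.comp_appTop]

lemma exists_addEquiv_tensorProduct_preimage {Z Z' S : Scheme.{u}} [IsAffine S] {p : Z ⟶ S}
    {R : Type u} [CommRing R] [Algebra Γ(S, ⊤) R] {G : Z' ⟶ Z} {p' : Z' ⟶ Spec (.of R)}
    (H : IsPullback G p' p (Spec.map (CommRingCat.ofHom (algebraMap Γ(S, ⊤) R)) ≫ S.isoSpec.inv))
    {V : Z.Opens} (hV : IsAffineOpen V) :
    letI : Algebra Γ(S, ⊤) Γ(Z, V) := (p.appLE ⊤ V le_top).hom.toAlgebra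
    ∃ ψ : Γ(Z, V) ⊗[Γ(S, ⊤)] R ≃+ Γ(Z', G ⁻¹ᵁ V), ∀ a x, ψ (a • x) = G.app V a * ψ x := by
  let φ := CommRingCat.ofHom (algebraMap Γ(S, ⊤) R)
  let g := Spec.map φ ≫ S.isoSpec.inv
  let : Algebra Γ(S, ⊤) Γ(Z, V) := (p.appLE ⊤ V le_top).hom.toAlgebra
  let : Algebra Γ(S, ⊤) Γ(Spec (.of R), ⊤) := (g.appLE ⊤ ⊤ le_top).hom.toAlgebra
  obtain ⟨e, he⟩ := exists_tensorProduct_equiv_preimage H hV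
  let ε : R ≃ₐ[Γ(S, ⊤)] Γ(Spec (.of R), ⊤) :=
    AlgEquiv.ofRingEquiv (f := (Scheme.ΓSpecIso (.of R)).commRingCatIsoToRingEquiv.symm) fun a =>
      (ConcreteCategory.congr_hom (appTop_specMap_comp_isoSpec_inv φ) a).symm.trans <| by
        rw [Scheme.Hom.appTop, Scheme.Hom.app_eq_appLE]; rfl
  let ψ : Γ(Z, V) ⊗[Γ(S, ⊤)] R ≃+* Γ(Z', G ⁻¹ᵁ V) :=
    (Algebra.TensorProduct.congr (AlgEquiv.refl (R := Γ(S, ⊤)) (A₁ := Γ(Z, V))) ε).toRingEquiv.trans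
      e
  refine ⟨ψ.toAddEquiv, fun a x => ?_⟩
  have hax : a • x = a ⊗ₜ 1 * x := by
    rw [← Algebra.TensorProduct.includeLeft_apply (S := Γ(S, ⊤)), Algebra.smul_def]
    rfl
  have ha : ψ (a ⊗ₜ 1) = G.app V a := by simp [ψ, he]
  exact (congrArg ψ hax).trans ((map_mul ψ _ _).trans (congrArg (· * ψ x) ha))

/-- The point `v` lies over the image of the generic point of `T`. -/
lemma exists_app_mul_ne_zero {Z Z' T S : Scheme.{u}} [IsIntegral T] [IsIntegral Z'] {G : Z' ⟶ Z}
    {p' : Z' ⟶ T} {p : Z ⟶ S} {g : T ⟶ S} (H : IsPullback G p' p g) [UniversallyOpen p']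
    {V : Z.Opens} {y : Γ(Z', G ⁻¹ᵁ V)} (hy : y ≠ 0) :
    ∃ v ∈ V, ∀ (h : Γ(Z, V)), ∀ z ∈ Z.basicOpen h, p z = p v → G.app V h * y ≠ 0 := by
  obtain ⟨w, hw⟩ : ((G ⁻¹ᵁ V : Z'.Opens) : Set Z').Nonempty :=
    (Opens.ne_bot_iff_nonempty _).mp fun hbot =>
      have : Subsingleton Γ(Z', G ⁻¹ᵁ V) := by rw [hbot]; infer_instance
      hy (Subsingleton.elim _ _)
  have : Nonempty (G ⁻¹ᵁ V : Z'.Opens) := ⟨⟨w, hw⟩⟩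
  obtain ⟨v', hv', hv'η⟩ : ∃ v' ∈ G ⁻¹ᵁ V, p' v' = genericPoint T :=
    (genericPoint_specializes (p' w)).mem_open (p'.isOpenMap _ (G ⁻¹ᵁ V).2) ⟨w, hw, rfl⟩
  refine ⟨G v', hv', fun h z hz hzv => mul_ne_zero (fun h0 => ?_) hy⟩
  have hg : p z = g (genericPoint T) := by
    rw [hzv, ← hv'η, ← Scheme.Hom.comp_apply, ← Scheme.Hom.comp_apply, H.w]
  obtain ⟨z', rfl⟩ : ∃ z', G z' = z := by
    obtain ⟨z', hz', -⟩ := Scheme.Pullback.exists_preimage_pullback z _ hg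
    exact ⟨H.isoPullback.inv z', by
      rw [← Scheme.Hom.comp_apply, IsPullback.isoPullback_inv_fst, hz']⟩
  have hz' : z' ∈ G ⁻¹ᵁ Z.basicOpen h := hz
  rw [Scheme.preimage_basicOpen, h0, Scheme.basicOpen_zero] at hz'
  exact hz'

variable {Z S : Scheme.{u}} (p : Z ⟶ S) [IsAffine S] [IsLocallyNoetherian S]
  [GeometricallyIntegral p] [Flat p] [UniversallyOpen p]

lemma exists_smul_ne_zero_of_basicOpen {V : Z.Opens} (hV : IsAffineOpen V) (P : Ideal Γ(S, ⊤))
    [P.IsPrime] :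
    letI : Algebra Γ(S, ⊤) Γ(Z, V) := (p.appLE ⊤ V le_top).hom.toAlgebra
    ∀ x : Γ(Z, V) ⊗[Γ(S, ⊤)] (Γ(S, ⊤) ⧸ P), x ≠ 0 → ∃ v ∈ V,
      ∀ (h : Γ(Z, V)), ∀ z ∈ Z.basicOpen h, p z = p v → h • x ≠ 0 := by
  let R : CommRingCat := .of (Γ(S, ⊤) ⧸ P)
  let g : Spec R ⟶ S :=
    Spec.map (CommRingCat.ofHom (algebraMap Γ(S, ⊤) (Γ(S, ⊤) ⧸ P))) ≫ S.isoSpec.inv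
  have hpb : IsPullback (pullback.fst p g) (pullback.snd p g) p g := .of_hasPullback p g
  have : IsNoetherianRing Γ(S, ⊤) :=
    IsLocallyNoetherian.component_noetherian ⟨⊤, isAffineOpen_top S⟩
  have : IsNoetherianRing R := inferInstanceAs (IsNoetherianRing (Γ(S, ⊤) ⧸ P))
  have : IsDomain R := inferInstanceAs (IsDomain (Γ(S, ⊤) ⧸ P))
  have : IsIntegral (pullback p g) := inferInstance
  let : Algebra Γ(S, ⊤) Γ(Z, V) := (p.appLE ⊤ V le_top).hom.toAlgebra
  obtain ⟨ψ, hψ⟩ := exists_addEquiv_tensorProduct_preimage hpb hV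
  intro x hx
  obtain ⟨v, hv, hne⟩ := exists_app_mul_ne_zero hpb ((map_ne_zero_iff ψ ψ.injective).mpr hx)
  exact ⟨v, hv, fun h z hz hzv h0 => hne h z hz hzv (by rw [← hψ, h0, map_zero])⟩

lemma eq_zero_of_smul_eq_zero_of_surjective {U : Z.Opens} (hU : ∀ s, ∃ z ∈ U, p z = s)
    {V : Z.Opens} (hV : IsAffineOpen V) {J : Set Γ(Z, V)}
    (hJ : ∀ z ∈ V, z ∈ U → ∃ h ∈ J, z ∈ Z.basicOpen h)
    {M : Type*} [AddCommGroup M] [Module Γ(S, ⊤) M] [Module.Finite Γ(S, ⊤) M] :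
    letI : Algebra Γ(S, ⊤) Γ(Z, V) := (p.appLE ⊤ V le_top).hom.toAlgebra
    ∀ x : Γ(Z, V) ⊗[Γ(S, ⊤)] M, (∀ h ∈ J, h • x = 0) → x = 0 := by
  have : IsNoetherianRing Γ(S, ⊤) :=
    IsLocallyNoetherian.component_noetherian ⟨⊤, isAffineOpen_top S⟩
  let : Algebra Γ(S, ⊤) Γ(Z, V) := (p.appLE ⊤ V le_top).hom.toAlgebra
  have : Module.Flat Γ(S, ⊤) Γ(Z, V) := p.flat_appLE (isAffineOpen_top S) hV le_top
  refine fun x => eq_zero_of_smul_eq_zero_of_prime J fun P _ x hx => ?_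
  by_contra hne
  obtain ⟨v, hv, H⟩ := exists_smul_ne_zero_of_basicOpen p hV P x hne
  obtain ⟨w, hw, hwv⟩ := hU (p v)
  obtain ⟨z, hzU, hzV, hz⟩ := exists_mem_inter_of_irreducible_fibre p hw hv hwv
  obtain ⟨h, hh, hzh⟩ := hJ z hzV hzU
  exact H h z hzh (hz.trans hwv) (hx h hh)

lemma eq_zero_of_mul_eq_zero_of_surjective {U : Z.Opens} (hU : ∀ s, ∃ z ∈ U, p z = s)
    {V : Z.Opens} (hV : IsAffineOpen V) {J : Set Γ(Z, V)}
    (hJ : ∀ z ∈ V, z ∈ U → ∃ h ∈ J, z ∈ Z.basicOpen h) {a : Γ(Z, V)}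
    (ha : ∀ h ∈ J, h * a = 0) : a = 0 := by
  let : Algebra Γ(S, ⊤) Γ(Z, V) := (p.appLE ⊤ V le_top).hom.toAlgebra
  have := eq_zero_of_smul_eq_zero_of_surjective p hU hV hJ (a ⊗ₜ (1 : Γ(S, ⊤))) fun h hh => by
    rw [smul_tmul', smul_eq_mul, ha h hh, zero_tmul]
  simpa using congrArg (AlgebraTensorModule.rid Γ(S, ⊤) Γ(Z, V) Γ(Z, V)) this

lemma section_eq_zero_of_surjective {U : Z.Opens} (hU : ∀ s, ∃ z ∈ U, p z = s) {V : Z.Opens}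
    {a : Γ(Z, V)} (ha : ∀ (z : Z) (hz : z ∈ V), z ∈ U → Z.presheaf.germ V z hz a = 0) : a = 0 := by
  wlog hV : IsAffineOpen V generalizing V
  · refine Z.IsSheaf.section_ext fun x hx => ?_
    obtain ⟨W, hW, hxW, hWV⟩ := exists_isAffineOpen_mem_and_subset hx
    refine ⟨W, hWV, hxW, ?_⟩
    rw [map_zero]
    refine this (fun z hz hzU => ?_) hW
    have := ha z (hWV hz) hzU
    rwa [← Z.presheaf.germ_res_apply (homOfLE hWV) z hz] at this
  refine eq_zero_of_mul_eq_zero_of_surjective p hU hV (J := {h | h * a = 0}) (fun z hzV hzU => ?_)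
    fun h hh => hh
  obtain ⟨h, hle, hzh⟩ := hV.exists_basicOpen_le ⟨z, hzU⟩ hzV
  have h0 : TopCat.Presheaf.restrictOpen a (Z.basicOpen h) (Z.basicOpen_le h) = 0 := by
    refine section_ext_germ fun y hy => ?_
    rw [map_zero]
    exact (Z.presheaf.germ_res_apply (homOfLE (Z.basicOpen_le h)) y hy a).trans
      (ha y (Z.basicOpen_le h hy) (hle hy))
  obtain ⟨n, hn⟩ := exists_pow_mul_eq_zero_of_res_basicOpen_eq_zero_of_isCompact Z hV.isCompact a h
    h0
  refine ⟨h ^ (n + 1), ?_, (Scheme.basicOpen_pow _ _ n.succ_pos).ge hzh⟩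
  change h ^ (n + 1) * a = 0
  rw [pow_succ', mul_assoc, hn, mul_zero]

lemma flat_quotient_span_singleton_of_surjective {U : Z.Opens} (hU : ∀ s, ∃ z ∈ U, p z = s)
    {V : Z.Opens} (hV : IsAffineOpen V) {ι : Type} [Finite ι] (f : ι → Γ(Z, V)) (j : ι)
    (hf : ∀ z ∈ V, z ∈ U → z ∈ Z.basicOpen (f j)) :
    letI : Algebra Γ(S, ⊤) Γ(Z, V) := (p.appLE ⊤ V le_top).hom.toAlgebra
    Module.Flat Γ(S, ⊤) ((ι → Γ(Z, V)) ⧸ Submodule.span Γ(Z, V) {f}) := by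
  let : Algebra Γ(S, ⊤) Γ(Z, V) := (p.appLE ⊤ V le_top).hom.toAlgebra
  have : Module.Flat Γ(S, ⊤) Γ(Z, V) := p.flat_appLE (isAffineOpen_top S) hV le_top
  refine flat_quotient_span_singleton f j fun I x hx =>
    eq_zero_of_smul_eq_zero_of_surjective p hU hV (J := {f j}) ?_ x (by rintro _ rfl; exact hx)
  exact fun z hzV hzU => ⟨f j, rfl, hf z hzV hzU⟩

end Density

section DomainFamily

variable {k : Type u} [Field k] {S X : Sch k}

lemma exists_prodMap_eq {T : Sch k} (g : T ⟶ S) {z : prodOver S X} {t : T.left}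
    (h : pullback.fst S.hom X.hom z = g.left t) :
    ∃ y, prodMap g X y = z ∧ pullback.fst T.hom X.hom y = t := by
  obtain ⟨y, hy, hyt⟩ := Scheme.Pullback.exists_preimage_pullback z t h
  let e := (prodMap_isPullback g X).isoPullback
  refine ⟨e.inv y, ?_, ?_⟩
  · rw [← Scheme.Hom.comp_apply, IsPullback.isoPullback_inv_fst, hy]
  · rw [← Scheme.Hom.comp_apply, IsPullback.isoPullback_inv_snd, hyt]

lemma isDomainFamily_iff [GeometricallyIntegral X.hom]
    {U : (prodOver S X).Opens} :
    IsDomainFamily U ↔ ∀ s : S.left, ∃ z ∈ U, pullback.fst S.hom X.hom z = s := by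
  constructor
  · intro hU s
    let T : Sch k := Over.mk (S.left.fromSpecResidueField s ≫ S.hom)
    let g : T ⟶ S := Over.homMk (S.left.fromSpecResidueField s)
    obtain ⟨t⟩ : Nonempty T.left := inferInstanceAs (Nonempty (Spec _))
    obtain ⟨y, -⟩ := (pullback.fst T.hom X.hom).surjective t
    obtain ⟨z, -, hz⟩ := (hU T g).inter_open_nonempty _ isOpen_univ ⟨y, trivial⟩
    refine ⟨prodMap g X z, hz, ?_⟩
    rw [← Scheme.Hom.comp_apply, prodMap_fst, Scheme.Hom.comp_apply]
    exact S.left.fromSpecResidueField_apply s _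
  · intro hU T g
    rw [dense_iff_inter_open]
    rintro W hW ⟨w, hw⟩
    obtain ⟨z, hz, hzs⟩ := hU (g.left (pullback.fst T.hom X.hom w))
    obtain ⟨y, rfl, hyt⟩ := exists_prodMap_eq g hzs
    obtain ⟨x, hxW, hx, -⟩ := exists_mem_inter_of_irreducible_fibre (pullback.fst T.hom X.hom)
      (U := ⟨W, hW⟩) (V := prodMap g X ⁻¹ᵁ U) hw hz hyt.symm
    exact ⟨x, hxW, hx⟩

end DomainFamily

/-! ### Standard affine charts of projective space -/

section Charts

variable {k : Type u} [Field k]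

section Scalars

/-- The structure map `k → Γ(V, 𝒪_Z)` of a `k`-scheme. -/
def sectionScalar {Z : Scheme.{u}} (s : Z ⟶ Spec (CommRingCat.of k)) (V : Z.Opens) :
    k →+* Γ(Z, V) :=
  ((Scheme.ΓSpecIso (CommRingCat.of k)).inv ≫ s.appLE ⊤ V le_top).hom

lemma germ_sectionScalar {Z : Scheme.{u}} (s : Z ⟶ Spec (CommRingCat.of k)) (V : Z.Opens) (z : Z)
    (hz : z ∈ V) : (Z.presheaf.germ V z hz).hom.comp (sectionScalar s V) = scalar s z := by
  rw [sectionScalar, scalar, ← CommRingCat.hom_comp, Category.assoc]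
  congr 2
  exact (Category.assoc _ _ _).trans
    (congrArg (s.app ⊤ ≫ ·) (Z.presheaf.germ_res (homOfLE le_top) z hz))

lemma appLE_sectionScalar {W Z : Scheme.{u}} (G : W ⟶ Z) (s : Z ⟶ Spec (CommRingCat.of k))
    (V : Z.Opens) (U : W.Opens) (h : U ≤ G ⁻¹ᵁ V) :
    (G.appLE V U h).hom.comp (sectionScalar s V) = sectionScalar (G ≫ s) U := by
  rw [sectionScalar, sectionScalar, ← CommRingCat.hom_comp, Category.assoc]
  congr 2
  exact Scheme.Hom.appLE_comp_appLE _ _ _ _ _ _ _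

lemma hom_ext_sectionScalar {Z : Scheme.{u}} {s t : Z ⟶ Spec (CommRingCat.of k)}
    (h : sectionScalar s ⊤ = sectionScalar t ⊤) : s = t := by
  refine ext_of_isAffine ?_
  have h1 := CommRingCat.hom_ext h
  rw [cancel_epi] at h1
  have h2 : ∀ r : Z ⟶ Spec (CommRingCat.of k), r.appLE ⊤ ⊤ le_top = r.appTop := fun r =>
    (Scheme.Hom.app_eq_appLE (f := r) (U := ⊤)).symm
  exact (h2 s).symm.trans (h1.trans (h2 t))

lemma sectionScalar_of_toSpecΓ {Z : Scheme.{u}} {s : Z ⟶ Spec (CommRingCat.of k)} {V : Z.Opens}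
    (χ : CommRingCat.of k ⟶ Γ(Z, V)) (h : V.ι ≫ s = V.toSpecΓ ≫ Spec.map χ) :
    sectionScalar s V = χ.hom := by
  have h1 := congrArg Scheme.Hom.appTop h
  rw [Scheme.Hom.comp_appTop, Scheme.Hom.comp_appTop, Scheme.Opens.toSpecΓ_appTop,
    ← Category.assoc, Scheme.ΓSpecIso_naturality, Category.assoc, ← Iso.inv_comp_eq,
    Iso.eq_comp_inv] at h1
  rw [← h1, sectionScalar]
  congr 1
  simp only [Category.assoc]
  congr 1
  change s.app ⊤ ≫ _ = s.app ⊤ ≫ _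
  congr 1
  exact Z.presheaf.map_comp (X := op ⊤) (Y := op (V.ι ''ᵁ ⊤)) (Z := op V)
    (homOfLE le_top).op (eqToHom (by simp)).op

end Scalars

section AffineTarget

variable {W Z : Scheme.{u}} {V : Z.Opens} (hV : IsAffineOpen V)

/-- The morphism to an affine open subscheme given by a homomorphism on sections. -/
def homOfAffineOpen (ψ : Γ(Z, V) ⟶ Γ(W, ⊤)) : W ⟶ Z := W.toSpecΓ ≫ Spec.map ψ ≫ hV.fromSpec

lemma top_le_preimage_homOfAffineOpen (ψ : Γ(Z, V) ⟶ Γ(W, ⊤)) :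
    ⊤ ≤ homOfAffineOpen hV ψ ⁻¹ᵁ V := by
  rintro w -
  change hV.fromSpec _ ∈ (V : Set Z)
  rw [← hV.range_fromSpec]
  exact ⟨_, rfl⟩

lemma eq_homOfAffineOpen (α : W ⟶ Z) (h : ⊤ ≤ α ⁻¹ᵁ V) :
    α = homOfAffineOpen hV (α.appLE V ⊤ h) := by
  rw [← cancel_epi W.topIso.hom, homOfAffineOpen]
  change (⊤ : W.Opens).ι ≫ α = (⊤ : W.Opens).ι ≫ W.toSpecΓ ≫ _
  rw [← Category.assoc (Scheme.Opens.ι _) W.toSpecΓ, ← Scheme.Opens.toSpecΓ_top,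
    Scheme.Opens.toSpecΓ_SpecMap_appLE_assoc, hV.toSpecΓ_fromSpec, Scheme.Hom.resLE_comp_ι]

lemma homOfAffineOpen_appLE (ψ : Γ(Z, V) ⟶ Γ(W, ⊤)) :
    (homOfAffineOpen hV ψ).appLE V ⊤ (top_le_preimage_homOfAffineOpen hV ψ) = ψ := by
  have h1 := eq_homOfAffineOpen hV _ (top_le_preimage_homOfAffineOpen hV ψ)
  generalize (homOfAffineOpen hV ψ).appLE V ⊤ (top_le_preimage_homOfAffineOpen hV ψ) = φ at h1
  rw [homOfAffineOpen, homOfAffineOpen, ← Category.assoc, ← Category.assoc, cancel_mono] at h1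
  have h2 := congrArg Scheme.Hom.appTop h1
  simp only [Scheme.Hom.comp_appTop, Scheme.toSpecΓ_appTop, Scheme.ΓSpecIso_naturality] at h2
  exact ((cancel_epi _).mp h2).symm

lemma hom_ext_of_affineOpen (hV : IsAffineOpen V) {α β : W ⟶ Z} (h : ⊤ ≤ α ⁻¹ᵁ V)
    (h' : ⊤ ≤ β ⁻¹ᵁ V) (e : α.appLE V ⊤ h = β.appLE V ⊤ h') : α = β := by
  rw [eq_homOfAffineOpen hV α h, eq_homOfAffineOpen hV β h', e]

end AffineTarget

section GradedRing

variable {A : Type u} [CommRing A] {σ : Type*} [SetLike σ A] [AddSubgroupClass σ A] (𝒜 : ℕ → σ)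
  [GradedRing 𝒜]

open HomogeneousLocalization

lemma basicOpen_ι_toSpecZero (f : A) {m : ℕ} (hf : f ∈ 𝒜 m) (hm : 0 < m) :
    (Proj.basicOpen 𝒜 f).ι ≫ Proj.toSpecZero 𝒜 = (Proj.basicOpen 𝒜 f).toSpecΓ ≫
      Spec.map (CommRingCat.ofHom (fromZeroRingHom 𝒜 (.powers f)) ≫ Proj.awayToSection 𝒜 f) := by
  rw [Spec.map_comp, ← Proj.awayι_toSpecZero _ _ hf hm, ← Proj.basicOpenIsoSpec_inv_ι]
  simp only [← Category.assoc]
  rw [← Proj.basicOpenToSpec, ← Proj.basicOpenIsoSpec_hom _ _ hf hm, Iso.hom_inv_id,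
    Category.id_comp]

lemma val_awayMap_mk {f g : A} (hf : f ∈ 𝒜 1) (hg : g ∈ 𝒜 1) {x : A} (hx : x = f * g) {d : ℕ}
    (F : A) (hF : F ∈ 𝒜 (d • 1)) :
    (awayMap 𝒜 hg hx (Away.mk 𝒜 hf d F hF)).val * algebraMap A (Localization.Away x) f ^ d =
      algebraMap A (Localization.Away x) F := by
  rw [val_awayMap, Away.val_mk, Localization.mk_eq_mk'_apply, ← map_pow]
  have h1 := IsLocalization.mk'_spec (Localization.Away f) F
    (⟨f ^ d, d, rfl⟩ : Submonoid.powers f)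
  have h2 := congrArg (Localization.awayLift (algebraMap A (Localization.Away x)) f
    (isUnit_of_dvd_unit (map_dvd _ ⟨_, hx⟩) (IsLocalization.Away.algebraMap_isUnit x))) h1
  rw [map_mul] at h2
  simpa only [Localization.awayLift, IsLocalization.Away.lift_eq] using h2

lemma awayMap_mk_eq_pow_mul {f g : A} (hf : f ∈ 𝒜 1) (hg : g ∈ 𝒜 1) {x : A} (hx : x = f * g)
    (hx' : x = g * f) {d : ℕ} (F : A) (hF : F ∈ 𝒜 (d • 1)) :
    awayMap 𝒜 hg hx (Away.mk 𝒜 hf d F hF) =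
      awayMap 𝒜 hg hx (Away.mk 𝒜 hf 1 g (by simpa using hg)) ^ d *
        awayMap 𝒜 hf hx' (Away.mk 𝒜 hg d F hF) := by
  apply HomogeneousLocalization.val_injective
  have hu : IsUnit (algebraMap A (Localization.Away x) f) :=
    isUnit_of_dvd_unit (map_dvd _ ⟨_, hx⟩) (IsLocalization.Away.algebraMap_isUnit x)
  apply (hu.pow d).mul_left_injective
  dsimp only
  rw [val_mul, val_pow, val_awayMap_mk 𝒜 hf hg hx F hF, ← val_awayMap_mk 𝒜 hg hf hx' F hF,
    ← val_awayMap_mk 𝒜 hf hg hx (d := 1) g (by simpa using hg)]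
  ring

lemma germ_awayToSection_awayMap {f g : A} {m : ℕ} (hg : g ∈ 𝒜 m) {x : A} (hx : x = f * g)
    (p : Proj 𝒜) (hpf : p ∈ Proj.basicOpen 𝒜 f) (hpx : p ∈ Proj.basicOpen 𝒜 x)
    (a : HomogeneousLocalization.Away 𝒜 f) :
    (Proj 𝒜).presheaf.germ _ p hpx (Proj.awayToSection 𝒜 x (awayMap 𝒜 hg hx a)) =
      (Proj 𝒜).presheaf.germ _ p hpf (Proj.awayToSection 𝒜 f a) := by
  rw [← (Proj 𝒜).presheaf.germ_res_apply (homOfLE (Proj.basicOpen_mono 𝒜 _ _ ⟨g, hx⟩)) p hpx]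
  have hmap := ConcreteCategory.congr_hom (Proj.awayMap_awayToSection 𝒜 hg hx) a
  exact congrArg _ hmap

lemma germ_awayToSection {f g : A} (hf : f ∈ 𝒜 1) (hg : g ∈ 𝒜 1) {d : ℕ}
    (F : A) (hF : F ∈ 𝒜 (d • 1)) (p : Proj 𝒜) (hpf : p ∈ Proj.basicOpen 𝒜 f)
    (hpg : p ∈ Proj.basicOpen 𝒜 g) :
    (Proj 𝒜).presheaf.germ _ p hpf (Proj.awayToSection 𝒜 f (Away.mk 𝒜 hf d F hF)) =
      (Proj 𝒜).presheaf.germ _ p hpf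
        (Proj.awayToSection 𝒜 f (Away.mk 𝒜 hf 1 g (by simpa using hg))) ^ d *
      (Proj 𝒜).presheaf.germ _ p hpg (Proj.awayToSection 𝒜 g (Away.mk 𝒜 hg d F hF)) := by
  have hp : p ∈ Proj.basicOpen 𝒜 (f * g) := by rw [Proj.basicOpen_mul]; exact ⟨hpf, hpg⟩
  rw [← germ_awayToSection_awayMap 𝒜 hg rfl p hpf hp,
    ← germ_awayToSection_awayMap 𝒜 hg rfl p hpf hp,
    ← germ_awayToSection_awayMap 𝒜 hf (mul_comm f g) p hpg hp,
    awayMap_mk_eq_pow_mul 𝒜 hf hg rfl (mul_comm f g) F hF]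
  simp only [map_mul, map_pow]

lemma basicOpen_awayToSection {f g : A} (hf : f ∈ 𝒜 1) (hg : g ∈ 𝒜 1) :
    (Proj 𝒜).basicOpen (Proj.awayToSection 𝒜 f (Away.mk 𝒜 hf 1 g (by simpa using hg))) =
      Proj.basicOpen 𝒜 f ⊓ Proj.basicOpen 𝒜 g := by
  set s := Proj.awayToSection 𝒜 f (Away.mk 𝒜 hf 1 g (by simpa using hg)) with hs
  have hι : (Proj.basicOpen 𝒜 f).ι = Proj.basicOpenToSpec 𝒜 f ≫ Proj.awayι 𝒜 f hf one_pos := by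
    rw [← Proj.basicOpenIsoSpec_hom _ _ hf one_pos, ← Proj.basicOpenIsoSpec_inv_ι,
      Iso.hom_inv_id_assoc]
  have helem : Away.isLocalizationElem hf hg = Away.mk 𝒜 hf 1 g (by simpa using hg) := by
    apply HomogeneousLocalization.val_injective
    simp [Away.isLocalizationElem]
  have hpre : (Proj.basicOpen 𝒜 f).ι ⁻¹ᵁ Proj.basicOpen 𝒜 g =
      (Proj.basicOpen 𝒜 f).ι ⁻¹ᵁ (Proj 𝒜).basicOpen s := by
    rw [← Scheme.Opens.toSpecΓ_preimage_basicOpen, hs, ← helem, hι, Scheme.Hom.comp_preimage,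
      Proj.awayι_preimage_basicOpen 𝒜 hf one_pos hg one_pos]
    rfl
  have himage := congrArg ((Proj.basicOpen 𝒜 f).ι ''ᵁ ·) hpre
  simp only [Scheme.Hom.image_preimage_eq_opensRange_inf, Scheme.Opens.opensRange_ι] at himage
  exact (himage.trans (inf_eq_right.mpr ((Proj 𝒜).basicOpen_le s))).symm

end GradedRing

section Proj
attribute [local instance] MvPolynomial.gradedAlgebra
open MvPolynomial

variable {n : ℕ}

/-- The inclusion of the ring of functions on `D₊(x_j)` into the localization at `x_j`. -/
def toLocalization (j : Fin (n + 1)) : Γ((projSpace k n).left, chart k n j) →+*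
    Localization.Away (X j : MvPolynomial (Fin (n + 1)) k) :=
  (algebraMap (HomogeneousLocalization.Away (homogeneousSubmodule (Fin (n + 1)) k) (X j))
    (Localization.Away (X j : MvPolynomial (Fin (n + 1)) k))).comp
    (Proj.basicOpenIsoAway (homogeneousSubmodule (Fin (n + 1)) k) (X j) (isHomogeneous_X k j)
      one_pos).inv.hom

lemma toLocalization_injective (j : Fin (n + 1)) :
    Function.Injective (toLocalization (k := k) j) := by
  have h1 := (ConcreteCategory.bijective_of_isIso (Proj.basicOpenIsoAway
    (homogeneousSubmodule (Fin (n + 1)) k) (X j) (isHomogeneous_X k j) one_pos).inv).1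
  exact (HomogeneousLocalization.val_injective _).comp h1

lemma toLocalization_awayToSection (j : Fin (n + 1)) (a) :
    toLocalization (k := k) j
      ((Proj.awayToSection (homogeneousSubmodule (Fin (n + 1)) k) (X j)).hom a) = a.val := by
  change HomogeneousLocalization.val _ = _
  congr 1
  exact ConcreteCategory.congr_hom (Proj.basicOpenIsoAway
    (homogeneousSubmodule (Fin (n + 1)) k) (X j) (isHomogeneous_X k j) one_pos).hom_inv_id a

lemma toLocalization_ratio (j : Fin (n + 1)) {d : ℕ} (F : MvPolynomial (Fin (n + 1)) k)
    (hF : F.IsHomogeneous d) :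
    toLocalization j (ratio j F hF) * algebraMap _ _ (X j : MvPolynomial (Fin (n + 1)) k) ^ d =
      algebraMap _ _ F := by
  have h1 : toLocalization j (ratio j F hF) =
      IsLocalization.mk' (Localization.Away (X j : MvPolynomial (Fin (n + 1)) k)) F
        (⟨X j ^ d, d, rfl⟩ : Submonoid.powers (X j : MvPolynomial (Fin (n + 1)) k)) :=
    (toLocalization_awayToSection j _).trans (Localization.mk_eq_mk'_apply _ _)
  rw [h1, ← map_pow]
  exact IsLocalization.mk'_spec _ _ _

lemma ratio_eq_of_toLocalization (j : Fin (n + 1)) {d : ℕ} {F : MvPolynomial (Fin (n + 1)) k}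
    (hF : F.IsHomogeneous d) {a : Γ((projSpace k n).left, chart k n j)}
    (h : toLocalization j a * algebraMap _ _ (X j : MvPolynomial (Fin (n + 1)) k) ^ d =
      algebraMap _ _ F) : ratio j F hF = a := by
  apply toLocalization_injective
  have hu : IsUnit (algebraMap (MvPolynomial (Fin (n + 1)) k)
      (Localization.Away (X j : MvPolynomial (Fin (n + 1)) k)) (X j)) :=
    IsLocalization.Away.algebraMap_isUnit _
  exact (hu.pow d).mul_left_injective ((toLocalization_ratio j F hF).trans h.symm)

lemma ratio_surjective (j : Fin (n + 1)) (a : Γ((projSpace k n).left, chart k n j)) :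
    ∃ (d : ℕ) (F : MvPolynomial (Fin (n + 1)) k) (hF : F.IsHomogeneous d), ratio j F hF = a := by
  obtain ⟨b, rfl⟩ := (ConcreteCategory.bijective_of_isIso (Proj.basicOpenIsoAway
    (homogeneousSubmodule (Fin (n + 1)) k) (X j) (isHomogeneous_X k j) one_pos).hom).2 a
  obtain ⟨d, F, hF, rfl⟩ := HomogeneousLocalization.Away.mk_surjective
    (homogeneousSubmodule (Fin (n + 1)) k) (isHomogeneous_X k j) b
  exact ⟨d, F, by simpa using hF, rfl⟩

lemma ratio_self (j : Fin (n + 1)) : ratio (k := k) j (X j) (isHomogeneous_X k j) = 1 :=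
  ratio_eq_of_toLocalization _ _ (by simp)

lemma ratio_mul (j : Fin (n + 1)) {d e : ℕ} {F G : MvPolynomial (Fin (n + 1)) k}
    (hF : F.IsHomogeneous d) (hG : G.IsHomogeneous e) :
    ratio j (F * G) (hF.mul hG) = ratio j F hF * ratio j G hG := by
  refine ratio_eq_of_toLocalization _ _ ?_
  rw [map_mul, map_mul, ← toLocalization_ratio j F hF, ← toLocalization_ratio j G hG]
  ring

lemma ratio_X_pow (j l : Fin (n + 1)) (N : ℕ) :
    ratio (k := k) l (X j ^ N) (isHomogeneous_X_pow j N) =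
      ratio l (X j) (isHomogeneous_X k j) ^ N := by
  refine ratio_eq_of_toLocalization _ _ ?_
  rw [map_pow, map_pow, ← toLocalization_ratio l (X j) (isHomogeneous_X k j)]
  ring

lemma sectionScalar_projSpace (j : Fin (n + 1)) (c : k) :
    sectionScalar (projSpace k n).hom (chart k n j) c = ratio j (C c) (isHomogeneous_C _ c) := by
  have h2 := sectionScalar_of_toSpecΓ (s := (projSpace k n).hom) (V := (chart k n j).1)
    (CommRingCat.ofHom (algebraMap k (homogeneousSubmodule (Fin (n + 1)) k 0)) ≫
      CommRingCat.ofHom (HomogeneousLocalization.fromZeroRingHom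
          (homogeneousSubmodule (Fin (n + 1)) k) _) ≫
      Proj.awayToSection (homogeneousSubmodule (Fin (n + 1)) k) (X j)) (by
      refine (Category.assoc _ _ _).symm.trans ((congrArg (· ≫ Spec.map _)
        (basicOpen_ι_toSpecZero _ _ (isHomogeneous_X k j) one_pos)).trans ?_)
      exact (Category.assoc _ _ _).trans (congrArg (_ ≫ ·) (Spec.map_comp _ _).symm))
  symm
  refine ratio_eq_of_toLocalization _ _ ?_
  rw [h2, pow_zero, mul_one]
  refine (toLocalization_awayToSection j _).trans ?_
  rfl

lemma ratio_eq_eval₂ (j : Fin (n + 1)) {d : ℕ} (F : MvPolynomial (Fin (n + 1)) k)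
    (hF : F.IsHomogeneous d) :
    ratio j F hF = F.eval₂ (sectionScalar (projSpace k n).hom (chart k n j))
      (fun i => ratio j (X i) (isHomogeneous_X k i)) := by
  refine ratio_eq_of_toLocalization _ _ ?_
  rw [hom_eval₂, mul_comm, ← eval₂_smul_of_isHomogeneous hF]
  have h1 : (toLocalization j).comp (sectionScalar (projSpace k n).hom (chart k n j)) =
      (algebraMap (MvPolynomial (Fin (n + 1)) k) _).comp C := by
    ext c
    rw [RingHom.comp_apply, sectionScalar_projSpace]
    simpa using toLocalization_ratio j (C c) (isHomogeneous_C _ c)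
  have h2 : (algebraMap (MvPolynomial (Fin (n + 1)) k)
      (Localization.Away (X j : MvPolynomial (Fin (n + 1)) k)) (X j)) •
      ((toLocalization j) ∘ (fun i => ratio j (X i) (isHomogeneous_X k i))) =
      (algebraMap (MvPolynomial (Fin (n + 1)) k) _) ∘ X := by
    funext i
    have := toLocalization_ratio j (X i) (isHomogeneous_X k i)
    rw [pow_one, mul_comm] at this
    exact this
  rw [h1]
  refine (congrArg (fun v => eval₂ _ v F) h2).trans ?_
  exact (hom_eval₂ F C (algebraMap _ _) X).symm.trans (by rw [eval₂_eta])

lemma exists_mem_chart (p : (projSpace k n).left) : ∃ j, p ∈ (chart k n j).1 := by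
  have h := Proj.iSup_basicOpen_eq_top' (homogeneousSubmodule (Fin (n + 1)) k)
    (X : Fin (n + 1) → MvPolynomial (Fin (n + 1)) k) (fun i => ⟨1, isHomogeneous_X k i⟩) (by
      refine top_le_iff.mp fun F _ => ?_
      have h1 : F ∈ Algebra.adjoin k (Set.range (X : Fin (n + 1) → MvPolynomial (Fin (n + 1)) k)) :=
        by rw [adjoin_range_X]; trivial
      induction h1 using Algebra.adjoin_induction with
      | mem x hx => exact Algebra.subset_adjoin hx
      | algebraMap r =>
        exact Subalgebra.algebraMap_mem _
          (algebraMap k (homogeneousSubmodule (Fin (n + 1)) k 0) r)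
      | add x y _ _ hx hy => exact add_mem (hx trivial) (hy trivial)
      | mul x y _ _ hx hy => exact mul_mem (hx trivial) (hy trivial))
  have hp : p ∈ (⨆ i, Proj.basicOpen (homogeneousSubmodule (Fin (n + 1)) k) (X i)) := by
    rw [h]; trivial
  exact Opens.mem_iSup.mp hp

lemma germ_ratio (l j : Fin (n + 1)) {d : ℕ} (F : MvPolynomial (Fin (n + 1)) k)
    (hF : F.IsHomogeneous d) (p : (projSpace k n).left) (hl : p ∈ (chart k n l).1)
    (hj : p ∈ (chart k n j).1) :
    (projSpace k n).left.presheaf.germ _ p hl (ratio l F hF) =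
      (projSpace k n).left.presheaf.germ _ p hl (ratio l (X j) (isHomogeneous_X k j)) ^ d *
        (projSpace k n).left.presheaf.germ _ p hj (ratio j F hF) :=
  germ_awayToSection (homogeneousSubmodule (Fin (n + 1)) k) (isHomogeneous_X k l)
    (isHomogeneous_X k j) F (by simpa using hF) p hl hj

lemma basicOpen_ratio (l j : Fin (n + 1)) :
    (projSpace k n).left.basicOpen (ratio l (X j) (isHomogeneous_X k j)) =
      (chart k n l).1 ⊓ (chart k n j).1 :=
  basicOpen_awayToSection (homogeneousSubmodule (Fin (n + 1)) k) (isHomogeneous_X k l)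
    (isHomogeneous_X k j)

end Proj

end Charts

/-! ### Morphisms to projective space -/

section MorphismsToProj

variable {k : Type u} [Field k]

lemma stalkMap_germ_appLE {W Z : Scheme.{u}} (g : W ⟶ Z) {V : Z.Opens} {U : W.Opens}
    (h : U ≤ g ⁻¹ᵁ V) (w : W) (hw : w ∈ U) (a : Γ(Z, V)) :
    (g.stalkMap w).hom (Z.presheaf.germ V (g w) (h hw) a) =
      W.presheaf.germ U w hw (g.appLE V U h a) := by
  refine (Scheme.Hom.germ_stalkMap_apply g V w (h hw) a).trans ?_
  exact (W.presheaf.germ_res_apply (homOfLE h) w hw (g.app V a)).symm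

lemma hom_ext_of_isOpenCover {W Y : Scheme.{u}} {ι : Type*} {V : ι → W.Opens} (hV : IsOpenCover V)
    {α β : W ⟶ Y} (h : ∀ i, (V i).ι ≫ α = (V i).ι ≫ β) : α = β :=
  (W.openCoverOfIsOpenCover V hV).hom_ext _ _ h

lemma exists_hom_of_isOpenCover {W Y : Scheme.{u}} {ι : Type u} {V : ι → W.Opens}
    (hV : IsOpenCover V) (α : ∀ i, (V i : Scheme.{u}) ⟶ Y)
    (h : ∀ (i j : ι) (T : Scheme.{u}) (a : T ⟶ V i) (b : T ⟶ V j),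
      a ≫ (V i).ι = b ≫ (V j).ι → a ≫ α i = b ≫ α j) :
    ∃ β : W ⟶ Y, ∀ i, (V i).ι ≫ β = α i :=
  ⟨(W.openCoverOfIsOpenCover V hV).glueMorphisms α fun i j => h i j _ _ _ pullback.condition,
    fun i => (W.openCoverOfIsOpenCover V hV).ι_glueMorphisms α _ i⟩

section StalkFamilies

variable {W Z : Scheme.{u}} {m : ℕ}

lemma StalkFamily.pullback_mono_at (g : W ⟶ Z) (w : W) {L M : StalkFamily Z m}
    (h : L (g w) ≤ M (g w)) : L.pullback g w ≤ M.pullback g w :=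
  Submodule.span_mono (Set.image_mono h)

lemma StalkFamily.le_of_pullback_le (g : W ⟶ Z) (w : W) [IsIso (g.stalkMap w)]
    {L M : StalkFamily Z m} (h : L.pullback g w ≤ M.pullback g w) : L (g w) ≤ M (g w) := by
  have hbij := ConcreteCategory.bijective_of_isIso (g.stalkMap w)
  have : RingHomSurjective (g.stalkMap w).hom := ⟨hbij.2⟩
  have hinj : Function.Injective (stalkVec m g w) := fun x y hxy =>
    funext fun j => hbij.1 (congrFun hxy j)
  rwa [StalkFamily.pullback, StalkFamily.pullback, Submodule.span_image, Submodule.span_image,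
    Submodule.span_eq, Submodule.span_eq, Submodule.map_le_map_iff_of_injective hinj] at h

lemma StalkFamily.eq_of_pullback_eq (g : W ⟶ Z) (w : W) [IsIso (g.stalkMap w)]
    {L M : StalkFamily Z m} (h : L.pullback g w = M.pullback g w) : L (g w) = M (g w) :=
  le_antisymm (le_of_pullback_le g w h.le) (le_of_pullback_le g w h.ge)

lemma StalkFamily.eq_of_pullback_ι_eq (V : Z.Opens) {L M : StalkFamily Z m}
    (h : L.pullback V.ι = M.pullback V.ι) (z : Z) (hz : z ∈ V) : L z = M z := by
  let w : (V : Scheme.{u}) := ⟨z, hz⟩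
  have : IsIso (V.ι.stalkMap w) := inferInstance
  exact eq_of_pullback_eq V.ι w (congrFun h w)

end StalkFamilies

section Proj
attribute [local instance] MvPolynomial.gradedAlgebra
open MvPolynomial

variable {n : ℕ}

variable (k) in
/-- The vector `(x_0 / x_j, …, x_n / x_j)` of functions on `D₊(x_j)`. -/
abbrev chartVec (j : Fin (n + 1)) : Fin (n + 1) → Γ((projSpace k n).left, chart k n j) :=
  fun i => ratio j (X i) (isHomogeneous_X k i)

lemma germVec_chartVec (l j : Fin (n + 1)) (p : (projSpace k n).left) (hl : p ∈ (chart k n l).1)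
    (hj : p ∈ (chart k n j).1) :
    germVec (chartVec k l) p hl = germVec (chartVec k l) p hl j • germVec (chartVec k j) p hj := by
  ext i
  refine (germ_ratio l j (X i) (isHomogeneous_X k i) p hl hj).trans ?_
  rw [pow_one]
  rfl

lemma taut_eq_span (j : Fin (n + 1)) (p : (projSpace k n).left) (hp : p ∈ (chart k n j).1) :
    taut k n p = Submodule.span _ {germVec (chartVec k j) p hp} := by
  apply le_antisymm
  · refine iSup₂_le fun l hl => ?_
    rw [Submodule.span_singleton_le_iff_mem, Submodule.mem_span_singleton]
    exact ⟨_, (germVec_chartVec l j p hl hp).symm⟩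
  · exact le_iSup₂ (f := fun (l : Fin (n + 1)) (hl : p ∈ (chart k n l).1) =>
      Submodule.span _ {germVec (chartVec k l) p hl}) j hp

section
variable {W : Scheme.{u}} (α : W ⟶ (projSpace k n).left) (w : W)

/-- The pullback along `α` of the vector `(x_0 / x_j, …, x_n / x_j)`, as a vector of germs. -/
abbrev pullbackVec {j : Fin (n + 1)} (hw : α w ∈ (chart k n j).1) :
    Fin (n + 1) → W.presheaf.stalk w :=
  stalkVec (n + 1) α w (germVec (chartVec k j) (α w) hw)

lemma taut_pullback_eq_span {j : Fin (n + 1)} (hw : α w ∈ (chart k n j).1) :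
    (taut k n).pullback α w = Submodule.span _ {pullbackVec α w hw} :=
  StalkFamily.pullback_span α _ w _ (taut_eq_span j (α w) hw)

lemma pullbackVec_self {j : Fin (n + 1)} (hw : α w ∈ (chart k n j).1) :
    pullbackVec α w hw j = 1 := by
  change (α.stalkMap w).hom ((projSpace k n).left.presheaf.germ _ _ hw (ratio j (X j) _)) = 1
  rw [ratio_self, map_one, map_one]

variable {α w}

lemma mem_chart_of_isUnit {v : Fin (n + 1) → W.presheaf.stalk w} {j : Fin (n + 1)}
    (hv : v ∈ (taut k n).pullback α w) (hj : IsUnit (v j)) : α w ∈ (chart k n j).1 := by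
  obtain ⟨l, hl⟩ := exists_mem_chart (α w)
  rw [taut_pullback_eq_span α w hl, Submodule.mem_span_singleton] at hv
  obtain ⟨a, rfl⟩ := hv
  have h1 : IsUnit (pullbackVec α w hl j) := isUnit_of_mul_isUnit_right hj
  have h2 : IsUnit (germVec (chartVec k l) (α w) hl j) := isUnit_of_map_unit (α.stalkMap w).hom _ h1
  have h3 : α w ∈ (projSpace k n).left.basicOpen (ratio l (X j) (isHomogeneous_X k j)) :=
    (Scheme.mem_basicOpen _ _ _ hl).mpr h2
  rw [basicOpen_ratio] at h3
  exact h3.2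

lemma eq_smul_pullbackVec {v : Fin (n + 1) → W.presheaf.stalk w} {j : Fin (n + 1)}
    (hv : v ∈ (taut k n).pullback α w) (hw : α w ∈ (chart k n j).1) :
    v = v j • pullbackVec α w hw := by
  rw [taut_pullback_eq_span α w hw, Submodule.mem_span_singleton] at hv
  obtain ⟨a, rfl⟩ := hv
  rw [Pi.smul_apply, pullbackVec_self, smul_eq_mul, mul_one]

lemma stalkMap_germ_ratio {j : Fin (n + 1)} (hw : α w ∈ (chart k n j).1) {d : ℕ}
    (F : MvPolynomial (Fin (n + 1)) k) (hF : F.IsHomogeneous d) :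
    (α.stalkMap w).hom ((projSpace k n).left.presheaf.germ _ (α w) hw (ratio j F hF)) =
      F.eval₂ (scalar (α ≫ (projSpace k n).hom) w) (pullbackVec α w hw) := by
  rw [ratio_eq_eval₂]
  have h1 := hom_eval₂ F (sectionScalar (projSpace k n).hom (chart k n j))
    ((projSpace k n).left.presheaf.germ _ (α w) hw).hom (chartVec k j)
  rw [germ_sectionScalar] at h1
  refine (congrArg (α.stalkMap w).hom h1).trans ?_
  rw [hom_eval₂, stalkMap_scalar]
  rfl

end

section
variable {W : Scheme.{u}} {α β : W ⟶ (projSpace k n).left} {w : W} {j : Fin (n + 1)}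

lemma pullbackVec_mem_of_pullback_eq
    (e : (taut k n).pullback α w = (taut k n).pullback β w) (hα : α w ∈ (chart k n j).1) :
    pullbackVec α w hα ∈ (taut k n).pullback β w := by
  rw [← e, taut_pullback_eq_span α w hα]
  exact Submodule.mem_span_singleton_self _

lemma mem_chart_of_pullback_eq
    (e : (taut k n).pullback α w = (taut k n).pullback β w) (hα : α w ∈ (chart k n j).1) :
    β w ∈ (chart k n j).1 :=
  mem_chart_of_isUnit (pullbackVec_mem_of_pullback_eq e hα)
    (by rw [pullbackVec_self]; exact isUnit_one)

lemma pullbackVec_eq_of_pullback_eq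
    (e : (taut k n).pullback α w = (taut k n).pullback β w) (hα : α w ∈ (chart k n j).1)
    (hβ : β w ∈ (chart k n j).1) : pullbackVec α w hα = pullbackVec β w hβ := by
  rw [eq_smul_pullbackVec (pullbackVec_mem_of_pullback_eq e hα) hβ, pullbackVec_self, one_smul]

end

lemma projSpace_hom_ext_of_chart {W : Scheme.{u}} {α β : W ⟶ (projSpace k n).left}
    (h : α ≫ (projSpace k n).hom = β ≫ (projSpace k n).hom)
    (e : (taut k n).pullback α = (taut k n).pullback β) (j : Fin (n + 1))
    (hα : ⊤ ≤ α ⁻¹ᵁ (chart k n j).1) (hβ : ⊤ ≤ β ⁻¹ᵁ (chart k n j).1) : α = β := by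
  refine hom_ext_of_affineOpen (chart k n j).2 hα hβ ?_
  ext a
  obtain ⟨d, F, hF, rfl⟩ := ratio_surjective j a
  have hratio (i) : α.appLE (chart k n j) ⊤ hα (chartVec k j i) =
      β.appLE (chart k n j) ⊤ hβ (chartVec k j i) := by
    refine section_ext_germ fun w hw => ?_
    rw [← stalkMap_germ_appLE, ← stalkMap_germ_appLE]
    exact congrFun (pullbackVec_eq_of_pullback_eq (congrFun e w) (hα hw) (hβ hw)) i
  rw [ratio_eq_eval₂]
  refine (hom_eval₂ F (sectionScalar (projSpace k n).hom (chart k n j))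
    (α.appLE (chart k n j) ⊤ hα).hom (chartVec k j)).trans ?_
  refine Eq.trans ?_ (hom_eval₂ F (sectionScalar (projSpace k n).hom (chart k n j))
    (β.appLE (chart k n j) ⊤ hβ).hom (chartVec k j)).symm
  rw [appLE_sectionScalar, appLE_sectionScalar, h]
  congr 1
  exact funext hratio

lemma projSpace_hom_ext {W : Scheme.{u}} {α β : W ⟶ (projSpace k n).left}
    (h : α ≫ (projSpace k n).hom = β ≫ (projSpace k n).hom)
    (e : (taut k n).pullback α = (taut k n).pullback β) : α = β := by
  let U : Fin (n + 1) → W.Opens := fun j => α ⁻¹ᵁ (chart k n j).1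
  have hU : IsOpenCover U :=
    IsOpenCover.mk (top_le_iff.mp fun w _ => Opens.mem_iSup.mpr (exists_mem_chart (α w)))
  refine hom_ext_of_isOpenCover hU fun j => ?_
  refine projSpace_hom_ext_of_chart (by simp [h]) ?_ j (fun w _ => w.2) fun w _ =>
    show β ((U j).ι w) ∈ (chart k n j).1 from mem_chart_of_pullback_eq (congrFun e _) w.2
  rw [StalkFamily.pullback_comp, e, ← StalkFamily.pullback_comp]

lemma exists_chart_ringHom {R : CommRingCat.{u}} (c : k →+* R) (f : Fin (n + 1) → R)
    (j : Fin (n + 1)) (hj : IsUnit (f j)) :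
    ∃ ψ : Γ((projSpace k n).left, chart k n j) ⟶ R,
      ∀ {d : ℕ} (F : MvPolynomial (Fin (n + 1)) k) (hF : F.IsHomogeneous d),
        ψ (ratio j F hF) * f j ^ d = F.eval₂ c f := by
  have hX : IsUnit (eval₂Hom c f (X j)) := by simpa using hj
  refine ⟨CommRingCat.ofHom (R := Γ((projSpace k n).left, chart k n j)) (S := R)
    ((IsLocalization.Away.lift (S := Localization.Away (X j : MvPolynomial (Fin (n + 1)) k))
      (X j) hX).comp (toLocalization j)), fun {d} F hF => ?_⟩
  have hlift := congrArg (IsLocalization.Away.lift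
    (S := Localization.Away (X j : MvPolynomial (Fin (n + 1)) k)) (X j) hX)
    (toLocalization_ratio j F hF)
  rw [map_mul, map_pow, IsLocalization.Away.lift_eq, IsLocalization.Away.lift_eq] at hlift
  simp only [coe_eval₂Hom, eval₂_X] at hlift
  exact hlift

lemma exists_hom_of_isUnit {W : Scheme.{u}} (s : W ⟶ Spec (CommRingCat.of k))
    (f : Fin (n + 1) → Γ(W, ⊤)) (j : Fin (n + 1)) (hj : IsUnit (f j)) :
    ∃ α : W ⟶ (projSpace k n).left, α ≫ (projSpace k n).hom = s ∧
      ∀ w, (taut k n).pullback α w = Submodule.span _ {germVec f w (Opens.mem_top w)} := by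
  obtain ⟨ψ, hψ⟩ := exists_chart_ringHom (sectionScalar s ⊤) f j hj
  let α := homOfAffineOpen (chart k n j).2 ψ
  have hα : ⊤ ≤ α ⁻¹ᵁ (chart k n j).1 := top_le_preimage_homOfAffineOpen _ _
  have hαψ : α.appLE (chart k n j) ⊤ hα = ψ := homOfAffineOpen_appLE _ _
  refine ⟨α, hom_ext_sectionScalar ?_, fun w => ?_⟩
  · rw [← appLE_sectionScalar α _ _ _ hα, hαψ]
    ext c
    change ψ (sectionScalar _ _ c) = _
    rw [sectionScalar_projSpace]
    simpa using hψ (C c) (isHomogeneous_C _ c)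
  · have hw : w ∈ (⊤ : W.Opens) := Opens.mem_top w
    have hvec : germVec f w hw = germVec f w hw j • pullbackVec α w (hα hw) := by
      ext i
      have hf := hψ (X i) (isHomogeneous_X k i)
      rw [pow_one, eval₂_X] at hf
      have hα_i : pullbackVec α w (hα hw) i =
          W.presheaf.germ ⊤ w hw (ψ (ratio j (X i) (isHomogeneous_X k i))) := by
        refine (stalkMap_germ_appLE α hα w hw _).trans ?_
        rw [hαψ]
      rw [Pi.smul_apply, hα_i, smul_eq_mul, mul_comm]
      exact (congrArg _ hf.symm).trans (map_mul _ _ _)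
    have hu : IsUnit (germVec f w hw j) := hj.map _
    rw [taut_pullback_eq_span α w (hα hw), hvec, Submodule.span_singleton_smul_eq hu]

lemma exists_hom_of_local_generators {W : Scheme.{u}} (s : W ⟶ Spec (CommRingCat.of k))
    (M : StalkFamily W (n + 1))
    (hM : ∀ w, ∃ (V : W.Opens) (f : Fin (n + 1) → Γ(W, V)) (j : Fin (n + 1)), w ∈ V ∧
      IsUnit (f j) ∧ ∀ (z : W) (hz : z ∈ V), M z = Submodule.span _ {germVec f z hz}) :
    ∃ α : W ⟶ (projSpace k n).left, α ≫ (projSpace k n).hom = s ∧ (taut k n).pullback α = M := by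
  choose V f j hwV hu hspan using hM
  have hV : IsOpenCover V :=
    IsOpenCover.mk (top_le_iff.mp fun w _ => Opens.mem_iSup.mpr ⟨w, hwV w⟩)
  have hloc : ∀ w, ∃ α : (V w : Scheme.{u}) ⟶ (projSpace k n).left,
      α ≫ (projSpace k n).hom = (V w).ι ≫ s ∧ (taut k n).pullback α = M.pullback (V w).ι := by
    intro w
    obtain ⟨α, h1, h2⟩ := exists_hom_of_isUnit ((V w).ι ≫ s)
      (fun i => (V w).ι.appLE (V w) ⊤ (fun z _ => z.2) (f w i)) (j w) ((hu w).map _)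
    refine ⟨α, h1, funext fun z => ?_⟩
    rw [h2, StalkFamily.pullback_span _ _ _ _ (hspan w ((V w).ι z) z.2)]
    congr 2
    ext i
    exact (stalkMap_germ_appLE (V w).ι (fun z _ => z.2) z (Opens.mem_top z) (f w i)).symm
  choose α h1 h2 using hloc
  obtain ⟨β, hβ⟩ := exists_hom_of_isOpenCover hV α fun x y T a b hc => by
    refine projSpace_hom_ext ?_ ?_
    · rw [Category.assoc, Category.assoc, h1, h1, ← Category.assoc, ← Category.assoc, hc]
    · rw [StalkFamily.pullback_comp, StalkFamily.pullback_comp, h2, h2,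
        ← StalkFamily.pullback_comp, ← StalkFamily.pullback_comp, hc]
  refine ⟨β, hom_ext_of_isOpenCover hV fun x => ?_, funext fun w => ?_⟩
  · rw [← Category.assoc, hβ, h1]
  · refine StalkFamily.eq_of_pullback_ι_eq (V w) ?_ w (hwV w)
    rw [← StalkFamily.pullback_comp, hβ, h2]

end Proj

end MorphismsToProj

/-! ### Morphisms to subschemes of projective space -/

section SubschemesOfProj

variable {k : Type u} [Field k]

section IdealSheaves

variable {Z : Scheme.{u}} (I : Z.IdealSheafData)

lemma exists_pow_mul_mem_ideal (V : Z.affineOpens) (t a : Γ(Z, V))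
    (h : Z.presheaf.map (homOfLE (Z.basicOpen_le t)).op a ∈ I.ideal (Z.affineBasicOpen t)) :
    ∃ N : ℕ, t ^ N * a ∈ I.ideal V := by
  rw [← I.map_ideal_basicOpen] at h
  let : Algebra Γ(Z, V) Γ(Z, Z.basicOpen t) :=
    (Z.presheaf.map (homOfLE (Z.basicOpen_le t)).op).hom.toAlgebra
  have : IsLocalization.Away t Γ(Z, Z.basicOpen t) := V.2.isLocalization_of_eq_basicOpen _ _ rfl
  obtain ⟨_, ⟨N, rfl⟩, hN⟩ :=
    (IsLocalization.algebraMap_mem_map_algebraMap_iff (.powers t) Γ(Z, Z.basicOpen t)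
      (I.ideal V) a).mp h
  exact ⟨N, hN⟩

lemma map_germ_eq_zero_of_mem_ideal {U V : Z.affineOpens} {R : Type*} [CommRing R]
    (p : Z) (hU : p ∈ U.1) (hV : p ∈ V.1) (θ : Z.presheaf.stalk p →+* R)
    (h : ∀ a ∈ I.ideal U, θ (Z.presheaf.germ U.1 p hU a) = 0) :
    ∀ a ∈ I.ideal V, θ (Z.presheaf.germ V.1 p hV a) = 0 := by
  intro a ha
  obtain ⟨D, hD, hpD, hDle⟩ :=
    exists_isAffineOpen_mem_and_subset (x := p) (U := U.1 ⊓ V.1) ⟨hU, hV⟩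
  have hDU : D ≤ U.1 := fun z hz => (hDle hz).1
  have hDV : D ≤ V.1 := fun z hz => (hDle hz).2
  have hker : I.ideal ⟨D, hD⟩ ≤ RingHom.ker (θ.comp (Z.presheaf.germ D p hpD).hom) := by
    rw [← I.map_ideal (U := ⟨D, hD⟩) (V := U) hDU, Ideal.map_le_iff_le_comap]
    intro b hb
    have hb0 := h b hb
    rw [← Z.presheaf.germ_res_apply (homOfLE hDU) p hpD] at hb0
    exact hb0
  have ha0 := hker (I.ideal_le_comap_ideal (U := ⟨D, hD⟩) (V := V) hDV ha)
  rw [← Z.presheaf.germ_res_apply (homOfLE hDV) p hpD]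
  exact ha0

lemma mem_iff_vanishingIdeal (B : Closeds Z) (V : Z.affineOpens) (p : Z) (hp : p ∈ V.1) :
    p ∈ B ↔ ∀ a ∈ (Scheme.IdealSheafData.vanishingIdeal B).ideal V, p ∉ Z.basicOpen a := by
  have hsupport := Scheme.IdealSheafData.mem_support_iff_of_mem
    (I := Scheme.IdealSheafData.vanishingIdeal B) hp
  rw [Scheme.mem_zeroLocus_iff] at hsupport
  refine Iff.trans ?_ hsupport
  exact (Set.ext_iff.mp (Scheme.IdealSheafData.coe_support_vanishingIdeal B) p).symm

end IdealSheaves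

lemma quasiCompact_of_isImmersion {Y P : Scheme.{u}} [IsLocallyNoetherian P] (i : Y ⟶ P)
    [IsImmersion i] : QuasiCompact i := by
  rw [← i.liftCoborder_ι]
  infer_instance

section Proj
attribute [local instance] MvPolynomial.gradedAlgebra
open MvPolynomial

variable {n : ℕ}

lemma map_ratio_eq_pow_mul (l j : Fin (n + 1)) {d : ℕ} (F : MvPolynomial (Fin (n + 1)) k)
    (hF : F.IsHomogeneous d) {D : (projSpace k n).left.Opens} (hl : D ≤ (chart k n l).1)
    (hj : D ≤ (chart k n j).1) :
    (projSpace k n).left.presheaf.map (homOfLE hl).op (ratio l F hF) =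
      (projSpace k n).left.presheaf.map (homOfLE hl).op
        (ratio l (X j) (isHomogeneous_X k j)) ^ d *
      (projSpace k n).left.presheaf.map (homOfLE hj).op (ratio j F hF) := by
  refine section_ext_germ fun p hp => ?_
  rw [map_mul, map_pow]
  have hgerm_l := (projSpace k n).left.presheaf.germ_res_apply (homOfLE hl) p hp
  have hgerm_j := (projSpace k n).left.presheaf.germ_res_apply (homOfLE hj) p hp
  exact (hgerm_l _).trans ((germ_ratio l j F hF p _ _).trans
    (congrArg₂ (fun x y => x ^ d * y) (hgerm_l _) (hgerm_j _)).symm)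

lemma exists_pow_mul_ratio_mem_ideal (I : (projSpace k n).left.IdealSheafData)
    (l j : Fin (n + 1)) {d : ℕ} {F : MvPolynomial (Fin (n + 1)) k} {hF : F.IsHomogeneous d}
    (hFI : ratio j F hF ∈ I.ideal (chart k n j)) :
    ∃ N : ℕ, ratio l (X j) (isHomogeneous_X k j) ^ N * ratio l F hF ∈ I.ideal (chart k n l) := by
  apply exists_pow_mul_mem_ideal
  have hle : (projSpace k n).left.basicOpen (ratio l (X j) (isHomogeneous_X k j)) ≤
      (chart k n j).1 := by
    rw [basicOpen_ratio]; exact inf_le_right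
  rw [map_ratio_eq_pow_mul l j F hF ((projSpace k n).left.basicOpen_le _) hle]
  exact Ideal.mul_mem_left _ _ (I.ideal_le_comap_ideal
    (U := (projSpace k n).left.affineBasicOpen (ratio l (X j) (isHomogeneous_X k j)))
    (V := chart k n j) hle hFI)

lemma exists_ratio_mem_ideal (I : (projSpace k n).left.IdealSheafData) (j : Fin (n + 1))
    (a : Γ((projSpace k n).left, chart k n j)) (ha : a ∈ I.ideal (chart k n j)) :
    ∃ (d : ℕ) (F : MvPolynomial (Fin (n + 1)) k) (hF : F.IsHomogeneous d), ratio j F hF = a ∧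
      ∀ l, ratio l F hF ∈ I.ideal (chart k n l) := by
  obtain ⟨e, G, hG, rfl⟩ := ratio_surjective j a
  choose N hN using fun l => exists_pow_mul_ratio_mem_ideal I l j ha
  let M := ∑ l, N l
  have hM (l) : N l ≤ M := Finset.single_le_sum (fun _ _ => Nat.zero_le _) (Finset.mem_univ l)
  refine ⟨_, _, (isHomogeneous_X_pow j M).mul hG, ?_, fun l => ?_⟩
  · rw [ratio_mul _ (isHomogeneous_X_pow j M) hG, ratio_X_pow, ratio_self, one_pow, one_mul]
  · rw [ratio_mul _ (isHomogeneous_X_pow j M) hG, ratio_X_pow, ← Nat.sub_add_cancel (hM l),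
      pow_add, mul_assoc]
    exact Ideal.mul_mem_left _ _ (hN l)

lemma landsInClosed_taut_pullback_iff (I : (projSpace k n).left.IdealSheafData) {W : Scheme.{u}}
    (α : W ⟶ (projSpace k n).left) :
    LandsInClosed I (α ≫ (projSpace k n).hom) ((taut k n).pullback α) ↔
      ∀ (w : W) (j : Fin (n + 1)) (hw : α w ∈ (chart k n j).1), ∀ a ∈ I.ideal (chart k n j),
        (α.stalkMap w).hom ((projSpace k n).left.presheaf.germ _ (α w) hw a) = 0 := by
  constructor
  · intro h w j hw a ha
    obtain ⟨d, F, hF, rfl, hFI⟩ := exists_ratio_mem_ideal I j a ha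
    rw [stalkMap_germ_ratio]
    exact h d F hF hFI w _
      ((Submodule.span_singleton_le_iff_mem _ _).mp (taut_pullback_eq_span α w hw).ge)
  · intro h d F hF hFI w v hv
    obtain ⟨j, hw⟩ := exists_mem_chart (α w)
    rw [eq_smul_pullbackVec hv hw, eval₂_smul_of_isHomogeneous hF, ← stalkMap_germ_ratio hw F hF,
      h w j hw _ (hFI j), mul_zero]

instance isLocallyNoetherian_projSpace : IsLocallyNoetherian (projSpace k n).left := by
  refine isLocallyNoetherian_of_affine_cover (S := chart k n)
    (top_le_iff.mp fun p _ => Opens.mem_iSup.mpr (exists_mem_chart p)) fun j => ?_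
  refine isNoetherianRing_of_surjective (MvPolynomial (Fin (n + 1)) k) _
    (eval₂Hom (sectionScalar (projSpace k n).hom (chart k n j)) (chartVec k j)) fun a => ?_
  obtain ⟨d, F, hF, rfl⟩ := ratio_surjective j a
  exact ⟨F, (ratio_eq_eval₂ j F hF).symm⟩

lemma landsInClosed_taut_pullback_iff_le_ker (I : (projSpace k n).left.IdealSheafData)
    {W : Scheme.{u}} (α : W ⟶ (projSpace k n).left) :
    LandsInClosed I (α ≫ (projSpace k n).hom) ((taut k n).pullback α) ↔ I ≤ α.ker := by
  rw [landsInClosed_taut_pullback_iff]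
  constructor
  · refine fun h => Scheme.IdealSheafData.le_ofIdeals_iff.mpr fun V a ha =>
      section_ext_germ fun w hw => ?_
    rw [map_zero]
    refine (Scheme.Hom.germ_stalkMap_apply α V.1 w hw a).symm.trans ?_
    obtain ⟨j, hj⟩ := exists_mem_chart (α w)
    exact map_germ_eq_zero_of_mem_ideal I (α w) hj hw (α.stalkMap w).hom (h w j hj) a ha
  · intro h w j hw a ha
    have happ : α.app (chart k n j) a = 0 := α.ideal_ker_le _ (h _ ha)
    exact (Scheme.Hom.germ_stalkMap_apply α _ w hw a).trans
      ((congrArg _ happ).trans (map_zero _))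

lemma mem_of_landsInClosed_vanishingIdeal {B : Closeds (projSpace k n).left} {W : Scheme.{u}}
    {α : W ⟶ (projSpace k n).left}
    (h : LandsInClosed (Scheme.IdealSheafData.vanishingIdeal B) (α ≫ (projSpace k n).hom)
      ((taut k n).pullback α)) (w : W) : α w ∈ B := by
  rw [landsInClosed_taut_pullback_iff_le_ker] at h
  rw [← SetLike.mem_coe, ← Scheme.IdealSheafData.coe_support_vanishingIdeal B]
  exact Scheme.IdealSheafData.support_antitone h (α.range_subset_ker_support ⟨w, rfl⟩)

lemma exists_lift_of_landsInClosed {Y : Sch k} (i : Y ⟶ projSpace k n) [IsImmersion i.left]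
    {W : Scheme.{u}} (α : W ⟶ (projSpace k n).left)
    (h : LandsInClosed i.left.ker (α ≫ (projSpace k n).hom) ((taut k n).pullback α))
    (hα : ∀ w, α w ∈ i.left.coborderRange) : ∃ φ : W ⟶ Y.left, φ ≫ i.left = α := by
  have := quasiCompact_of_isImmersion i.left
  have hker : i.left.imageι.ker ≤ α.ker := by
    rw [Scheme.IdealSheafData.ker_subschemeι]
    exact (landsInClosed_taut_pullback_iff_le_ker _ α).mp h
  have hrange : Set.range α ⊆ Set.range i.left.coborderRange.ι := by
    rw [Scheme.Opens.range_ι]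
    exact Set.range_subset_iff.mpr hα
  obtain ⟨φ, hφ, -⟩ := (IsImmersion.isPullback_toImage_liftCoborder i.left).exists_lift
    (IsClosedImmersion.lift i.left.imageι α hker)
    (IsOpenImmersion.lift i.left.coborderRange.ι α hrange)
    (by rw [IsClosedImmersion.lift_fac, IsOpenImmersion.lift_fac])
  refine ⟨φ, ?_⟩
  have himage := congrArg (φ ≫ ·) i.left.toImage_imageι
  rw [← himage, ← Category.assoc, hφ, IsClosedImmersion.lift_fac]

lemma not_isUnit_eval₂_of_mem {W : Scheme.{u}} {α : W ⟶ (projSpace k n).left} {w : W}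
    {B : Closeds (projSpace k n).left} (hB : α w ∈ B) {d : ℕ} {F : MvPolynomial (Fin (n + 1)) k}
    {hF : F.IsHomogeneous d}
    (hFB : ∀ j, ratio j F hF ∈ (Scheme.IdealSheafData.vanishingIdeal B).ideal (chart k n j))
    {v : Fin (n + 1) → W.presheaf.stalk w} (hv : v ∈ (taut k n).pullback α w) :
    ¬ IsUnit (F.eval₂ (scalar (α ≫ (projSpace k n).hom) w) v) := by
  intro hu
  obtain ⟨j, hj⟩ := exists_mem_chart (α w)
  rw [eq_smul_pullbackVec hv hj, eval₂_smul_of_isHomogeneous hF, ← stalkMap_germ_ratio hj F hF]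
    at hu
  have hgerm := isUnit_of_map_unit (α.stalkMap w).hom _ (isUnit_of_mul_isUnit_right hu)
  exact (mem_iff_vanishingIdeal B (chart k n j) (α w) hj).mp hB _ (hFB j)
    ((Scheme.mem_basicOpen _ _ _ hj).mpr hgerm)

end Proj

end SubschemesOfProj

/-! ### Regularity domains of invertible subsheaves -/

section RegularityDomains

variable {k : Type u} [Field k]

lemma germVec_map {Z : Scheme.{u}} {m : ℕ} {U V : Z.Opens} (h : U ≤ V) (f : Fin m → Γ(Z, V))
    (z : Z) (hz : z ∈ U) :
    germVec (fun j => Z.presheaf.map (homOfLE h).op (f j)) z hz = germVec f z (h hz) :=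
  funext fun j => Z.presheaf.germ_res_apply (homOfLE h) z hz (f j)

lemma stalkMap_eval₂ {W Z : Scheme.{u}} (G : W ⟶ Z) (s : Z ⟶ Spec (CommRingCat.of k)) (w : W)
    {m : ℕ} (v : Fin m → Z.presheaf.stalk (G w)) (F : MvPolynomial (Fin m) k) :
    (G.stalkMap w).hom (F.eval₂ (scalar s (G w)) v) =
      F.eval₂ (scalar (G ≫ s) w) (stalkVec m G w v) := by
  rw [MvPolynomial.hom_eval₂, stalkMap_scalar]
  rfl

lemma germ_eval₂ {Z : Scheme.{u}} {m : ℕ} (s : Z ⟶ Spec (CommRingCat.of k)) {V : Z.Opens}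
    (f : Fin m → Γ(Z, V)) (F : MvPolynomial (Fin m) k) (z : Z) (hz : z ∈ V) :
    Z.presheaf.germ V z hz (F.eval₂ (sectionScalar s V) f) =
      F.eval₂ (scalar s z) (germVec f z hz) := by
  refine (MvPolynomial.hom_eval₂ F (sectionScalar s V) (Z.presheaf.germ V z hz).hom f).trans ?_
  rw [germ_sectionScalar]
  rfl

variable {Z S : Scheme.{u}} {m : ℕ} {p : Z ⟶ S} {L L' : StalkFamily Z m}

lemma IsRegularAt.pullback {Z' : Scheme.{u}} (G : Z' ⟶ Z) {z : Z'} (h : IsRegularAt L (G z)) :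
    IsRegularAt (L.pullback G) z := by
  obtain ⟨v, hv, j, hj⟩ := h
  exact ⟨stalkVec m G z v, Submodule.subset_span ⟨v, hv, rfl⟩, j, hj.map (G.stalkMap z).hom⟩

lemma isRegularAt_iff_of_span {V : Z.Opens} {f : Fin m → Γ(Z, V)} {z : Z} (hz : z ∈ V)
    (h : L z = Submodule.span _ {germVec f z hz}) :
    IsRegularAt L z ↔ ∃ j, z ∈ Z.basicOpen (f j) := by
  constructor
  · rintro ⟨v, hv, j, hj⟩
    rw [h, Submodule.mem_span_singleton] at hv
    obtain ⟨a, rfl⟩ := hv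
    exact ⟨j, (Scheme.mem_basicOpen _ _ _ hz).mpr (isUnit_of_mul_isUnit_right hj)⟩
  · rintro ⟨j, hj⟩
    exact ⟨germVec f z hz, (Submodule.span_singleton_le_iff_mem _ _).mp h.ge, j,
      (Scheme.mem_basicOpen _ _ _ hz).mp hj⟩

lemma IsFlatInvertible.exists_generator (hL : IsFlatInvertible p L) (z : Z) :
    ∃ (V : Z.Opens) (f : Fin m → Γ(Z, V)), z ∈ V ∧
      ∀ (w : Z) (hw : w ∈ V), L w = Submodule.span _ {germVec f w hw} := by
  obtain ⟨V, f, -, hz, h, -⟩ := hL z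
  exact ⟨V, f, hz, h⟩

lemma IsFlatInvertible.exists_generators (hL : IsFlatInvertible p L)
    (hL' : IsFlatInvertible p L') (z : Z) :
    ∃ (V : Z.Opens) (f f' : Fin m → Γ(Z, V)), z ∈ V ∧
      (∀ (w : Z) (hw : w ∈ V), L w = Submodule.span _ {germVec f w hw}) ∧
      ∀ (w : Z) (hw : w ∈ V), L' w = Submodule.span _ {germVec f' w hw} := by
  obtain ⟨V, f, hzV, hf⟩ := hL.exists_generator z
  obtain ⟨V', f', hzV', hf'⟩ := hL'.exists_generator z
  refine ⟨V ⊓ V', fun j => Z.presheaf.map (homOfLE inf_le_left).op (f j),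
    fun j => Z.presheaf.map (homOfLE inf_le_right).op (f' j), ⟨hzV, hzV'⟩,
    fun w hw => ?_, fun w hw => ?_⟩
  · rw [hf w hw.1, germVec_map inf_le_left f w hw]
  · rw [hf' w hw.2, germVec_map inf_le_right f' w hw]

/-- The regularity domain of an invertible subsheaf, as an open subscheme. -/
def IsFlatInvertible.regularLocus (hL : IsFlatInvertible p L) : Z.Opens where
  carrier := {z | IsRegularAt L z}
  is_open' := by
    refine isOpen_iff_mem_nhds.mpr fun z hz => ?_
    obtain ⟨V, f, hzV, h⟩ := hL.exists_generator z
    obtain ⟨j, hj⟩ := (isRegularAt_iff_of_span hzV (h z hzV)).mp hz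
    refine Filter.mem_of_superset ((Z.basicOpen (f j)).2.mem_nhds hj) fun w hw => ?_
    have hwV : w ∈ V := Z.basicOpen_le _ hw
    exact (isRegularAt_iff_of_span hwV (h w hwV)).mpr ⟨j, hw⟩

lemma IsFlatInvertible.exists_isRegularAt [IsIntegral Z] (hL : IsFlatInvertible p L) :
    ∃ z, IsRegularAt L z := by
  obtain ⟨V, f, -, hz, h, hfree, -⟩ := hL (genericPoint Z)
  have : Nonempty V := ⟨⟨_, hz⟩⟩
  obtain ⟨j, hj⟩ : ∃ j, f j ≠ 0 := by
    by_contra! hf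
    exact one_ne_zero (hfree 1 fun j => by rw [hf j, mul_zero])
  have hne : Z.basicOpen (f j) ≠ ⊥ := fun hbot => hj ((basicOpen_eq_bot_iff _).mp hbot)
  obtain ⟨w, hw⟩ := (Opens.ne_bot_iff_nonempty _).mp hne
  have hwV : w ∈ V := Z.basicOpen_le _ hw
  exact ⟨w, (isRegularAt_iff_of_span hwV (h w hwV)).mpr ⟨j, hw⟩⟩

lemma IsFlatInvertible.exists_hom {n : ℕ} {L : StalkFamily Z (n + 1)} (hL : IsFlatInvertible p L)
    (s : Z ⟶ Spec (CommRingCat.of k)) :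
    ∃ α : (hL.regularLocus : Scheme.{u}) ⟶ (projSpace k n).left,
      α ≫ (projSpace k n).hom = hL.regularLocus.ι ≫ s ∧
      (taut k n).pullback α = L.pullback hL.regularLocus.ι := by
  set R := hL.regularLocus
  refine exists_hom_of_local_generators (R.ι ≫ s) (L.pullback R.ι) fun w => ?_
  obtain ⟨V, f, hzV, h⟩ := hL.exists_generator (R.ι w)
  obtain ⟨j, hj⟩ := (isRegularAt_iff_of_span hzV (h _ hzV)).mp w.2
  have hDV : Z.basicOpen (f j) ≤ V := Z.basicOpen_le _
  refine ⟨R.ι ⁻¹ᵁ Z.basicOpen (f j),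
    fun i => R.ι.app _ (Z.presheaf.map (homOfLE hDV).op (f i)), j, hj, ?_, fun z hz => ?_⟩
  · exact (RingedSpace.isUnit_res_basicOpen Z.toRingedSpace (f j)).map _
  · rw [StalkFamily.pullback_span R.ι L z _ (h (R.ι z) (hDV hz)), ← germVec_map hDV f _ hz,
      stalkVec_germVec R.ι _ z hz]

lemma mul_comm_of_span_eq_span {R ι : Type*} [CommRing R] {v v' : ι → R}
    (h : Submodule.span R {v} = Submodule.span R {v'}) (a b : ι) : v a * v' b = v b * v' a := by
  obtain ⟨c, rfl⟩ := Submodule.mem_span_singleton.mp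
    ((Submodule.span_singleton_le_iff_mem _ _).mp h.le)
  simp only [Pi.smul_apply, smul_eq_mul]
  ring

lemma mem_span_singleton_of_mul_comm {R ι : Type*} [CommRing R] {v v' : ι → R}
    (h : ∀ a b, v a * v' b = v b * v' a) {j : ι} (hj : IsUnit (v' j)) :
    v ∈ Submodule.span R {v'} := by
  obtain ⟨c, hc⟩ := hj.exists_right_inv
  refine Submodule.mem_span_singleton.mpr ⟨v j * c, funext fun b => ?_⟩
  rw [Pi.smul_apply, smul_eq_mul]
  linear_combination (-c) * h b j + v b * hc

section Density

variable [IsAffine S] [IsLocallyNoetherian S] [GeometricallyIntegral p] [Flat p]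
  [UniversallyOpen p]

lemma GenericallyAgree.of_surjective (hL : IsFlatInvertible p L) (hL' : IsFlatInvertible p L')
    {U : Z.Opens} (hU : ∀ s, ∃ z ∈ U, p z = s) (h : ∀ z ∈ U, L z = L' z) :
    GenericallyAgree L L' := by
  intro z hz hz'
  obtain ⟨V, f, f', hzV, hf, hf'⟩ := hL.exists_generators hL' z
  have hcomm (a b) : germVec f z hzV a * germVec f' z hzV b =
      germVec f z hzV b * germVec f' z hzV a := by
    have hsections : f a * f' b - f b * f' a = 0 := by
      refine section_eq_zero_of_surjective p hU fun w hw hwU => ?_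
      rw [map_sub, map_mul, map_mul, sub_eq_zero]
      exact mul_comm_of_span_eq_span ((hf w hw).symm.trans ((h w hwU).trans (hf' w hw))) a b
    have hgerms := congrArg (Z.presheaf.germ V z hzV) hsections
    rwa [map_sub, map_mul, map_mul, map_zero, sub_eq_zero] at hgerms
  obtain ⟨j, hj⟩ := (isRegularAt_iff_of_span hzV (hf z hzV)).mp hz
  obtain ⟨l, hl⟩ := (isRegularAt_iff_of_span hzV (hf' z hzV)).mp hz'
  rw [hf z hzV, hf' z hzV]
  apply le_antisymm <;> rw [Submodule.span_singleton_le_iff_mem]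
  · exact mem_span_singleton_of_mul_comm hcomm ((Scheme.mem_basicOpen _ _ _ hzV).mp hl)
  · exact mem_span_singleton_of_mul_comm (fun a b => by simpa only [mul_comm] using hcomm b a)
      ((Scheme.mem_basicOpen _ _ _ hzV).mp hj)

end Density

section LandsInClosed

variable {n : ℕ} {L : StalkFamily Z (n + 1)} {s : Z ⟶ Spec (CommRingCat.of k)}

lemma IsFlatInvertible.landsInClosed_of_eval₂_eq_zero (hL : IsFlatInvertible p L)
    {I : (projSpace k n).left.IdealSheafData}
    (h : ∀ {d : ℕ} (F : MvPolynomial (Fin (n + 1)) k) (hF : F.IsHomogeneous d),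
      (∀ j, ratio j F hF ∈ I.ideal (chart k n j)) →
      ∀ {V : Z.Opens} (f : Fin (n + 1) → Γ(Z, V)), (∀ w (hw : w ∈ V), germVec f w hw ∈ L w) →
        F.eval₂ (sectionScalar s V) f = 0) : LandsInClosed I s L := by
  intro d F hF hI z v hv
  obtain ⟨V, f, hzV, hf⟩ := hL.exists_generator z
  rw [hf z hzV, Submodule.mem_span_singleton] at hv
  obtain ⟨a, rfl⟩ := hv
  have hF0 := h F hF hI f fun w hw => (Submodule.span_singleton_le_iff_mem _ _).mp (hf w hw).ge
  rw [eval₂_smul_of_isHomogeneous hF, ← germ_eval₂, hF0, map_zero, mul_zero]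

lemma IsFlatInvertible.landsInClosed_of_surjective [IsAffine S] [IsLocallyNoetherian S]
    [GeometricallyIntegral p] [Flat p] [UniversallyOpen p] (hL : IsFlatInvertible p L) {U : Z.Opens}
    (hU : ∀ s, ∃ z ∈ U, p z = s) {I : (projSpace k n).left.IdealSheafData}
    (h : LandsInClosed I (U.ι ≫ s) (L.pullback U.ι)) : LandsInClosed I s L := by
  refine hL.landsInClosed_of_eval₂_eq_zero fun F hF hI V f hf =>
    section_eq_zero_of_surjective p hU fun w hw hwU => ?_
  rw [germ_eval₂]
  let w' : (U : Scheme.{u}) := ⟨w, hwU⟩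
  have : IsIso (U.ι.stalkMap w') := inferInstance
  apply (ConcreteCategory.bijective_of_isIso (U.ι.stalkMap w')).1
  refine Eq.trans ?_ (map_zero (U.ι.stalkMap w').hom).symm
  exact (stalkMap_eval₂ U.ι s w' (germVec f (U.ι w') hw) F).trans
    (h _ F hF hI w' _ (Submodule.subset_span ⟨_, hf w hw, rfl⟩))

lemma IsFlatInvertible.landsInClosed_vanishingIdeal [IsIntegral Z] (hL : IsFlatInvertible p L)
    {B : Closeds (projSpace k n).left} {R : Z.Opens} {z₀ : Z}
    (hz₀ : z₀ ∈ R) (α : (R : Scheme.{u}) ⟶ (projSpace k n).left)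
    (hα : α ≫ (projSpace k n).hom = R.ι ≫ s) (e : (taut k n).pullback α = L.pullback R.ι)
    (hB : ∀ w, α w ∈ B) : LandsInClosed (Scheme.IdealSheafData.vanishingIdeal B) s L := by
  refine hL.landsInClosed_of_eval₂_eq_zero fun F hF hI V f hf => ?_
  by_contra hne
  obtain ⟨w, hw⟩ :=
    (Opens.ne_bot_iff_nonempty _).mp fun hbot => hne ((basicOpen_eq_bot_iff _).mp hbot)
  obtain ⟨y, hyR, hy⟩ := nonempty_preirreducible_inter R.2
    (Z.basicOpen (F.eval₂ (sectionScalar s V) f)).2 ⟨z₀, hz₀⟩ ⟨w, hw⟩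
  have hyV : y ∈ V := Z.basicOpen_le _ hy
  let y' : (R : Scheme.{u}) := ⟨y, hyR⟩
  have hmem : stalkVec (n + 1) R.ι y' (germVec f y hyV) ∈ (taut k n).pullback α y' := by
    rw [e]
    exact Submodule.subset_span ⟨_, hf y hyV, rfl⟩
  have hunit : IsUnit (F.eval₂ (scalar s y) (germVec f y hyV)) := by
    rw [← germ_eval₂]
    exact (Scheme.mem_basicOpen _ _ _ hyV).mp hy
  refine not_isUnit_eval₂_of_mem (hB y') hI hmem ?_
  rw [hα]
  exact stalkMap_eval₂ R.ι s y' (germVec f (R.ι y') hyV) F ▸ hunit.map (R.ι.stalkMap y').hom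

end LandsInClosed

end RegularityDomains

/-! ### Quasi-maps and the generically defined maps they present -/

section Presents

variable {k : Type u} [Field k]

lemma isLocallyNoetherian_left (S : Aff k) : IsLocallyNoetherian S.obj.left := by
  have := S.property.2
  exact LocallyOfFiniteType.isLocallyNoetherian S.obj.hom

-- The integral scheme is the closure of the point, with its reduced structure.
lemma exists_integral_hom_specializes (S : Aff k) (s : S.obj.left) :
    ∃ (T : Aff k) (g : T ⟶ S), IsIntegral T.obj.left ∧ ∀ t, s ⤳ g.hom.left t := by
  have := S.property.1
  have := S.property.2
  let P := (S.obj.left.isoSpec.hom s).asIdeal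
  have : P.IsPrime := (S.obj.left.isoSpec.hom s).isPrime
  let R' : CommRingCat := .of (Γ(S.obj.left, ⊤) ⧸ P)
  have : IsDomain R' := inferInstanceAs (IsDomain (Γ(S.obj.left, ⊤) ⧸ P))
  let φ : Γ(S.obj.left, ⊤) ⟶ R' := CommRingCat.ofHom (Ideal.Quotient.mk P)
  have : IsClosedImmersion (Spec.map φ) :=
    IsClosedImmersion.spec_of_surjective φ Ideal.Quotient.mk_surjective
  let g : Spec R' ⟶ S.obj.left := Spec.map φ ≫ S.obj.left.isoSpec.inv
  let T : Aff k := ⟨Over.mk (g ≫ S.obj.hom), inferInstanceAs (IsAffine (Spec R')),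
    inferInstanceAs (LocallyOfFiniteType (g ≫ S.obj.hom))⟩
  refine ⟨T, ⟨Over.homMk g rfl⟩, inferInstanceAs (IsIntegral (Spec R')), fun t => ?_⟩
  change s ⤳ S.obj.left.isoSpec.inv (Spec.map φ t)
  have hs : S.obj.left.isoSpec.inv (S.obj.left.isoSpec.hom s) = s := by
    rw [← Scheme.Hom.comp_apply, Iso.hom_inv_id]
    rfl
  rw [← hs]
  refine Specializes.map ((PrimeSpectrum.le_iff_specializes _ _).mp fun a ha => ?_)
    S.obj.left.isoSpec.inv.continuous
  change φ.hom a ∈ t.asIdeal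
  rw [show φ.hom a = 0 from Ideal.Quotient.eq_zero_iff_mem.mpr ha]
  exact zero_mem _

lemma isIntegral_prodOver {X : Sch k} [GeometricallyIntegral X.hom] (T : Aff k)
    [IsIntegral T.obj.left] : IsIntegral (prodOver T.obj X) := by
  have := isLocallyNoetherian_left T
  infer_instance

variable {X : Sch k} {n : ℕ} {Y : Sch k} {i : Y ⟶ projSpace k n}

lemma Presents.taut_pullback {S : Sch k} {L : StalkFamily (prodOver S X) (n + 1)}
    {φ : GenMap X Y S} (h : Presents i L φ) {W : (prodOver S X).Opens} (hW : W ≤ φ.dom) :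
    (taut k n).pullback ((prodOver S X).homOfLE hW ≫ φ.hom ≫ i.left) = L.pullback W.ι := by
  rw [StalkFamily.pullback_comp, h.2, ← StalkFamily.pullback_comp, Scheme.homOfLE_ι]

lemma Presents.pullback {S T : Sch k} {L : StalkFamily (prodOver S X) (n + 1)}
    {φ : GenMap X Y S} (h : Presents i L φ) (g : T ⟶ S) :
    Presents i (L.pullback (prodMap g X)) (φ.pullback g) := by
  refine ⟨fun z hz => (h.1 _ hz).pullback _, ?_⟩
  rw [← StalkFamily.pullback_comp]
  change (taut k n).pullback ((prodMap g X ∣_ φ.dom ≫ φ.hom) ≫ i.left) =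
    L.pullback ((prodMap g X ⁻¹ᵁ φ.dom).ι ≫ prodMap g X)
  rw [← morphismRestrict_ι, Category.assoc, StalkFamily.pullback_comp, h.2,
    ← StalkFamily.pullback_comp]

lemma GenMap.hom_comp_left_comp_hom {S : Sch k} (φ : GenMap X Y S) :
    (φ.hom ≫ i.left) ≫ (projSpace k n).hom = φ.dom.ι ≫ prodStr S X := by
  rw [Category.assoc, Over.w i, φ.w]

lemma Presents.landsInClosed_iff_le_ker {S : Sch k} {L : StalkFamily (prodOver S X) (n + 1)}
    {φ : GenMap X Y S} (h : Presents i L φ) (I : (projSpace k n).left.IdealSheafData) :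
    LandsInClosed I (φ.dom.ι ≫ prodStr S X) (L.pullback φ.dom.ι) ↔ I ≤ (φ.hom ≫ i.left).ker := by
  rw [← h.2, ← φ.hom_comp_left_comp_hom (i := i), landsInClosed_taut_pullback_iff_le_ker]

lemma Presents.genericallyAgree_of_equiv [GeometricallyIntegral X.hom] {S : Aff k}
    {L L' : StalkFamily (prodOver S.obj X) (n + 1)}
    (hL : IsFlatInvertible (pullback.fst S.obj.hom X.hom) L)
    (hL' : IsFlatInvertible (pullback.fst S.obj.hom X.hom) L')
    {φ φ' : GenMap X Y S.obj} (h : Presents i L φ) (h' : Presents i L' φ') (e : φ ≈ φ') :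
    GenericallyAgree L L' := by
  have := S.property.1
  have := isLocallyNoetherian_left S
  obtain ⟨W, hW, hW', hdom, e⟩ := e
  refine GenericallyAgree.of_surjective hL hL' (isDomainFamily_iff.mp hdom) ?_
  refine StalkFamily.eq_of_pullback_ι_eq W ?_
  rw [← h.taut_pullback hW, ← h'.taut_pullback hW', ← Category.assoc, e, Category.assoc]

variable [IsImmersion i.left]

lemma Presents.equiv_of_genericallyAgree {S : Sch k} {L L' : StalkFamily (prodOver S X) (n + 1)}
    {φ φ' : GenMap X Y S} (h : Presents i L φ) (h' : Presents i L' φ') (e : GenericallyAgree L L') :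
    φ ≈ φ' := by
  refine ⟨φ.dom ⊓ φ'.dom, inf_le_left, inf_le_right, φ.isDomainFamily.inf φ'.isDomainFamily, ?_⟩
  rw [← cancel_mono i.left, Category.assoc, Category.assoc]
  refine projSpace_hom_ext ?_ ?_
  · simp only [Category.assoc, Over.w, GenMap.w, Scheme.homOfLE_ι_assoc]
  · rw [h.taut_pullback, h'.taut_pullback]
    funext w
    have hw : L ((φ.dom ⊓ φ'.dom).ι w) = L' ((φ.dom ⊓ φ'.dom).ι w) :=
      e _ (h.1 _ w.2.1) (h'.1 _ w.2.2)
    exact le_antisymm (StalkFamily.pullback_mono_at _ _ hw.le)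
      (StalkFamily.pullback_mono_at _ _ hw.ge)

variable [GeometricallyIntegral X.hom]

lemma Presents.isQuasiMap {S : Aff k} {L : StalkFamily (prodOver S.obj X) (n + 1)}
    (hL : IsFlatInvertible (pullback.fst S.obj.hom X.hom) L) {φ : GenMap X Y S.obj}
    (h : Presents i L φ) : IsQuasiMap X i S L where
  flatInvertible := hL
  landsInClosure := by
    have := S.property.1
    have := isLocallyNoetherian_left S
    exact hL.landsInClosed_of_surjective (isDomainFamily_iff.mp φ.isDomainFamily)
      ((h.landsInClosed_iff_le_ker _).mpr (Scheme.Hom.le_ker_comp _ _))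
  avoidsBoundary T g := by
    rintro ⟨t⟩ hland
    have := S.property.1
    have := T.property.1
    have hLT := hL.pullback (prodMap_isPullback g.hom X)
    let ψ := φ.pullback g.hom
    obtain ⟨z, hz, -⟩ := isDomainFamily_iff.mp ψ.isDomainFamily t
    have hlandψ := hland.pullback hLT ψ.dom.ι
    rw [← (h.pullback g.hom).2, ← ψ.hom_comp_left_comp_hom (i := i)] at hlandψ
    exact mem_of_landsInClosed_vanishingIdeal hlandψ ⟨z, hz⟩
      (subset_coborder ⟨ψ.hom ⟨z, hz⟩, rfl⟩)

/- Otherwise the base change to `T` would map its whole regularity domain, which is nonempty and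
hence dense because `T × X` is integral, to the boundary of `Y`. -/
lemma IsQuasiMap.exists_mem_coborderRange {S T : Aff k}
    {L : StalkFamily (prodOver S.obj X) (n + 1)} (hq : IsQuasiMap X i S L)
    {R : (prodOver S.obj X).Opens} (hR : ∀ z, IsRegularAt L z → z ∈ R)
    {α : (R : Scheme.{u}) ⟶ (projSpace k n).left}
    (hα : α ≫ (projSpace k n).hom = R.ι ≫ prodStr S.obj X)
    (hαL : (taut k n).pullback α = L.pullback R.ι)
    (g : T ⟶ S) [IsIntegral T.obj.left] :
    ∃ w, α w ∈ i.left.coborderRange ∧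
      ∃ t, g.hom.left t = pullback.fst S.obj.hom X.hom (R.ι w) := by
  have := S.property.1
  have := T.property.1
  have := isIntegral_prodOver (X := X) T
  have hLT := hq.flatInvertible.pullback (prodMap_isPullback g.hom X)
  obtain ⟨z₀, hz₀⟩ := hLT.exists_isRegularAt
  let G := hLT.regularLocus.ι ≫ prodMap g.hom X
  have hrange : Set.range G ⊆ Set.range R.ι := by
    rw [Scheme.Opens.range_ι]
    rintro _ ⟨w, rfl⟩
    exact hR _ (IsRegularAt.of_pullback hq.flatInvertible (prodMap g.hom X)
      (z := hLT.regularLocus.ι w) w.2)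
  let γ : (hLT.regularLocus : Scheme.{u}) ⟶ R := IsOpenImmersion.lift R.ι G hrange
  have hγ : γ ≫ R.ι = G := IsOpenImmersion.lift_fac _ _ _
  by_contra! hboundary
  refine hq.avoidsBoundary T g inferInstance (hLT.landsInClosed_vanishingIdeal hz₀ (γ ≫ α)
    ?_ ?_ fun w hw =>
      hboundary (γ w) hw (pullback.fst T.obj.hom X.hom (hLT.regularLocus.ι w)) ?_)
  · rw [Category.assoc, hα, ← Category.assoc, hγ, Category.assoc, prodMap_str]
  · rw [StalkFamily.pullback_comp, hαL, ← StalkFamily.pullback_comp, hγ,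
      StalkFamily.pullback_comp]
  · have hfst : γ ≫ R.ι ≫ pullback.fst S.obj.hom X.hom =
        hLT.regularLocus.ι ≫ pullback.fst T.obj.hom X.hom ≫ g.hom.left := by
      rw [← Category.assoc, hγ, Category.assoc, prodMap_fst]
    exact congrArg (fun f : (hLT.regularLocus : Scheme.{u}) ⟶ S.obj.left => f w) hfst.symm

lemma IsQuasiMap.isDomainFamily_coborderRange {S : Aff k}
    {L : StalkFamily (prodOver S.obj X) (n + 1)} (hq : IsQuasiMap X i S L)
    {R : (prodOver S.obj X).Opens} (hR : ∀ z, IsRegularAt L z → z ∈ R)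
    {α : (R : Scheme.{u}) ⟶ (projSpace k n).left}
    (hα : α ≫ (projSpace k n).hom = R.ι ≫ prodStr S.obj X)
    (hαL : (taut k n).pullback α = L.pullback R.ι) :
    IsDomainFamily (R.ι ''ᵁ (α ⁻¹ᵁ i.left.coborderRange)) := by
  refine isDomainFamily_iff.mpr fun s => ?_
  obtain ⟨T, g, hT, hsg⟩ := exists_integral_hom_specializes S s
  obtain ⟨w, hw, t, ht⟩ := hq.exists_mem_coborderRange hR hα hαL g
  have hopen := (pullback.fst S.obj.hom X.hom).isOpenMap _
    (R.ι ''ᵁ (α ⁻¹ᵁ i.left.coborderRange)).2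
  exact (hsg t).mem_open hopen ⟨_, ⟨w, hw, rfl⟩, ht.symm⟩

lemma IsQuasiMap.exists_presents {S : Aff k} {L : StalkFamily (prodOver S.obj X) (n + 1)}
    (hq : IsQuasiMap X i S L) : ∃ φ : GenMap X Y S.obj, Presents i L φ := by
  let R := hq.flatInvertible.regularLocus
  obtain ⟨α, hα, hαL⟩ := hq.flatInvertible.exists_hom (prodStr S.obj X)
  let U : (prodOver S.obj X).Opens := R.ι ''ᵁ (α ⁻¹ᵁ i.left.coborderRange)
  have hUR : U ≤ R := by
    rintro _ ⟨w, -, rfl⟩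
    exact w.2
  let β := (prodOver S.obj X).homOfLE hUR ≫ α
  have hβ : β ≫ (projSpace k n).hom = U.ι ≫ prodStr S.obj X := by
    rw [Category.assoc, hα, Scheme.homOfLE_ι_assoc]
  have hβL : (taut k n).pullback β = L.pullback U.ι := by
    rw [StalkFamily.pullback_comp, hαL, ← StalkFamily.pullback_comp, Scheme.homOfLE_ι]
  have hβU (w : (U : Scheme.{u})) : β w ∈ i.left.coborderRange := by
    obtain ⟨w', hw', e⟩ := w.2
    have hww' : (prodOver S.obj X).homOfLE hUR w = w' := by
      apply R.ι.isOpenEmbedding.injective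
      rw [← Scheme.Hom.comp_apply, Scheme.homOfLE_ι]
      exact e.symm
    change α ((prodOver S.obj X).homOfLE hUR w) ∈ _
    rwa [hww']
  have hland := hq.landsInClosure.pullback hq.flatInvertible U.ι
  rw [← hβ, ← hβL] at hland
  obtain ⟨φ, hφ⟩ := exists_lift_of_landsInClosed i β hland hβU
  refine ⟨⟨U, hq.isDomainFamily_coborderRange (fun _ h => h) hα hαL, φ, ?_⟩, fun z hz => hUR hz, ?_⟩
  · rw [← Over.w i, ← Category.assoc, hφ, hβ]
  · change (taut k n).pullback (φ ≫ i.left) = L.pullback U.ι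
    rw [hφ, hβL]

end Presents

/-! ### Extension over an ample cover -/

section Extension

section AmpleCover

variable {Z : Scheme.{u}} {m : ℕ}

lemma exists_pow_smul_extension {V W : Z.Opens} (hV : IsAffineOpen V) (t : Γ(Z, V))
    (hW : Z.basicOpen t ≤ W) (a : Fin m → Γ(Z, W)) :
    ∃ (M : ℕ) (c : Fin m → Γ(Z, V)), ∀ (z : Z) (hz : z ∈ V) (hzt : z ∈ Z.basicOpen t),
      germVec c z hz = Z.presheaf.germ V z hz t ^ M • germVec a z (hW hzt) := by
  have := hV.isLocalization_basicOpen t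
  obtain ⟨⟨_, M, rfl⟩, hM⟩ := IsLocalization.exist_integer_multiples_of_finite (R := Γ(Z, V))
    (Submonoid.powers t) (S := Γ(Z, Z.basicOpen t))
    fun i => Z.presheaf.map (homOfLE hW).op (a i)
  choose c hc using hM
  refine ⟨M, c, fun z hz hzt => funext fun i => ?_⟩
  have hres : Z.presheaf.map (homOfLE (Z.basicOpen_le t)).op (c i) =
      Z.presheaf.map (homOfLE (Z.basicOpen_le t)).op (t ^ M) *
        Z.presheaf.map (homOfLE hW).op (a i) := hc i
  have hgerm := congrArg (Z.presheaf.germ _ z hzt) hres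
  rwa [map_mul, Z.presheaf.germ_res_apply, Z.presheaf.germ_res_apply, Z.presheaf.germ_res_apply,
    map_pow] at hgerm

/-- The loci `opens l` where sections `x_l` of a line bundle on `Z` do not vanish, assumed to be
affine and to cover `Z`, with the functions `ratio l l' = x_{l'} / x_l`. This is how an ample line
bundle enters the extension argument: the bundle itself is not recorded. -/
structure AmpleCover (Z : Scheme.{u}) (ι : Type*) where
  opens : ι → Z.Opens
  isAffineOpen (l : ι) : IsAffineOpen (opens l)
  exists_mem (z : Z) : ∃ l, z ∈ opens l
  ratio (l : ι) : ι → Γ(Z, opens l)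
  basicOpen_ratio (l l' : ι) : Z.basicOpen (ratio l l') = opens l ⊓ opens l'
  germ_ratio (l l' l'' : ι) (z : Z) (hl : z ∈ opens l) (hl' : z ∈ opens l') :
    Z.presheaf.germ _ z hl (ratio l l'') =
      Z.presheaf.germ _ z hl (ratio l l') * Z.presheaf.germ _ z hl' (ratio l' l'')

namespace AmpleCover

/-- The ample cover attached to the pullback of `𝒪(1)` along an affine morphism to `ℙ^N`. -/
def ofIsAffineHom {k : Type u} [Field k] {N : ℕ} (β : Z ⟶ (projSpace k N).left) [IsAffineHom β] :
    AmpleCover Z (Fin (N + 1)) where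
  opens l := β ⁻¹ᵁ (chart k N l).1
  isAffineOpen l := (chart k N l).2.preimage β
  exists_mem z := exists_mem_chart (β z)
  ratio l l' := β.app _ (chartVec k l l')
  basicOpen_ratio l l' := by
    rw [← Scheme.preimage_basicOpen]
    exact congrArg (β ⁻¹ᵁ ·) (GenericMaps.basicOpen_ratio l l')
  germ_ratio l l' l'' z hl hl' := by
    have hchart := congrFun (germVec_chartVec l l' (β z) hl hl') l''
    have hstalk := congrArg (β.stalkMap z).hom hchart
    rw [Pi.smul_apply, smul_eq_mul, map_mul] at hstalk
    have happ (j j' : Fin (N + 1)) (hj : β z ∈ (chart k N j).1) :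
        (β.stalkMap z).hom (germVec (chartVec k j) (β z) hj j') =
          Z.presheaf.germ _ z hj (β.app _ (chartVec k j j')) :=
      Scheme.Hom.germ_stalkMap_apply β _ z hj _
    exact (happ l l'' hl).symm.trans
      (hstalk.trans (congrArg₂ (· * ·) (happ l l' hl) (happ l' l'' hl')))

variable {ι : Type*} (𝒰 : AmpleCover Z ι)

lemma isUnit_germ_ratio {l l' : ι} {z : Z} (hl : z ∈ 𝒰.opens l) (hl' : z ∈ 𝒰.opens l') :
    IsUnit (Z.presheaf.germ _ z hl (𝒰.ratio l l')) := by
  rw [← Scheme.mem_basicOpen, 𝒰.basicOpen_ratio]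
  exact ⟨hl, hl'⟩

/-- Vectors `e l` of sections that glue to a vector of sections of the `M`-th power of the line
bundle: `e l` is the quotient of that vector by `x_l ^ M`. -/
def IsTwistedSection (M : ℕ) (e : ∀ l, Fin m → Γ(Z, 𝒰.opens l)) : Prop :=
  ∀ (l l' : ι) (z : Z) (hl : z ∈ 𝒰.opens l) (hl' : z ∈ 𝒰.opens l'),
    germVec (e l) z hl = Z.presheaf.germ _ z hl (𝒰.ratio l l') ^ M • germVec (e l') z hl'

/-- The subsheaf of `𝒪_Z^m` generated locally by the vectors `e l`. -/
def lineSpan (e : ∀ l, Fin m → Γ(Z, 𝒰.opens l)) : StalkFamily Z m := fun z =>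
  ⨆ (l : ι) (hl : z ∈ 𝒰.opens l), Submodule.span _ {germVec (e l) z hl}

variable {𝒰}

lemma IsTwistedSection.lineSpan_eq {M : ℕ} {e : ∀ l, Fin m → Γ(Z, 𝒰.opens l)}
    (he : 𝒰.IsTwistedSection M e) {l : ι} {z : Z} (hl : z ∈ 𝒰.opens l) :
    𝒰.lineSpan e z = Submodule.span _ {germVec (e l) z hl} := by
  apply le_antisymm
  · refine iSup₂_le fun l' hl' => ?_
    rw [Submodule.span_singleton_le_iff_mem, Submodule.mem_span_singleton]
    exact ⟨_, (he l' l z hl' hl).symm⟩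
  · exact le_iSup₂ (f := fun (l : ι) (hl : z ∈ 𝒰.opens l) =>
      Submodule.span _ {germVec (e l) z hl}) l hl

lemma exists_twisted_extension [Finite ι] {o : ι} (c : Fin m → Γ(Z, 𝒰.opens o)) :
    ∃ (M : ℕ) (e : ∀ l, Fin m → Γ(Z, 𝒰.opens l)),
      ∀ (l : ι) (z : Z) (hl : z ∈ 𝒰.opens l) (ho : z ∈ 𝒰.opens o),
        germVec (e l) z hl = Z.presheaf.germ _ z hl (𝒰.ratio l o) ^ M • germVec c z ho := by
  choose M c' hc' using fun l => exists_pow_smul_extension (𝒰.isAffineOpen l) (𝒰.ratio l o)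
    ((𝒰.basicOpen_ratio l o).le.trans inf_le_right) c
  obtain ⟨B, hB⟩ := (Set.finite_range M).bddAbove
  refine ⟨B, fun l => 𝒰.ratio l o ^ (B - M l) • c' l, fun l z hl ho => ?_⟩
  have hle : M l ≤ B := hB ⟨l, rfl⟩
  have hsmul : germVec (𝒰.ratio l o ^ (B - M l) • c' l) z hl =
      Z.presheaf.germ _ z hl (𝒰.ratio l o) ^ (B - M l) • germVec (c' l) z hl := by
    ext i
    simp only [germVec, Pi.smul_apply, smul_eq_mul, map_mul, map_pow]
  rw [hsmul, hc' l z hl ((𝒰.basicOpen_ratio l o).ge ⟨hl, ho⟩), smul_smul, ← pow_add,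
    Nat.sub_add_cancel hle]

section

variable {S : Scheme.{u}} (p : Z ⟶ S) [IsAffine S] [IsLocallyNoetherian S]
  [GeometricallyIntegral p] [Flat p] [UniversallyOpen p]

lemma isTwistedSection_of_surjective {U : Z.Opens} (hU : ∀ s, ∃ z ∈ U, p z = s) {o : ι}
    (hUo : U ≤ 𝒰.opens o) {c : Fin m → Γ(Z, 𝒰.opens o)} {M : ℕ}
    {e : ∀ l, Fin m → Γ(Z, 𝒰.opens l)}
    (he : ∀ (l : ι) (z : Z) (hl : z ∈ 𝒰.opens l) (ho : z ∈ 𝒰.opens o),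
      germVec (e l) z hl = Z.presheaf.germ _ z hl (𝒰.ratio l o) ^ M • germVec c z ho) :
    𝒰.IsTwistedSection M e := by
  intro l l' z hl hl'
  ext i
  let d : Γ(Z, 𝒰.opens l ⊓ 𝒰.opens l') :=
    Z.presheaf.map (homOfLE inf_le_left).op (e l i) -
      Z.presheaf.map (homOfLE inf_le_left).op (𝒰.ratio l l') ^ M *
        Z.presheaf.map (homOfLE inf_le_right).op (e l' i)
  have hgerm (w : Z) (hw : w ∈ 𝒰.opens l ⊓ 𝒰.opens l') : Z.presheaf.germ _ w hw d =
      germVec (e l) w hw.1 i -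
        Z.presheaf.germ _ w hw.1 (𝒰.ratio l l') ^ M * germVec (e l') w hw.2 i := by
    rw [map_sub, map_mul, map_pow, Z.presheaf.germ_res_apply, Z.presheaf.germ_res_apply,
      Z.presheaf.germ_res_apply]
    rfl
  have hd : d = 0 := section_eq_zero_of_surjective p hU fun w hw hwU => by
    rw [hgerm, he l w hw.1 (hUo hwU), he l' w hw.2 (hUo hwU), 𝒰.germ_ratio l l' o w hw.1 hw.2,
      mul_pow, Pi.smul_apply, Pi.smul_apply, smul_eq_mul, smul_eq_mul, mul_assoc, sub_self]
  have hz := hgerm z ⟨hl, hl'⟩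
  rw [hd, map_zero] at hz
  exact sub_eq_zero.mp hz.symm

lemma IsTwistedSection.isFlatInvertible {M : ℕ} {e : ∀ l, Fin m → Γ(Z, 𝒰.opens l)}
    (he : 𝒰.IsTwistedSection M e) {U : Z.Opens} (hU : ∀ s, ∃ z ∈ U, p z = s) (j : Fin m)
    (hj : ∀ (l : ι) (z : Z) (hl : z ∈ 𝒰.opens l), z ∈ U → IsUnit (germVec (e l) z hl j)) :
    IsFlatInvertible p (𝒰.lineSpan e) := by
  intro z
  obtain ⟨l, hl⟩ := 𝒰.exists_mem z
  have hbasic (w : Z) (hw : w ∈ 𝒰.opens l) (hwU : w ∈ U) : w ∈ Z.basicOpen (e l j) :=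
    (Scheme.mem_basicOpen _ _ _ hw).mpr (hj l w hw hwU)
  refine ⟨𝒰.opens l, e l, 𝒰.isAffineOpen l, hl, fun _ hw => he.lineSpan_eq hw, fun a ha => ?_,
    flat_quotient_span_singleton_of_surjective p hU (𝒰.isAffineOpen l) (e l) j hbasic⟩
  refine eq_zero_of_mul_eq_zero_of_surjective p hU (𝒰.isAffineOpen l) (J := {e l j})
    (fun w hw hwU => ⟨e l j, rfl, hbasic w hw hwU⟩) ?_
  rintro _ rfl
  rw [mul_comm, ha j]

lemma exists_isFlatInvertible_extension [Finite ι] {o : ι} (h : Γ(Z, 𝒰.opens o))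
    (hh : ∀ s, ∃ z ∈ Z.basicOpen h, p z = s) (a : Fin m → Γ(Z, Z.basicOpen h)) {j : Fin m}
    (ha : IsUnit (a j)) :
    ∃ L : StalkFamily Z m, IsFlatInvertible p L ∧
      ∀ (z : Z) (hz : z ∈ Z.basicOpen h), L z = Submodule.span _ {germVec a z hz} := by
  have ho : Z.basicOpen h ≤ 𝒰.opens o := Z.basicOpen_le h
  obtain ⟨M₀, c, hc⟩ := exists_pow_smul_extension (𝒰.isAffineOpen o) h le_rfl a
  obtain ⟨M, e, he⟩ := 𝒰.exists_twisted_extension c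
  have htwisted : 𝒰.IsTwistedSection M e := isTwistedSection_of_surjective p hh ho he
  have hgerm (l : ι) (z : Z) (hl : z ∈ 𝒰.opens l) (hz : z ∈ Z.basicOpen h) :
      ∃ r : Z.presheaf.stalk z, IsUnit r ∧ germVec (e l) z hl = r • germVec a z hz := by
    refine ⟨_, ((𝒰.isUnit_germ_ratio hl (ho hz)).pow M).mul
      (((Scheme.mem_basicOpen _ _ _ (ho hz)).mp hz).pow M₀), ?_⟩
    rw [he l z hl (ho hz), hc z (ho hz) hz, smul_smul]
  refine ⟨𝒰.lineSpan e, htwisted.isFlatInvertible p hh j fun l z hl hz => ?_, fun z hz => ?_⟩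
  · obtain ⟨r, hr, hre⟩ := hgerm l z hl hz
    rw [hre]
    exact hr.mul (ha.map (Z.presheaf.germ _ z hz).hom)
  · obtain ⟨r, hr, hre⟩ := hgerm o z (ho hz) hz
    rw [htwisted.lineSpan_eq (ho hz), hre]
    exact Submodule.span_singleton_smul_eq hr _

end

end AmpleCover

end AmpleCover

section LocalSurjectivity

variable {k : Type u} [Field k] {n : ℕ}

lemma exists_germVec_eq_pullbackVec {Z : Scheme.{u}} {U : Z.Opens}
    (α : (U : Scheme.{u}) ⟶ (projSpace k n).left) {j : Fin (n + 1)}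
    (hα : ∀ w, α w ∈ (chart k n j).1) :
    ∃ a : Fin (n + 1) → Γ(Z, U), a j = 1 ∧
      ∀ w, stalkVec (n + 1) U.ι w (germVec a (U.ι w) w.2) = pullbackVec α w (hα w) := by
  let b (l : Fin (n + 1)) : Γ(U, ⊤) := α.appLE (chart k n j).1 ⊤ (fun w _ => hα w) (chartVec k j l)
  have hι : U.topIso.hom ≫ U.ι.appLE U ⊤ (fun w _ => w.2) = 𝟙 _ := by
    rw [← U.topIso.hom_inv_id]
    congr 1
    simp only [Scheme.Opens.topIso_inv, Scheme.Hom.appLE, Scheme.Opens.ι_app]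
    exact (Z.presheaf.map_comp _ _).symm
  refine ⟨fun l => U.topIso.hom (b l), ?_, fun w => funext fun l => ?_⟩
  · have hb : b j = 1 := (congrArg _ (ratio_self j)).trans (map_one _)
    exact (congrArg U.topIso.hom hb).trans (map_one _)
  · refine (stalkMap_germ_appLE U.ι (U := ⊤) (fun w _ => w.2) w trivial _).trans ?_
    rw [show U.ι.appLE U ⊤ _ (U.topIso.hom (b l)) = b l from ConcreteCategory.congr_hom hι (b l)]
    exact (stalkMap_germ_appLE α (V := (chart k n j).1) (U := ⊤) (fun w _ => hα w) w trivial
      (chartVec k j l)).symm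

variable {X Y : Sch k}

lemma exists_isOpenImmersion_surjective (S : Aff k) {U : (prodOver S.obj X).Opens}
    {z : prodOver S.obj X} (hz : z ∈ U) :
    ∃ (T : Aff k) (g : T ⟶ S), IsOpenImmersion g.hom.left ∧
      pullback.fst S.obj.hom X.hom z ∈ Set.range g.hom.left ∧
      ∀ t, ∃ w ∈ prodMap g.hom X ⁻¹ᵁ U, pullback.fst T.obj.hom X.hom w = t := by
  have := S.property.2
  let V : S.obj.left.Opens := ⟨_, (pullback.fst S.obj.hom X.hom).isOpenMap _ U.2⟩
  obtain ⟨T₀, hT₀, hzT₀, hT₀V⟩ := exists_isAffineOpen_mem_and_subset (U := V)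
    (x := pullback.fst S.obj.hom X.hom z) ⟨z, hz, rfl⟩
  let T : Aff k := ⟨Over.mk (T₀.ι ≫ S.obj.hom), hT₀,
    inferInstanceAs (LocallyOfFiniteType (T₀.ι ≫ S.obj.hom))⟩
  let g : T ⟶ S := ⟨Over.homMk T₀.ι rfl⟩
  refine ⟨T, g, inferInstanceAs (IsOpenImmersion T₀.ι), ⟨⟨_, hzT₀⟩, rfl⟩, fun t => ?_⟩
  obtain ⟨y, hy, hyt⟩ := hT₀V t.2
  obtain ⟨w, hw, hwt⟩ := Scheme.exists_preimage_of_isPullback (prodMap_isPullback g.hom X) y t hyt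
  exact ⟨w, show prodMap g.hom X w ∈ U from hw ▸ hy, hwt⟩

lemma GenMap.preimage_image_preimage {S T : Sch k} (g : T ⟶ S) (φ : GenMap X Y S)
    (f : Y.left ⟶ (projSpace k n).left) (V : (projSpace k n).left.Opens) :
    (φ.pullback g).dom.ι ''ᵁ (((φ.pullback g).hom ≫ f) ⁻¹ᵁ V) =
      prodMap g X ⁻¹ᵁ (φ.dom.ι ''ᵁ ((φ.hom ≫ f) ⁻¹ᵁ V)) := by
  rw [← image_morphismRestrict_preimage]
  rfl

lemma isAffineHom_snd_comp (S : Aff k) {Z : Scheme.{u}} (c : X.left ⟶ Z) [IsAffineHom c] :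
    IsAffineHom (pullback.snd S.obj.hom X.hom ≫ c) := by
  have := S.property.1
  have : IsAffineHom (pullback.snd S.obj.hom X.hom) :=
    isAffineHom_isStableUnderBaseChange.of_isPullback (IsPullback.of_hasPullback _ _)
      (inferInstanceAs (IsAffineHom S.obj.hom))
  infer_instance

variable [GeometricallyIntegral X.hom]

lemma AmpleCover.exists_presents {i : Y ⟶ projSpace k n} {S : Aff k} {ι : Type*} [Finite ι]
    (𝒰 : AmpleCover (prodOver S.obj X) ι) (φ : GenMap X Y S.obj) {o : ι}
    (h : Γ(prodOver S.obj X, 𝒰.opens o)) {j : Fin (n + 1)}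
    (hj : (prodOver S.obj X).basicOpen h ≤ φ.dom.ι ''ᵁ ((φ.hom ≫ i.left) ⁻¹ᵁ (chart k n j).1))
    (hh : ∀ s, ∃ z ∈ (prodOver S.obj X).basicOpen h, pullback.fst S.obj.hom X.hom z = s) :
    ∃ L : StalkFamily (prodOver S.obj X) (n + 1),
      IsFlatInvertible (pullback.fst S.obj.hom X.hom) L ∧
      ∃ ψ : GenMap X Y S.obj, ψ ≈ φ ∧ Presents i L ψ := by
  have := S.property.1
  have := isLocallyNoetherian_left S
  let U := (prodOver S.obj X).basicOpen h
  have hdom : U ≤ φ.dom := hj.trans (φ.dom.ι_image_le _)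
  let α : (U : Scheme.{u}) ⟶ (projSpace k n).left :=
    ((prodOver S.obj X).homOfLE hdom ≫ φ.hom) ≫ i.left
  have hα (w : (U : Scheme.{u})) : α w ∈ (chart k n j).1 := by
    obtain ⟨w', hw', e⟩ := hj w.2
    have hww' : (prodOver S.obj X).homOfLE hdom w = w' := by
      apply φ.dom.ι.isOpenEmbedding.injective
      rw [← Scheme.Hom.comp_apply, Scheme.homOfLE_ι]
      exact e.symm
    change (φ.hom ≫ i.left) ((prodOver S.obj X).homOfLE hdom w) ∈ _
    rwa [hww']
  obtain ⟨a, haj, ha⟩ := exists_germVec_eq_pullbackVec α hα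
  obtain ⟨L, hL, hLa⟩ := 𝒰.exists_isFlatInvertible_extension (pullback.fst S.obj.hom X.hom) h hh a
    (haj ▸ isUnit_one)
  have hU : IsDomainFamily U := isDomainFamily_iff.mpr hh
  refine ⟨L, hL, ⟨U, hU, (prodOver S.obj X).homOfLE hdom ≫ φ.hom, ?_⟩,
    ⟨U, le_rfl, hdom, hU, by simp⟩, fun z hz => ?_, funext fun w => ?_⟩
  · rw [Category.assoc, φ.w, Scheme.homOfLE_ι_assoc]
  · refine (isRegularAt_iff_of_span hz (hLa z hz)).mpr ⟨j, ?_⟩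
    rw [haj]
    simpa using hz
  · rw [StalkFamily.pullback_span U.ι L w _ (hLa (U.ι w) w.2), ha w]
    exact taut_pullback_eq_span α w (hα w)

lemma GenMap.exists_presents_pullback (hX : IsProjective X) (i : Y ⟶ projSpace k n) {S : Aff k}
    (φ : GenMap X Y S.obj) (s : S.obj.left) :
    ∃ (T : Aff k) (g : T ⟶ S), IsOpenImmersion g.hom.left ∧ s ∈ Set.range g.hom.left ∧
      ∃ L : StalkFamily (prodOver T.obj X) (n + 1),
        IsFlatInvertible (pullback.fst T.obj.hom X.hom) L ∧
        ∃ ψ : GenMap X Y T.obj, ψ ≈ φ.pullback g.hom ∧ Presents i L ψ := by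
  obtain ⟨N, c, hc⟩ := hX
  obtain ⟨z, hz, rfl⟩ := isDomainFamily_iff.mp φ.isDomainFamily s
  have (S : Aff k) := isAffineHom_snd_comp S c.left
  let β (S : Aff k) := pullback.snd S.obj.hom X.hom ≫ c.left
  obtain ⟨o, ho⟩ := exists_mem_chart (β S z)
  obtain ⟨j, hj⟩ := exists_mem_chart ((φ.hom ≫ i.left) ⟨z, hz⟩)
  obtain ⟨h, hle, hzh⟩ := ((chart k N o).2.preimage (β S)).exists_basicOpen_le
    (V := φ.dom.ι ''ᵁ ((φ.hom ≫ i.left) ⁻¹ᵁ (chart k n j).1)) ⟨z, ⟨_, hj, rfl⟩⟩ ho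
  obtain ⟨T, g, hg, hzg, hsurj⟩ := exists_isOpenImmersion_surjective S hzh
  have hβ : prodMap g.hom X ≫ β S = β T := by
    rw [← Category.assoc, prodMap_snd]
  have : IsAffineHom (prodMap g.hom X ≫ β S) := hβ ▸ inferInstanceAs (IsAffineHom (β T))
  have hh : (prodOver T.obj X).basicOpen ((prodMap g.hom X).app _ h) =
      prodMap g.hom X ⁻¹ᵁ (prodOver S.obj X).basicOpen h :=
    (Scheme.preimage_basicOpen _ h).symm
  refine ⟨T, g, hg, hzg, (AmpleCover.ofIsAffineHom (prodMap g.hom X ≫ β S)).exists_presents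
    (φ.pullback g.hom) (o := o) (j := j) ((prodMap g.hom X).app _ h) ?_ ?_⟩
  · exact hh.le.trans fun _ hw => (φ.preimage_image_preimage g.hom i.left _).ge (hle hw)
  · exact fun t => (hsurj t).imp fun _ hw => ⟨hh.ge hw.1, hw.2⟩

end LocalSurjectivity

end Extension

/-! ### The map from quasi-maps to generically defined maps -/

section AssociatedMap

variable {k : Type u} [Field k] {X Y : Sch k} {n : ℕ} {i : Y ⟶ projSpace k n} [IsImmersion i.left]

lemma IsAssociatedMap.app_eq {η : QMap X i ⟶ GMap X Y} (h : IsAssociatedMap i η)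
    {S : (Aff k)ᵒᵖ} {q : (QMap X i).obj S} {φ : GenMap X Y S.unop.obj} (hφ : Presents i q.1 φ) :
    η.app S q = Quotient.mk _ φ := by
  obtain ⟨ψ, hψ, hψq⟩ := h S q
  rw [hψq]
  exact Quotient.sound (hψ.equiv_of_genericallyAgree hφ fun _ _ _ => rfl)

variable [GeometricallyIntegral X.hom]

variable (X i) in
lemma equivalence_relE (S : (Aff k)ᵒᵖ) : Equivalence (relE X i S) where
  refl _ _ _ _ := rfl
  symm h z hz hz' := (h z hz' hz).symm
  trans {q₁ q₂ q₃} h₁₂ h₂₃ := by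
    obtain ⟨φ₁, hφ₁⟩ := q₁.2.exists_presents
    obtain ⟨φ₂, hφ₂⟩ := q₂.2.exists_presents
    obtain ⟨φ₃, hφ₃⟩ := q₃.2.exists_presents
    exact hφ₁.genericallyAgree_of_equiv q₁.2.flatInvertible q₃.2.flatInvertible hφ₃
      (Setoid.trans (hφ₁.equiv_of_genericallyAgree hφ₂ h₁₂)
        (hφ₂.equiv_of_genericallyAgree hφ₃ h₂₃))

variable (X i) in
/-- The map `η` of the theorem: a quasi-map is sent to the generically defined map it presents. -/
def associatedMap : QMap X i ⟶ GMap X Y where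
  app S := ↾fun q => Quotient.mk _ q.2.exists_presents.choose
  naturality S T g := by
    ext q
    exact Quotient.sound
      (((QMap X i).map g q).2.exists_presents.choose_spec.equiv_of_genericallyAgree
        (q.2.exists_presents.choose_spec.pullback g.unop.hom) fun _ _ _ => rfl)

variable (X i) in
lemma isAssociatedMap_associatedMap : IsAssociatedMap i (associatedMap X i) :=
  fun _ q => ⟨_, q.2.exists_presents.choose_spec, rfl⟩

namespace IsAssociatedMap

variable {η : QMap X i ⟶ GMap X Y} (h : IsAssociatedMap i η)
include h

lemma unique {η' : QMap X i ⟶ GMap X Y} (h' : IsAssociatedMap i η') : η = η' := by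
  ext S q
  obtain ⟨φ, hφ⟩ := q.2.exists_presents
  exact (h.app_eq hφ).trans (h'.app_eq hφ).symm

lemma app_eq_app_iff {S : (Aff k)ᵒᵖ} (q q' : (QMap X i).obj S) :
    η.app S q = η.app S q' ↔ relE X i S q q' := by
  obtain ⟨φ, hφ⟩ := q.2.exists_presents
  obtain ⟨φ', hφ'⟩ := q'.2.exists_presents
  rw [h.app_eq hφ, h.app_eq hφ']
  exact ⟨fun e => hφ.genericallyAgree_of_equiv q.2.flatInvertible q'.2.flatInvertible hφ'
    (Quotient.exact e), fun e => Quotient.sound (hφ.equiv_of_genericallyAgree hφ' e)⟩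

/-- The value at `S` of the map `Φ` of the theorem. -/
def descFun (S : (Aff k)ᵒᵖ) : Quot (relE X i S) → (GMap X Y).obj S :=
  Quot.lift (fun q : (QMap X i).obj S => (η.app S q : (GMap X Y).obj S))
    fun q q' e => (h.app_eq_app_iff q q').mpr e

lemma descFun_map {S T : (Aff k)ᵒᵖ} (g : S ⟶ T) (q : (QMapModE X i).obj S) :
    h.descFun T ((QMapModE X i).map g q) = (GMap X Y).map g (h.descFun S q) := by
  revert q
  refine Quot.ind fun q => ?_
  have hη := NatTrans.naturality_apply η g q
  exact hη

/-- The map `Φ` of the theorem, induced by `η` on the quotient by `ℰ_Y`. -/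
def desc : QMapModE X i ⟶ GMap X Y where
  app S := ↾(h.descFun S)
  naturality _ _ g := ConcreteCategory.hom_ext _ _ fun q => h.descFun_map g q

lemma toQuotient_desc : toQuotient X i ≫ h.desc = η := rfl

lemma desc_injective (S : (Aff k)ᵒᵖ) : Function.Injective (h.desc.app S) := by
  intro q q' e
  induction q using Quot.inductionOn with | _ q
  induction q' using Quot.inductionOn with | _ q'
  exact Quot.sound ((h.app_eq_app_iff q q').mp e)

lemma eq_desc {Φ : QMapModE X i ⟶ GMap X Y} (hΦ : IsAssociatedMap i (toQuotient X i ≫ Φ)) :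
    Φ = h.desc := by
  ext S q
  induction q using Quot.inductionOn with | _ q
  exact ConcreteCategory.congr_hom (NatTrans.congr_app (hΦ.unique h) S) q

lemma isIso_sheafification_desc (hX : IsProjective X) :
    IsIso ((zariskiSheafification k).map h.desc) := by
  let f := Functor.whiskerRight h.desc uliftFunctor.{u + 1, u}
  change IsIso ((presheafToSheaf (zariski k) (Type (u + 1))).map f)
  rw [← GrothendieckTopology.W_iff]
  have : Presheaf.IsLocallyInjective (zariski k) f := by
    refine Presheaf.isLocallyInjective_of_injective _ _ fun S => ?_
    rintro ⟨q⟩ ⟨q'⟩ e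
    exact congrArg ULift.up (h.desc_injective S (congrArg ULift.down e))
  have : Presheaf.IsLocallySurjective (zariski k) f := by
    refine ⟨fun {S} ⟨x⟩ => ?_⟩
    induction x using Quotient.inductionOn with | _ φ
    intro s
    obtain ⟨T, g, hg, hs, L, hL, ψ, hψφ, hψ⟩ := φ.exists_presents_pullback hX i s
    let q : (QMap X i).obj (op T) := ⟨L, hψ.isQuasiMap hL⟩
    refine ⟨T, g, ⟨ULift.up (Quot.mk _ q), congrArg ULift.up ?_⟩, hg, hs⟩
    exact (h.app_eq (q := q) hψ).trans (Quotient.sound hψφ)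
  exact (zariski k).W_of_isLocallyBijective f

end IsAssociatedMap

end AssociatedMap

end GenericMaps

end

theorem mainTheorem4_general {k : Type u} [Field k] (X : Sch k) [GeometricallyIntegral X.hom]
    (hX : IsProjective X) (Y : Sch k) (n : ℕ) (i : Y ⟶ projSpace k n) [IsImmersion i.left] :
    (∀ S, Equivalence (relE X i S)) ∧
    (∃! η : QMap X i ⟶ GMap X Y, IsAssociatedMap i η) ∧
    (∀ η : QMap X i ⟶ GMap X Y, IsAssociatedMap i η →
      ∃ Φ : QMapModE X i ⟶ GMap X Y, toQuotient X i ≫ Φ = η ∧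
        IsIso ((zariskiSheafification k).map Φ)) ∧
    (∀ (n' : ℕ) (i' : Y ⟶ projSpace k n') [IsImmersion i'.left],
      ∃ e : (zariskiSheafification k).obj (QMapModE X i) ≅
          (zariskiSheafification k).obj (QMapModE X i'),
        ∀ (Φ : QMapModE X i ⟶ GMap X Y) (Φ' : QMapModE X i' ⟶ GMap X Y),
          IsAssociatedMap i (toQuotient X i ≫ Φ) → IsAssociatedMap i' (toQuotient X i' ≫ Φ') →
          e.hom ≫ (zariskiSheafification k).map Φ' = (zariskiSheafification k).map Φ) := by
  have hη := isAssociatedMap_associatedMap X i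
  refine ⟨equivalence_relE X i, ⟨_, hη, fun η' hη' => hη'.unique hη⟩,
    fun η h => ⟨h.desc, h.toQuotient_desc, h.isIso_sheafification_desc hX⟩, fun n' i' _ => ?_⟩
  have hη' := isAssociatedMap_associatedMap X i'
  have := hη.isIso_sheafification_desc hX
  have := hη'.isIso_sheafification_desc hX
  refine ⟨asIso ((zariskiSheafification k).map hη.desc) ≪≫
    (asIso ((zariskiSheafification k).map hη'.desc)).symm, fun Φ Φ' hΦ hΦ' => ?_⟩
  rw [hη.eq_desc hΦ, hη'.eq_desc hΦ']
  simp

theorem mainTheorem4 {k : Type u} [Field k] [IsAlgClosed k] [CharZero k]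
    (X : Sch k) [ConnectedSpace X.left] [SmoothOfRelativeDimension 1 X.hom] (hX : IsProjective X)
    (Y : Sch k) (n : ℕ) (i : Y ⟶ projSpace k n) [IsImmersion i.left] :
    (∀ S, Equivalence (relE X i S)) ∧
    (∃! η : QMap X i ⟶ GMap X Y, IsAssociatedMap i η) ∧
    (∀ η : QMap X i ⟶ GMap X Y, IsAssociatedMap i η →
      ∃ Φ : QMapModE X i ⟶ GMap X Y, toQuotient X i ≫ Φ = η ∧
        IsIso ((zariskiSheafification k).map Φ)) ∧
    (∀ (n' : ℕ) (i' : Y ⟶ projSpace k n') [IsImmersion i'.left],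
      ∃ e : (zariskiSheafification k).obj (QMapModE X i) ≅
          (zariskiSheafification k).obj (QMapModE X i'),
        ∀ (Φ : QMapModE X i ⟶ GMap X Y) (Φ' : QMapModE X i' ⟶ GMap X Y),
          IsAssociatedMap i (toQuotient X i ≫ Φ) → IsAssociatedMap i' (toQuotient X i' ≫ Φ') →
          e.hom ≫ (zariskiSheafification k).map Φ' = (zariskiSheafification k).map Φ) := by
  have : Smooth X.hom := SmoothOfRelativeDimension.smooth 1 X.hom
  have : IsIntegral X.left := isIntegral_of_smooth_of_connectedSpace X.hom
  have : GeometricallyIntegral X.hom := geometricallyIntegral_of_isAlgClosed X.hom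
  exact mainTheorem4_general X hX Y n i
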